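/- Let $M$ be a smooth manifold and $E$ an exact real Courant algebroid over $M$, i.e. a smooth real vector bundle that is an extension $0\to T^*M\to E\xrightarrow{\pi} TM\to 0$, with a nondegenerate symmetric pairing and a Courant bracket on its sheaf of sections. Let $(\mathcal J_+,\mathcal J_-)$ be a generalized Kähler structure on $E$: two commuting generalized complex structures (orthogonal endomorphisms of $E$ with square $-1$ and involutive $+i$-eigenbundles $L_\pm\subset E\otimes\mathbb C$) such that $\langle\mathcal J_+x,\mathcal J_-y\rangle$ is positive definite. Let $C_\pm$ be the $\pm1$-eigenbundles of $-\mathcal J_+\mathcal J_-$; then $\pi$ restricts to isomorphisms $C_\pm\cong TM$, and $X_\pm=(M,I_\pm)$, where $I_\pm$ is the complex structure on $M$ induced by $\mathcal J_+|_{C_\pm}$. Put $\ell_+=L_+\cap L_-$ and $\ell_-=L_+\cap\overline{L_-}$. The bundle $\overline\ell_\pm$ is an isotropic involutive lifting of $T_{0,1}X_\pm$ to $E\otimes\mathbb C$, so that $\mathcal E_\pm=\overline\ell_\pm^{\,\perp}/\overline\ell_\pm$ has the $\overline\partial$-operator $\overline\partial_X s=[\tilde X,\tilde s]\bmod\overline\ell_\pm$,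 where $\tilde X$ is the lift of $X\in T_{0,1}X_\pm$ to $\overline\ell_\pm$ and $\tilde s$ is any lift of $s$ to $\overline\ell_\pm^{\,\perp}$, and its holomorphic sections carry the bracket $[s,t]=[\tilde s,\tilde t]\bmod\overline\ell_\pm$. Let $$\mathcal A_\pm=\overline{L_+}/\overline\ell_\pm,\qquad \mathcal B_+=\overline{L_-}/\overline\ell_+,\qquad \mathcal B_-=L_- /\overline\ell_-$$ be the reductions of the $-i$-eigenbundle of $\mathcal J_+$ (for $\mathcal A_\pm$) and of the $-i$- and $+i$-eigenbundle of $\mathcal J_-$ (for $\mathcal B_+$ and $\mathcal B_-$). They are holomorphic Dirac structures in $\mathcal E_\pm$, and in particular holomorphic Lie algebroids over the complex manifolds $X_\pm$. A holomorphic Lie algebroid $\mathcal L$ over a complex manifold $X$, with anchor $\rho$, has an associated complex Lie algebroid $\mathcal L\oplus T_{0,1}X$ over the underlying smooth manifold. Its anchor is $\rho$ plus the inclusion of $T_{0,1}X$; its bracket is that of $\mathcal L$ on holomorphic sections of $\mathcal L$, the Lie bracket on sections of $T_{0,1}X$, and $[Y,s]=\overline\partial_Y s+[Y,\rho(s)]^{0,1}$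 for sections $Y$ of $T_{0,1}X$ and $s$ of $\mathcal L$. Holomorphic Lie algebroids $\mathcal L_\pm$ over $X_\pm$ are called *Morita equivalent* when there is an isomorphism, over the identity of $M$, of complex Lie algebroids $\mathcal L_+\oplus T_{0,1}X_+\cong\mathcal L_-\oplus T_{0,1}X_-$, and $\mathcal L_+$ is *Morita conjugate* to $\mathcal L_-$ when $\mathcal L_+\oplus T_{0,1}X_+$ is isomorphic to the complex conjugate of the complex Lie algebroid $\mathcal L_-\oplus T_{0,1}X_-$. **Proposition.** $\mathcal A_\pm$ and $\mathcal B_\pm$ are holomorphic Lie algebroids over the complex manifolds $X_\pm$, $\mathcal A_+$ is Morita equivalent to $\mathcal A_-$, and $\mathcal B_+$ is Morita conjugate to $\mathcal B_-$. -/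

import Mathlib

open scoped Manifold ContDiff Topology
open Filter VectorField

noncomputable section

/-! ### Complexification of a real vector space -/

/-- The complexification `V ⊗ ℂ = V ⊕ iV` of a real vector space; `⟨a, b⟩` stands for `a + i b`. -/
@[ext]
structure Cx (V : Type*) where
  re : V
  im : V

namespace Cx

section Basic

variable {V W : Type*} [AddCommGroup V]

instance : Zero (Cx V) := ⟨⟨0, 0⟩⟩
instance : Add (Cx V) := ⟨fun v w => ⟨v.re + w.re, v.im + w.im⟩⟩
instance : Neg (Cx V) := ⟨fun v => ⟨-v.re, -v.im⟩⟩
instance : Sub (Cx V) := ⟨fun v w => ⟨v.re - w.re, v.im - w.im⟩⟩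
instance : SMul ℕ (Cx V) := ⟨fun k v => ⟨k • v.re, k • v.im⟩⟩
instance : SMul ℤ (Cx V) := ⟨fun k v => ⟨k • v.re, k • v.im⟩⟩
@[simp] theorem zero_re : (0 : Cx V).re = 0 := rfl
@[simp] theorem zero_im : (0 : Cx V).im = 0 := rfl
@[simp] theorem add_re (v w : Cx V) : (v + w).re = v.re + w.re := rfl
@[simp] theorem add_im (v w : Cx V) : (v + w).im = v.im + w.im := rfl
@[simp] theorem neg_re (v : Cx V) : (-v).re = -v.re := rfl
@[simp] theorem neg_im (v : Cx V) : (-v).im = -v.im := rfl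
@[simp] theorem sub_re (v w : Cx V) : (v - w).re = v.re - w.re := rfl
@[simp] theorem sub_im (v w : Cx V) : (v - w).im = v.im - w.im := rfl
/-- Complex conjugation `a + ib ↦ a - ib`. -/
def conj (v : Cx V) : Cx V := ⟨v.re, -v.im⟩

@[simp] theorem conj_re (v : Cx V) : (conj v).re = v.re := rfl
@[simp] theorem conj_im (v : Cx V) : (conj v).im = -v.im := rfl

variable [Module ℝ V] [AddCommGroup W] [Module ℝ W]

/-- `(a + ib)(v + iw) = (av - bw) + i(aw + bv)`. -/
instance : SMul ℂ (Cx V) :=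
  ⟨fun c v => ⟨c.re • v.re - c.im • v.im, c.re • v.im + c.im • v.re⟩⟩

@[simp] theorem smul_re (c : ℂ) (v : Cx V) : (c • v).re = c.re • v.re - c.im • v.im := rfl
@[simp] theorem smul_im (c : ℂ) (v : Cx V) : (c • v).im = c.re • v.im + c.im • v.re := rfl

instance : AddCommGroup (Cx V) :=
  Function.Injective.addCommGroup (fun v : Cx V => (v.re, v.im))
    (fun v w h => by
      have h' := Prod.mk.inj h
      exact Cx.ext h'.1 h'.2)
    rfl (fun _ _ => rfl) (fun _ => rfl) (fun _ _ => rfl) (fun _ _ => rfl) (fun _ _ => rfl)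

instance : Module ℂ (Cx V) where
  one_smul v := by ext <;> simp
  mul_smul c d v := by
    ext <;> simp only [smul_re, smul_im, Complex.mul_re, Complex.mul_im] <;> module
  smul_zero c := by ext <;> simp
  smul_add c v w := by
    ext <;> simp only [smul_re, smul_im, add_re, add_im] <;> module
  add_smul c d v := by
    ext <;> simp only [smul_re, smul_im, add_re, add_im, Complex.add_re, Complex.add_im] <;> module
  zero_smul v := by ext <;> simp

/-- The complex-linear extension of a real-linear map. -/
def map (f : V →ₗ[ℝ] W) : Cx V →ₗ[ℂ] Cx W where
  toFun v := ⟨f v.re, f v.im⟩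
  map_add' v w := by ext <;> simp
  map_smul' c v := by ext <;> simp

@[simp] theorem map_re (f : V →ₗ[ℝ] W) (v : Cx V) : (map f v).re = f v.re := rfl
@[simp] theorem map_im (f : V →ₗ[ℝ] W) (v : Cx V) : (map f v).im = f v.im := rfl

/-- The complex-bilinear extension of a real bilinear form. -/
def pair (B : V →ₗ[ℝ] V →ₗ[ℝ] ℝ) (v w : Cx V) : ℂ :=
  ⟨B v.re w.re - B v.im w.im, B v.re w.im + B v.im w.re⟩

/-- The orthogonal complement of a complex subspace for the complex-bilinear extension of `B`. -/
def perp (B : V →ₗ[ℝ] V →ₗ[ℝ] ℝ) (D : Submodule ℂ (Cx V)) : Submodule ℂ (Cx V) where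
  carrier := {v | ∀ d ∈ D, pair B v d = 0}
  zero_mem' d _ := by apply Complex.ext <;> simp [pair]
  add_mem' {v w} hv hw d hd := by
    have h1 := hv d hd
    have h2 := hw d hd
    have : pair B (v + w) d = pair B v d + pair B w d := by
      apply Complex.ext <;> simp [pair] <;> ring
    rw [this, h1, h2, add_zero]
  smul_mem' c v hv d hd := by
    have h1 := hv d hd
    have : pair B (c • v) d = c * pair B v d := by
      apply Complex.ext <;> simp [pair] <;> ring
    rw [this, h1, mul_zero]

end Basic

end Cx

/-! ### Smooth functions, sections and vector fields

Local sections of a bundle are encoded, as in Mathlib's `VectorField.mlieBracket`, by arbitrary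
sections over all of `M` together with the condition that they are smooth *near* a given point;
a section over an open set `U` is a section that is smooth near every point of `U`, extended by
anything, and all operations depend only on germs. -/

section Manifold

variable {n : ℕ} {M : Type*} [TopologicalSpace M] [ChartedSpace (EuclideanSpace ℝ (Fin n)) M]

/-- `f` is a smooth (complex- or real-valued) function near `x`. -/
def FnSmoothAt (n : ℕ) {M : Type*} [TopologicalSpace M]
    [ChartedSpace (EuclideanSpace ℝ (Fin n)) M] {G : Type*} [NormedAddCommGroup G]
    [NormedSpace ℝ G] (f : M → G) (x : M) : Prop :=
  ∀ᶠ y in 𝓝 x, ContMDiffAt (𝓡 n) 𝓘(ℝ, G) ∞ f y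

/-- `s` is a smooth section of the real vector bundle `E` near `x`. -/
def SecSmoothAt (n : ℕ) {M : Type*} [TopologicalSpace M]
    [ChartedSpace (EuclideanSpace ℝ (Fin n)) M] (F : Type*) [NormedAddCommGroup F]
    [NormedSpace ℝ F] {E : M → Type*} [TopologicalSpace (Bundle.TotalSpace F E)]
    [∀ x, TopologicalSpace (E x)] [FiberBundle F E] (s : ∀ x, E x) (x : M) : Prop :=
  ∀ᶠ y in 𝓝 x, ContMDiffAt (𝓡 n) ((𝓡 n).prod 𝓘(ℝ, F)) ∞
    (fun z => Bundle.TotalSpace.mk' F z (s z)) y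

/-- `s` is a smooth section of the complexification `E ⊗ ℂ` near `x`. -/
def CSecSmoothAt (n : ℕ) {M : Type*} [TopologicalSpace M]
    [ChartedSpace (EuclideanSpace ℝ (Fin n)) M] (F : Type*) [NormedAddCommGroup F]
    [NormedSpace ℝ F] {E : M → Type*} [TopologicalSpace (Bundle.TotalSpace F E)]
    [∀ x, TopologicalSpace (E x)] [FiberBundle F E] (s : ∀ x, Cx (E x)) (x : M) : Prop :=
  SecSmoothAt n F (fun y => (s y).re) x ∧ SecSmoothAt n F (fun y => (s y).im) x

/-- The complexified tangent space `T_x M ⊗ ℂ`. -/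
abbrev CT (n : ℕ) {M : Type*} [TopologicalSpace M]
    [ChartedSpace (EuclideanSpace ℝ (Fin n)) M] (x : M) : Type :=
  Cx (TangentSpace (𝓡 n) x)

/-- `X` is a smooth complex vector field near `x`. -/
def VFSmoothAt [IsManifold (𝓡 n) ∞ M] (X : ∀ x : M, CT n x) (x : M) : Prop :=
  CSecSmoothAt n (EuclideanSpace ℝ (Fin n)) (E := (TangentSpace (𝓡 n) : M → Type _)) X x

/-- The differential `df : T_x M → G` of a function with values in a vector space. -/
def dFn {G : Type*} [NormedAddCommGroup G] [NormedSpace ℝ G] (f : M → G) (x : M) :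
    TangentSpace (𝓡 n) x →L[ℝ] G :=
  mfderiv (𝓡 n) 𝓘(ℝ, G) f x

/-- The derivative `v(f) = df(re v) + i df(im v)` of `f : M → ℂ` along a complex tangent vector. -/
def lieD {x : M} (v : CT n x) (f : M → ℂ) : ℂ :=
  dFn f x v.re + Complex.I * dFn f x v.im

/-- The complex-bilinear extension of the Lie bracket of vector fields. -/
def vfBracket (X Y : ∀ x : M, CT n x) (x : M) : CT n x :=
  ⟨mlieBracket (𝓡 n) (fun y => (X y).re) (fun y => (Y y).re) x
      - mlieBracket (𝓡 n) (fun y => (X y).im) (fun y => (Y y).im) x,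
    mlieBracket (𝓡 n) (fun y => (X y).re) (fun y => (Y y).im) x
      + mlieBracket (𝓡 n) (fun y => (X y).im) (fun y => (Y y).re) x⟩

theorem FnSmoothAt.star {f : M → ℂ} {x : M} (h : FnSmoothAt n f x) :
    FnSmoothAt n (fun y => (starRingEnd ℂ) (f y)) x := by
  filter_upwards [h] with y hy
  exact (Complex.conjCLE.contDiff.contMDiff.contMDiffAt (x := f y)).comp y hy

theorem lieD_conj {f : M → ℂ} {x : M} (h : FnSmoothAt n f x) (v : CT n x) :
    lieD (Cx.conj v) f = (starRingEnd ℂ) (lieD v (fun y => (starRingEnd ℂ) (f y))) := by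
  have hd : MDifferentiableAt (𝓡 n) 𝓘(ℝ, ℂ) f x :=
    (h.self_of_nhds).mdifferentiableAt (by simp)
  have hc : dFn (n := n) (fun y => (starRingEnd ℂ) (f y)) x =
      (Complex.conjCLE : ℂ →L[ℝ] ℂ).comp (dFn f x) := by
    have h1 : HasMFDerivAt 𝓘(ℝ, ℂ) 𝓘(ℝ, ℂ) (fun z : ℂ => (starRingEnd ℂ) z) (f x)
        (Complex.conjCLE : ℂ →L[ℝ] ℂ) :=
      (Complex.conjCLE : ℂ →L[ℝ] ℂ).hasFDerivAt.hasMFDerivAt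
    exact (h1.comp x hd.hasMFDerivAt).mfderiv
  simp [lieD, hc]

end Manifold

/-! ### Complex vector bundles, given by fibres and smooth sections -/

/-- A family of complex vector spaces over `M` with a notion of smooth section near a point. -/
structure FibreFamily.{u, v} (M : Type u) where
  Fib : M → Type v
  [grp : ∀ x, AddCommGroup (Fib x)]
  [mod : ∀ x, Module ℂ (Fib x)]
  SmoothAt : (∀ x, Fib x) → M → Prop

attribute [instance] FibreFamily.grp FibreFamily.mod

namespace FibreFamily

variable {M : Type*}

/-- `V` is a smooth complex vector bundle: near every point there is a smooth frame, i.e. finitely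
many sections that form a basis of every nearby fibre, such that the smooth sections are exactly
those with smooth coefficients in the frame. -/
def IsVectorBundle (n : ℕ) [TopologicalSpace M] [ChartedSpace (EuclideanSpace ℝ (Fin n)) M]
    (V : FibreFamily M) : Prop :=
  ∀ x : M, ∃ (k : ℕ) (e : Fin k → ∀ y, V.Fib y), ∀ᶠ y in 𝓝 x,
    (∀ v : V.Fib y, ∃! c : Fin k → ℂ, v = ∑ i, c i • e i y) ∧
    ∀ s : ∀ y, V.Fib y, V.SmoothAt s y ↔
      ∃ f : Fin k → M → ℂ, (∀ i, FnSmoothAt n (f i) y) ∧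
        ∀ᶠ z in 𝓝 y, s z = ∑ i, f i z • e i z

/-- The Whitney sum `V ⊕ W`. -/
def sum (V W : FibreFamily M) : FibreFamily M where
  Fib x := V.Fib x × W.Fib x
  SmoothAt s x := V.SmoothAt (fun y => (s y).1) x ∧ W.SmoothAt (fun y => (s y).2) x

/-- The complex conjugate bundle: same elements, with `c` acting as `conj c` did. -/
def conj (V : FibreFamily M) : FibreFamily M where
  Fib := V.Fib
  mod x := Module.compHom (V.Fib x) (starRingEnd ℂ)
  SmoothAt := V.SmoothAt

end FibreFamily

/-! ### Complex Lie algebroids -/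

section LieAlgebroid

variable {n : ℕ} {M : Type*} [TopologicalSpace M] [ChartedSpace (EuclideanSpace ℝ (Fin n)) M]
  [IsManifold (𝓡 n) ∞ M]

/-- A complex Lie algebroid structure on the bundle `V`: a Lie bracket on the sheaf of smooth
sections and a bracket-preserving anchor `V → TM ⊗ ℂ` satisfying the Leibniz rule. -/
structure ComplexLieAlgebroid (n : ℕ) {M : Type*} [TopologicalSpace M]
    [ChartedSpace (EuclideanSpace ℝ (Fin n)) M] [IsManifold (𝓡 n) ∞ M] (V : FibreFamily M) where
  anchor : ∀ x, V.Fib x →ₗ[ℂ] CT n x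
  bracket : (∀ x, V.Fib x) → (∀ x, V.Fib x) → ∀ x, V.Fib x
  isVectorBundle : V.IsVectorBundle n
  anchor_smooth : ∀ s x, V.SmoothAt s x → VFSmoothAt (fun y => anchor y (s y)) x
  bracket_smooth : ∀ s t x, V.SmoothAt s x → V.SmoothAt t x → V.SmoothAt (bracket s t) x
  bracket_local : ∀ s s' t t' x, V.SmoothAt s x → V.SmoothAt t x →
    (∀ᶠ y in 𝓝 x, s y = s' y) → (∀ᶠ y in 𝓝 x, t y = t' y) → bracket s t x = bracket s' t' x
  bracket_add : ∀ s t u x, V.SmoothAt s x → V.SmoothAt t x → V.SmoothAt u x →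
    bracket s (t + u) x = bracket s t x + bracket s u x
  bracket_skew : ∀ s t x, V.SmoothAt s x → V.SmoothAt t x →
    bracket s t x = -bracket t s x
  jacobi : ∀ s t u x, V.SmoothAt s x → V.SmoothAt t x → V.SmoothAt u x →
    bracket s (bracket t u) x = bracket (bracket s t) u x + bracket t (bracket s u) x
  leibniz : ∀ (f : M → ℂ) s t x, FnSmoothAt n f x → V.SmoothAt s x → V.SmoothAt t x →
    bracket s (fun y => f y • t y) x = f x • bracket s t x + lieD (anchor x (s x)) f • t x
  anchor_bracket : ∀ s t x, V.SmoothAt s x → V.SmoothAt t x →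
    anchor x (bracket s t x) =
      vfBracket (fun y => anchor y (s y)) (fun y => anchor y (t y)) x

/-- An isomorphism of complex Lie algebroids over the identity of `M`: a smooth complex-linear
bundle isomorphism that intertwines the anchors and the brackets. -/
structure ComplexLieAlgebroid.Iso {V W : FibreFamily M} (A : ComplexLieAlgebroid n V)
    (B : ComplexLieAlgebroid n W) where
  toEquiv : ∀ x, V.Fib x ≃ₗ[ℂ] W.Fib x
  smooth_iff : ∀ s x, V.SmoothAt s x ↔ W.SmoothAt (fun y => toEquiv y (s y)) x
  anchor_eq : ∀ x v, B.anchor x (toEquiv x v) = A.anchor x v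
  bracket_eq : ∀ s t x, V.SmoothAt s x → V.SmoothAt t x →
    toEquiv x (A.bracket s t x) = B.bracket (fun y => toEquiv y (s y)) (fun y => toEquiv y (t y)) x

theorem VFSmoothAt.conj {X : ∀ x : M, CT n x} {x : M} (h : VFSmoothAt X x) :
    VFSmoothAt (fun y => Cx.conj (X y)) x := by
  refine ⟨h.1, ?_⟩
  filter_upwards [h.2] with y hy
  exact hy.neg_section

theorem vfBracket_conj (X Y : ∀ x : M, CT n x) (x : M) (hX : VFSmoothAt X x)
    (hY : VFSmoothAt Y x) :
    vfBracket (fun y => Cx.conj (X y)) (fun y => Cx.conj (Y y)) x = Cx.conj (vfBracket X Y x) := by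
  have neg : ∀ {Z : ∀ y : M, TangentSpace (𝓡 n) y}, SecSmoothAt n (EuclideanSpace ℝ (Fin n)) Z x →
      ∀ W : ∀ y : M, TangentSpace (𝓡 n) y,
      mlieBracket (𝓡 n) (fun y => -Z y) W x = -mlieBracket (𝓡 n) Z W x := by
    intro Z hZ W
    have := mlieBracket_const_smul_left (I := 𝓡 n) (c := (-1 : ℝ)) (V := Z) (W := W) (x := x)
      ((hZ.self_of_nhds).mdifferentiableAt (by simp))
    simpa [Pi.smul_def, Pi.neg_def] using this
  have neg' : ∀ {Z : ∀ y : M, TangentSpace (𝓡 n) y}, SecSmoothAt n (EuclideanSpace ℝ (Fin n)) Z x →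
      ∀ W : ∀ y : M, TangentSpace (𝓡 n) y,
      mlieBracket (𝓡 n) W (fun y => -Z y) x = -mlieBracket (𝓡 n) W Z x := by
    intro Z hZ W
    have := mlieBracket_const_smul_right (I := 𝓡 n) (c := (-1 : ℝ)) (V := W) (W := Z) (x := x)
      ((hZ.self_of_nhds).mdifferentiableAt (by simp))
    simpa [Pi.smul_def, Pi.neg_def] using this
  ext1
  · simp only [vfBracket, Cx.conj_re, Cx.conj_im]
    rw [neg hX.2, neg' hY.2, neg_neg]
  · simp only [vfBracket, Cx.conj_re, Cx.conj_im]
    rw [neg hX.2, neg' hY.2, neg_add]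

/-- The complex conjugate of a complex Lie algebroid. -/
def ComplexLieAlgebroid.conj {V : FibreFamily M} (A : ComplexLieAlgebroid n V) :
    ComplexLieAlgebroid n V.conj where
  anchor x :=
    { toFun := fun v => Cx.conj (A.anchor x v)
      map_add' := fun v w => by
        have h : A.anchor x (v + w) = A.anchor x v + A.anchor x w := map_add _ _ _
        change Cx.conj (A.anchor x (v + w)) = _
        rw [h]
        ext1 <;> simp [add_comm]
      map_smul' := fun c v => by
        have h : ∀ w : V.Fib x, Cx.conj (A.anchor x ((starRingEnd ℂ) c • w)) =
            c • Cx.conj (A.anchor x w) := fun w => by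
          rw [map_smul]
          ext1 <;> simp [add_comm]
        exact h v }
  bracket := A.bracket
  isVectorBundle x := by
    obtain ⟨k, e, he⟩ := A.isVectorBundle x
    refine ⟨k, e, ?_⟩
    filter_upwards [he] with y hy
    refine ⟨fun v => ?_, fun s => ?_⟩
    · obtain ⟨c, hc, hu⟩ := hy.1 v
      refine ⟨fun i => (starRingEnd ℂ) (c i), ?_, ?_⟩
      · refine hc.trans (Finset.sum_congr rfl fun i _ => ?_)
        change c i • e i y = (starRingEnd ℂ) ((starRingEnd ℂ) (c i)) • e i y
        rw [Complex.conj_conj]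
      · intro d hd
        have := hu (fun i => (starRingEnd ℂ) (d i)) hd
        funext i
        rw [← this]
        simp
    · refine (hy.2 s).trans ⟨?_, ?_⟩
      · rintro ⟨f, hf, hs⟩
        refine ⟨fun i z => (starRingEnd ℂ) (f i z), fun i => (hf i).star, ?_⟩
        filter_upwards [hs] with z hz
        refine hz.trans (Finset.sum_congr rfl fun i _ => ?_)
        change f i z • e i z = (starRingEnd ℂ) ((starRingEnd ℂ) (f i z)) • e i z
        rw [Complex.conj_conj]
      · rintro ⟨f, hf, hs⟩
        exact ⟨fun i z => (starRingEnd ℂ) (f i z), fun i => (hf i).star, hs⟩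
  anchor_smooth s x hs := (A.anchor_smooth s x hs).conj
  bracket_smooth := A.bracket_smooth
  bracket_local := A.bracket_local
  bracket_add := A.bracket_add
  bracket_skew := A.bracket_skew
  jacobi := A.jacobi
  leibniz f s t x hf hs ht := by
    have h := A.leibniz (fun y => (starRingEnd ℂ) (f y)) s t x hf.star hs ht
    refine h.trans ?_
    have h2 : ∀ a b : V.Fib x, (starRingEnd ℂ) (f x) • a +
        lieD (A.anchor x (s x)) (fun y => (starRingEnd ℂ) (f y)) • b =
        (starRingEnd ℂ) (f x) • a +
          (starRingEnd ℂ) (lieD (Cx.conj (A.anchor x (s x))) f) • b := by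
      intro a b
      rw [lieD_conj hf, Complex.conj_conj]
    exact h2 _ _
  anchor_bracket s t x hs ht := by
    change Cx.conj (A.anchor x (A.bracket s t x)) = _
    rw [A.anchor_bracket s t x hs ht]
    exact (vfBracket_conj _ _ x (A.anchor_smooth s x hs) (A.anchor_smooth t x ht)).symm

end LieAlgebroid

/-! ### Complex manifolds and holomorphic Lie algebroids

A complex manifold is a smooth manifold with an integrable almost complex structure, a holomorphic
vector bundle is a smooth complex vector bundle with a flat `∂̄`-operator, and its holomorphic
sections are the local smooth sections killed by `∂̄`. -/

section Holomorphic

variable {n : ℕ} {M : Type*} [TopologicalSpace M] [ChartedSpace (EuclideanSpace ℝ (Fin n)) M]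

/-- `T_{0,1}`, the `-i`-eigenspace of `I`. -/
def T01 (I : ∀ x : M, TangentSpace (𝓡 n) x →ₗ[ℝ] TangentSpace (𝓡 n) x) (x : M) :
    Submodule ℂ (CT n x) :=
  LinearMap.ker (Cx.map (I x) + Complex.I • LinearMap.id)

/-- `T_{1,0}`, the `+i`-eigenspace of `I`. -/
def T10 (I : ∀ x : M, TangentSpace (𝓡 n) x →ₗ[ℝ] TangentSpace (𝓡 n) x) (x : M) :
    Submodule ℂ (CT n x) :=
  LinearMap.ker (Cx.map (I x) - Complex.I • LinearMap.id)

/-- The projection `(1 + iI)/2` to `T_{0,1}`. -/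
def pr01 (I : ∀ x : M, TangentSpace (𝓡 n) x →ₗ[ℝ] TangentSpace (𝓡 n) x) (x : M) :
    CT n x →ₗ[ℂ] CT n x :=
  (1 / 2 : ℂ) • (LinearMap.id + Complex.I • Cx.map (I x))

/-- The projection `(1 - iI)/2` to `T_{1,0}`. -/
def pr10 (I : ∀ x : M, TangentSpace (𝓡 n) x →ₗ[ℝ] TangentSpace (𝓡 n) x) (x : M) :
    CT n x →ₗ[ℂ] CT n x :=
  (1 / 2 : ℂ) • (LinearMap.id - Complex.I • Cx.map (I x))

theorem pr10_of_mem_T01 {I : ∀ x : M, TangentSpace (𝓡 n) x →ₗ[ℝ] TangentSpace (𝓡 n) x} {x : M}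
    {v : CT n x} (hv : v ∈ T01 I x) : pr10 I x v = 0 := by
  have h : Cx.map (I x) v = -(Complex.I • v) := by
    have h1 : Cx.map (I x) v + Complex.I • v = 0 := hv
    exact eq_neg_of_add_eq_zero_left h1
  simp [pr10, h, smul_smul]

variable [IsManifold (𝓡 n) ∞ M]

/-- `X` is a smooth section of `T_{0,1}` near `x`. -/
def T01SmoothAt (I : ∀ x : M, TangentSpace (𝓡 n) x →ₗ[ℝ] TangentSpace (𝓡 n) x)
    (X : ∀ x : M, CT n x) (x : M) : Prop :=
  VFSmoothAt X x ∧ ∀ᶠ y in 𝓝 x, X y ∈ T01 I y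

/-- `I` is an integrable almost complex structure: `(M, I)` is a complex manifold. -/
structure IsComplexStructure
    (I : ∀ x : M, TangentSpace (𝓡 n) x →ₗ[ℝ] TangentSpace (𝓡 n) x) : Prop where
  smooth : ∀ X x, VFSmoothAt X x → VFSmoothAt (fun y => Cx.map (I y) (X y)) x
  sq : ∀ x v, I x (I x v) = -v
  integrable : ∀ X Y x, T01SmoothAt I X x → T01SmoothAt I Y x → vfBracket X Y x ∈ T01 I x

/-- `f` is a holomorphic function near `x`. -/
def HolFnAt (I : ∀ x : M, TangentSpace (𝓡 n) x →ₗ[ℝ] TangentSpace (𝓡 n) x)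
    (f : M → ℂ) (x : M) : Prop :=
  FnSmoothAt n f x ∧ ∀ᶠ y in 𝓝 x, ∀ v ∈ T01 I y, lieD v f = 0

/-- The bundle `T_{0,1}` of the complex manifold `(M, I)`. -/
def T01Family (I : ∀ x : M, TangentSpace (𝓡 n) x →ₗ[ℝ] TangentSpace (𝓡 n) x) : FibreFamily M where
  Fib x := T01 I x
  SmoothAt X x := VFSmoothAt (fun y => (X y : CT n y)) x

/-- The data of a holomorphic Lie algebroid over `(M, I)`: a complex vector bundle, its
`∂̄`-operator `(X, s) ↦ ∂̄_X s` for `X` in `T_{0,1}`, its anchor, and the bracket of local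
holomorphic sections. The laws are stated in `HolLieAlgebroidData.IsHolomorphicLieAlgebroid`. -/
structure HolLieAlgebroidData.{u, v} (n : ℕ) (M : Type u) [TopologicalSpace M]
    [ChartedSpace (EuclideanSpace ℝ (Fin n)) M] where
  I : ∀ x : M, TangentSpace (𝓡 n) x →ₗ[ℝ] TangentSpace (𝓡 n) x
  bundle : FibreFamily.{u, v} M
  dbar : (∀ x : M, CT n x) → (∀ x, bundle.Fib x) → ∀ x, bundle.Fib x
  anchor : ∀ x, bundle.Fib x →ₗ[ℂ] CT n x
  bracket : (∀ x, bundle.Fib x) → (∀ x, bundle.Fib x) → ∀ x, bundle.Fib x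

namespace HolLieAlgebroidData

/-- `s` is a holomorphic section near `x`. -/
def HolAt (𝓛 : HolLieAlgebroidData n M) (s : ∀ x, 𝓛.bundle.Fib x) (x : M) : Prop :=
  ∀ᶠ y in 𝓝 x, 𝓛.bundle.SmoothAt s y ∧ ∀ X, T01SmoothAt 𝓛.I X y → 𝓛.dbar X s y = 0

/-- `𝓛` is a holomorphic Lie algebroid over the complex manifold `(M, I)`. -/
structure IsHolomorphicLieAlgebroid (𝓛 : HolLieAlgebroidData n M) : Prop where
  isComplexStructure : IsComplexStructure 𝓛.I
  isVectorBundle : 𝓛.bundle.IsVectorBundle n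
  dbar_smooth : ∀ X s x, T01SmoothAt 𝓛.I X x → 𝓛.bundle.SmoothAt s x →
    𝓛.bundle.SmoothAt (𝓛.dbar X s) x
  dbar_local : ∀ X X' s s' x, T01SmoothAt 𝓛.I X x → 𝓛.bundle.SmoothAt s x →
    (∀ᶠ y in 𝓝 x, X y = X' y) → (∀ᶠ y in 𝓝 x, s y = s' y) → 𝓛.dbar X s x = 𝓛.dbar X' s' x
  dbar_add_left : ∀ X Y s x, T01SmoothAt 𝓛.I X x → T01SmoothAt 𝓛.I Y x →
    𝓛.bundle.SmoothAt s x → 𝓛.dbar (X + Y) s x = 𝓛.dbar X s x + 𝓛.dbar Y s x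
  dbar_smul_left : ∀ (f : M → ℂ) X s x, FnSmoothAt n f x → T01SmoothAt 𝓛.I X x →
    𝓛.bundle.SmoothAt s x → 𝓛.dbar (fun y => f y • X y) s x = f x • 𝓛.dbar X s x
  dbar_add_right : ∀ X s t x, T01SmoothAt 𝓛.I X x → 𝓛.bundle.SmoothAt s x →
    𝓛.bundle.SmoothAt t x → 𝓛.dbar X (s + t) x = 𝓛.dbar X s x + 𝓛.dbar X t x
  dbar_leibniz : ∀ (f : M → ℂ) X s x, FnSmoothAt n f x → T01SmoothAt 𝓛.I X x →
    𝓛.bundle.SmoothAt s x →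
    𝓛.dbar X (fun y => f y • s y) x = f x • 𝓛.dbar X s x + lieD (X x) f • s x
  dbar_flat : ∀ X Y s x, T01SmoothAt 𝓛.I X x → T01SmoothAt 𝓛.I Y x → 𝓛.bundle.SmoothAt s x →
    𝓛.dbar X (𝓛.dbar Y s) x - 𝓛.dbar Y (𝓛.dbar X s) x = 𝓛.dbar (vfBracket X Y) s x
  anchor_mem : ∀ x v, 𝓛.anchor x v ∈ T10 𝓛.I x
  anchor_smooth : ∀ s x, 𝓛.bundle.SmoothAt s x → VFSmoothAt (fun y => 𝓛.anchor y (s y)) x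
  /-- The anchor is holomorphic; the `∂̄`-operator of `T_{1,0}` is `∂̄_X Y = [X, Y]^{1,0}`. -/
  anchor_hol : ∀ X s x, T01SmoothAt 𝓛.I X x → 𝓛.bundle.SmoothAt s x →
    𝓛.anchor x (𝓛.dbar X s x) = pr10 𝓛.I x (vfBracket X (fun y => 𝓛.anchor y (s y)) x)
  bracket_hol : ∀ s t x, 𝓛.HolAt s x → 𝓛.HolAt t x → 𝓛.HolAt (𝓛.bracket s t) x
  bracket_local : ∀ s s' t t' x, 𝓛.HolAt s x → 𝓛.HolAt t x →
    (∀ᶠ y in 𝓝 x, s y = s' y) → (∀ᶠ y in 𝓝 x, t y = t' y) →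
    𝓛.bracket s t x = 𝓛.bracket s' t' x
  bracket_add : ∀ s t u x, 𝓛.HolAt s x → 𝓛.HolAt t x → 𝓛.HolAt u x →
    𝓛.bracket s (t + u) x = 𝓛.bracket s t x + 𝓛.bracket s u x
  bracket_skew : ∀ s t x, 𝓛.HolAt s x → 𝓛.HolAt t x → 𝓛.bracket s t x = -𝓛.bracket t s x
  jacobi : ∀ s t u x, 𝓛.HolAt s x → 𝓛.HolAt t x → 𝓛.HolAt u x →
    𝓛.bracket s (𝓛.bracket t u) x =
      𝓛.bracket (𝓛.bracket s t) u x + 𝓛.bracket t (𝓛.bracket s u) x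
  leibniz : ∀ (f : M → ℂ) s t x, HolFnAt 𝓛.I f x → 𝓛.HolAt s x → 𝓛.HolAt t x →
    𝓛.bracket s (fun y => f y • t y) x = f x • 𝓛.bracket s t x + lieD (𝓛.anchor x (s x)) f • t x
  anchor_bracket : ∀ s t x, 𝓛.HolAt s x → 𝓛.HolAt t x →
    𝓛.anchor x (𝓛.bracket s t x) =
      vfBracket (fun y => 𝓛.anchor y (s y)) (fun y => 𝓛.anchor y (t y)) x

/-- The underlying bundle of the associated complex Lie algebroid `𝓛 ⊕ T_{0,1}`. -/
abbrev assocBundle (𝓛 : HolLieAlgebroidData n M) : FibreFamily M :=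
  𝓛.bundle.sum (T01Family 𝓛.I)

/-- `A` is the complex Lie algebroid `𝓛 ⊕ T_{0,1}` associated to the holomorphic Lie algebroid `𝓛`.
The anchor is that of `𝓛` plus the inclusion of `T_{0,1}`; holomorphic sections of `𝓛` have their
bracket in `𝓛`; sections of `T_{0,1}` have their Lie bracket; and
`[X, s] = ∂̄_X s + [X, ρ(s)]^{0,1}`. A holomorphic bundle has local holomorphic frames, so, by the
Leibniz rule, these conditions determine `A`. -/
structure IsAssociated (𝓛 : HolLieAlgebroidData n M)
    (A : ComplexLieAlgebroid n 𝓛.assocBundle) : Prop where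
  anchor_eq : ∀ x (v : 𝓛.bundle.Fib x) (X : T01 𝓛.I x),
    A.anchor x (v, X) = 𝓛.anchor x v + (X : CT n x)
  bracket_hol : ∀ s t x, 𝓛.HolAt s x → 𝓛.HolAt t x →
    A.bracket (fun y => (s y, 0)) (fun y => (t y, 0)) x = (𝓛.bracket s t x, 0)
  bracket_T01 : ∀ (X Y : ∀ x, T01 𝓛.I x) x, (T01Family 𝓛.I).SmoothAt X x →
    (T01Family 𝓛.I).SmoothAt Y x →
    (A.bracket (fun y => (0, X y)) (fun y => (0, Y y)) x).1 = 0 ∧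
    (T01 𝓛.I x).subtype (A.bracket (fun y => (0, X y)) (fun y => (0, Y y)) x).2 =
      vfBracket (fun y => (X y : CT n y)) (fun y => (Y y : CT n y)) x
  bracket_mixed : ∀ (X : ∀ x, T01 𝓛.I x) s x, (T01Family 𝓛.I).SmoothAt X x →
    𝓛.bundle.SmoothAt s x →
    (A.bracket (fun y => (0, X y)) (fun y => (s y, 0)) x).1 =
      𝓛.dbar (fun y => (X y : CT n y)) s x ∧
    (T01 𝓛.I x).subtype (A.bracket (fun y => (0, X y)) (fun y => (s y, 0)) x).2 =
      pr01 𝓛.I x (vfBracket (fun y => (X y : CT n y)) (fun y => 𝓛.anchor y (s y)) x)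

/-- Morita equivalence of holomorphic Lie algebroids over two complex structures on `M`: the
associated complex Lie algebroids are isomorphic. -/
def MoritaEquivalent (𝓛₁ 𝓛₂ : HolLieAlgebroidData n M) : Prop :=
  ∃ (A₁ : ComplexLieAlgebroid n 𝓛₁.assocBundle) (A₂ : ComplexLieAlgebroid n 𝓛₂.assocBundle),
    𝓛₁.IsAssociated A₁ ∧ 𝓛₂.IsAssociated A₂ ∧ Nonempty (A₁.Iso A₂)

/-- Morita conjugacy: the complex Lie algebroid associated to `𝓛₁` is isomorphic to the complex
conjugate of the one associated to `𝓛₂`. -/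
def MoritaConjugate (𝓛₁ 𝓛₂ : HolLieAlgebroidData n M) : Prop :=
  ∃ (A₁ : ComplexLieAlgebroid n 𝓛₁.assocBundle) (A₂ : ComplexLieAlgebroid n 𝓛₂.assocBundle),
    𝓛₁.IsAssociated A₁ ∧ 𝓛₂.IsAssociated A₂ ∧ Nonempty (A₁.Iso A₂.conj)

end HolLieAlgebroidData

end Holomorphic

/-! ### Courant algebroids and generalized Kähler structures -/

section Courant

/-- An exact real Courant algebroid `0 → T*M → E → TM → 0`. The pairing is normalized by
`⟨ι ξ, e⟩ = ξ(π e) / 2`, as for `⟨X + ξ, Y + η⟩ = (ξ(Y) + η(X)) / 2` on `TM ⊕ T*M`. -/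
structure CourantAlgebroid (n : ℕ) {M : Type*} [TopologicalSpace M]
    [ChartedSpace (EuclideanSpace ℝ (Fin n)) M] [IsManifold (𝓡 n) ∞ M]
    (F : Type*) [NormedAddCommGroup F] [NormedSpace ℝ F] (E : M → Type*)
    [∀ x, AddCommGroup (E x)] [∀ x, Module ℝ (E x)] [∀ x, TopologicalSpace (E x)]
    [TopologicalSpace (Bundle.TotalSpace F E)] [FiberBundle F E] where
  anchor : ∀ x, E x →ₗ[ℝ] TangentSpace (𝓡 n) x
  coanchor : ∀ x, Module.Dual ℝ (TangentSpace (𝓡 n) x) →ₗ[ℝ] E x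
  pairing : ∀ x, E x →ₗ[ℝ] E x →ₗ[ℝ] ℝ
  bracket : (∀ x, E x) → (∀ x, E x) → ∀ x, E x
  anchor_smooth : ∀ s x, SecSmoothAt n F s x →
    SecSmoothAt n (EuclideanSpace ℝ (Fin n)) (E := (TangentSpace (𝓡 n) : M → Type _))
      (fun y => anchor y (s y)) x
  pairing_smooth : ∀ s t x, SecSmoothAt n F s x → SecSmoothAt n F t x →
    FnSmoothAt n (fun y => pairing y (s y) (t y)) x
  bracket_smooth : ∀ s t x, SecSmoothAt n F s x → SecSmoothAt n F t x →
    SecSmoothAt n F (bracket s t) x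
  bracket_local : ∀ s s' t t' x, SecSmoothAt n F s x → SecSmoothAt n F t x →
    (∀ᶠ y in 𝓝 x, s y = s' y) → (∀ᶠ y in 𝓝 x, t y = t' y) → bracket s t x = bracket s' t' x
  anchor_surjective : ∀ x, Function.Surjective (anchor x)
  exact : ∀ x, LinearMap.ker (anchor x) = LinearMap.range (coanchor x)
  pairing_symm : ∀ x e e', pairing x e e' = pairing x e' e
  pairing_nondegenerate : ∀ x e, (∀ e', pairing x e e' = 0) → e = 0
  pairing_coanchor : ∀ x ξ e, pairing x (coanchor x ξ) e = (1 / 2 : ℝ) * ξ (anchor x e)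
  bracket_add_left : ∀ s t u x, SecSmoothAt n F s x → SecSmoothAt n F t x →
    SecSmoothAt n F u x → bracket (s + t) u x = bracket s u x + bracket t u x
  bracket_add_right : ∀ s t u x, SecSmoothAt n F s x → SecSmoothAt n F t x →
    SecSmoothAt n F u x → bracket s (t + u) x = bracket s t x + bracket s u x
  jacobi : ∀ s t u x, SecSmoothAt n F s x → SecSmoothAt n F t x → SecSmoothAt n F u x →
    bracket s (bracket t u) x = bracket (bracket s t) u x + bracket t (bracket s u) x
  anchor_bracket : ∀ s t x, SecSmoothAt n F s x → SecSmoothAt n F t x →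
    anchor x (bracket s t x) =
      mlieBracket (𝓡 n) (fun y => anchor y (s y)) (fun y => anchor y (t y)) x
  leibniz : ∀ (f : M → ℝ) s t x, FnSmoothAt n f x → SecSmoothAt n F s x → SecSmoothAt n F t x →
    bracket s (fun y => f y • t y) x = f x • bracket s t x + dFn f x (anchor x (s x)) • t x
  pairing_invariant : ∀ s t u x, SecSmoothAt n F s x → SecSmoothAt n F t x →
    SecSmoothAt n F u x →
    dFn (fun y => pairing y (t y) (u y)) x (anchor x (s x)) =
      pairing x (bracket s t x) (u x) + pairing x (t x) (bracket s u x)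
  bracket_self : ∀ s x, SecSmoothAt n F s x →
    bracket s s x = coanchor x (dFn (fun y => pairing y (s y) (s y)) x).toLinearMap

variable {n : ℕ} {M : Type*} [TopologicalSpace M] [ChartedSpace (EuclideanSpace ℝ (Fin n)) M]
  [IsManifold (𝓡 n) ∞ M] {F : Type*} [NormedAddCommGroup F] [NormedSpace ℝ F] {E : M → Type*}
  [∀ x, AddCommGroup (E x)] [∀ x, Module ℝ (E x)] [∀ x, TopologicalSpace (E x)]
  [TopologicalSpace (Bundle.TotalSpace F E)] [FiberBundle F E]

namespace CourantAlgebroid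

/-- The complex-bilinear extension of the Courant bracket to sections of `E ⊗ ℂ`. -/
def cbracket (C : CourantAlgebroid n F E) (s t : ∀ x, Cx (E x)) (x : M) : Cx (E x) :=
  ⟨C.bracket (fun y => (s y).re) (fun y => (t y).re) x
      - C.bracket (fun y => (s y).im) (fun y => (t y).im) x,
    C.bracket (fun y => (s y).re) (fun y => (t y).im) x
      + C.bracket (fun y => (s y).im) (fun y => (t y).re) x⟩

/-- The family of subspaces `L` of `E ⊗ ℂ` is involutive for the Courant bracket. -/
def Involutive (C : CourantAlgebroid n F E) (L : ∀ x, Submodule ℂ (Cx (E x))) : Prop :=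
  ∀ s t x, CSecSmoothAt n F s x → CSecSmoothAt n F t x →
    (∀ᶠ y in 𝓝 x, s y ∈ L y) → (∀ᶠ y in 𝓝 x, t y ∈ L y) → C.cbracket s t x ∈ L x

/-- The eigenspaces of (the complex-linear extension of) `J` for the eigenvalue `c`. -/
def eigen (J : ∀ x, E x →ₗ[ℝ] E x) (c : ℂ) (x : M) : Submodule ℂ (Cx (E x)) :=
  LinearMap.ker (Cx.map (J x) - c • LinearMap.id)

/-- A generalized complex structure on `E`. -/
structure GeneralizedComplex (C : CourantAlgebroid n F E) where
  J : ∀ x, E x →ₗ[ℝ] E x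
  smooth : ∀ s x, SecSmoothAt n F s x → SecSmoothAt n F (fun y => J y (s y)) x
  sq : ∀ x e, J x (J x e) = -e
  orthogonal : ∀ x e e', C.pairing x (J x e) (J x e') = C.pairing x e e'
  involutive : C.Involutive (eigen J Complex.I)

/-- A generalized Kähler structure on `E`. -/
structure GeneralizedKahler (C : CourantAlgebroid n F E) where
  Jp : C.GeneralizedComplex
  Jm : C.GeneralizedComplex
  commute : ∀ x e, Jp.J x (Jm.J x e) = Jm.J x (Jp.J x e)
  positive : ∀ x e, e ≠ 0 → 0 < C.pairing x (Jp.J x e) (Jm.J x e)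

/-! #### Reduction of a Dirac structure by a lifting of `T_{0,1}` -/

/-- `t` is a smooth section of `Dᗮ` near `x` that represents the section `q` of `Dᗮ/D`. -/
def IsLift (C : CourantAlgebroid n F E) (D : ∀ x, Submodule ℂ (Cx (E x)))
    (q : ∀ x, Cx (E x) ⧸ D x) (t : ∀ x, Cx (E x)) (x : M) : Prop :=
  CSecSmoothAt n F t x ∧
    ∀ᶠ y in 𝓝 x, t y ∈ Cx.perp (C.pairing y) (D y) ∧ (D y).mkQ (t y) = q y

open Classical in
/-- The lift of a section `X` of `T_{0,1}` to the section of `D` with anchor `X`. -/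
def liftT01 (C : CourantAlgebroid n F E) (D : ∀ x, Submodule ℂ (Cx (E x)))
    (X : ∀ x : M, CT n x) (x : M) : Cx (E x) :=
  if h : ∃ d ∈ D x, Cx.map (C.anchor x) d = X x then h.choose else 0

open Classical in
/-- The `∂̄`-operator of `Dᗮ/D`: `∂̄_X q = [X̃, q̃] mod D`, for the lift `X̃` of `X` to `D` and any
lift `q̃` of `q` to a smooth section of `Dᗮ`. -/
def redDbar (C : CourantAlgebroid n F E) (D : ∀ x, Submodule ℂ (Cx (E x)))
    (X : ∀ x : M, CT n x) (q : ∀ x, Cx (E x) ⧸ D x) (x : M) : Cx (E x) ⧸ D x :=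
  if h : ∃ t, C.IsLift D q t x then (D x).mkQ (C.cbracket (C.liftT01 D X) h.choose x) else 0

open Classical in
/-- The bracket of holomorphic sections of `Dᗮ/D`: `[q, r] = [q̃, r̃] mod D`, for any lifts `q̃`, `r̃`
to smooth sections of `Dᗮ`. -/
def redBracket (C : CourantAlgebroid n F E) (D : ∀ x, Submodule ℂ (Cx (E x)))
    (q r : ∀ x, Cx (E x) ⧸ D x) (x : M) : Cx (E x) ⧸ D x :=
  if h : (∃ t, C.IsLift D q t x) ∧ ∃ u, C.IsLift D r u x then
    (D x).mkQ (C.cbracket h.1.choose h.2.choose x) else 0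

/-- The reduction `L_D = (L ∩ Dᗮ + D)/D ⊂ Dᗮ/D`. -/
def redSub (C : CourantAlgebroid n F E) (D L : ∀ x, Submodule ℂ (Cx (E x))) (x : M) :
    Submodule ℂ (Cx (E x) ⧸ D x) :=
  ((L x ⊓ Cx.perp (C.pairing x) (D x)) ⊔ D x).map (D x).mkQ

open Classical in
/-- A vector of `V` known to lie in the subspace `S`, as an element of `S`. -/
def toSub {V : Type*} [AddCommGroup V] [Module ℂ V] (S : Submodule ℂ V) (v : V) : S :=
  if h : v ∈ S then ⟨v, h⟩ else 0

/-- The reduction `L_D ⊂ Dᗮ/D` of the Dirac structure `L`, for a lifting `D` of `T_{0,1}` of the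
complex structure `I`, as a holomorphic Lie algebroid: the `∂̄`-operator and the bracket are the
restrictions of those of `Dᗮ/D`, and the anchor is induced by `π : Dᗮ → TM ⊗ ℂ` and
`(TM ⊗ ℂ)/T_{0,1} ≅ T_{1,0}`. -/
def reduction (C : CourantAlgebroid n F E)
    (I : ∀ x : M, TangentSpace (𝓡 n) x →ₗ[ℝ] TangentSpace (𝓡 n) x)
    (D L : ∀ x, Submodule ℂ (Cx (E x)))
    (hD : ∀ x, ∀ d ∈ D x, Cx.map (C.anchor x) d ∈ T01 I x) : HolLieAlgebroidData n M where
  I := I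
  bundle :=
    { Fib := fun x => C.redSub D L x
      SmoothAt := fun s x => ∃ t, C.IsLift D (fun y => (s y : Cx (E y) ⧸ D y)) t x }
  dbar X s x := toSub _ (C.redDbar D X (fun y => (s y : Cx (E y) ⧸ D y)) x)
  anchor x :=
    ((D x).liftQ ((pr10 I x).comp (Cx.map (C.anchor x)))
      (fun d hd => by
        simpa using pr10_of_mem_T01 (hD x d hd))).domRestrict (C.redSub D L x)
  bracket s t x := toSub _ (C.redBracket D (fun y => (s y : Cx (E y) ⧸ D y))
    (fun y => (t y : Cx (E y) ⧸ D y)) x)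

/-! #### The bi-Hermitian complex structures and the four holomorphic Dirac structures -/

namespace GeneralizedKahler

variable {C : CourantAlgebroid n F E} (K : C.GeneralizedKahler)

/-- `C_±`, the `±1`-eigenspace of `G = -J₊J₋`. -/
def Cpm (ε : ℤˣ) (x : M) : Submodule ℝ (E x) :=
  LinearMap.ker ((K.Jp.J x).comp (K.Jm.J x) + ((ε : ℤ) : ℝ) • LinearMap.id)

/-- The projection `C_± → TM`. -/
def anchorCpm (ε : ℤˣ) (x : M) : K.Cpm ε x →ₗ[ℝ] TangentSpace (𝓡 n) x :=
  (C.anchor x).domRestrict (K.Cpm ε x)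

theorem mem_Cpm {ε : ℤˣ} {x : M} {e : E x} :
    e ∈ K.Cpm ε x ↔ K.Jp.J x (K.Jm.J x e) = -(((ε : ℤ) : ℝ) • e) := by
  simp [Cpm, eq_neg_iff_add_eq_zero]

theorem eq_zero_of_mem_Cpm {ε : ℤˣ} {x : M} {e : E x} (he : e ∈ K.Cpm ε x)
    (h0 : C.anchor x e = 0) : e = 0 := by
  by_contra hne
  have hpos := K.positive x e hne
  rw [mem_Cpm] at he
  have hm : K.Jm.J x e = ((ε : ℤ) : ℝ) • K.Jp.J x e := by
    have := congrArg (K.Jp.J x) he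
    rw [K.Jp.sq, map_neg, map_smul] at this
    exact neg_injective this
  have hmem : e ∈ LinearMap.range (C.coanchor x) := by
    rw [← C.exact]
    exact h0
  obtain ⟨ξ, rfl⟩ := hmem
  have hz : C.pairing x (C.coanchor x ξ) (C.coanchor x ξ) = 0 := by
    rw [C.pairing_coanchor, h0]
    simp
  rw [hm, map_smul, K.Jp.orthogonal, hz] at hpos
  simp at hpos

theorem anchorCpm_bijective (ε : ℤˣ) (x : M) : Function.Bijective (K.anchorCpm ε x) := by
  have hε : ((ε : ℤ) : ℝ) * ((ε : ℤ) : ℝ) = 1 := by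
    rcases Int.units_eq_one_or ε with h | h <;> simp [h]
  set r : ℝ := ((ε : ℤ) : ℝ) with hr
  have hinj : Function.Injective (K.anchorCpm ε x) := by
    rw [← LinearMap.ker_eq_bot, LinearMap.ker_eq_bot']
    rintro ⟨e, he⟩ h0
    exact Subtype.ext (K.eq_zero_of_mem_Cpm he h0)
  refine ⟨hinj, ?_⟩
  have hGG : ∀ e, K.Jp.J x (K.Jm.J x (K.Jp.J x (K.Jm.J x e))) = e := by
    intro e
    rw [K.commute x (K.Jp.J x (K.Jm.J x e)), K.Jp.sq, map_neg, K.Jm.sq, neg_neg]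
  -- the projection of a covector to `C_±`
  let p : Module.Dual ℝ (TangentSpace (𝓡 n) x) →ₗ[ℝ] E x :=
    (LinearMap.id - r • (K.Jp.J x).comp (K.Jm.J x)).comp (C.coanchor x)
  have hp : ∀ ξ, p ξ ∈ K.Cpm ε x := by
    intro ξ
    rw [mem_Cpm]
    simp only [p, LinearMap.comp_apply, LinearMap.sub_apply, LinearMap.smul_apply,
      LinearMap.id_apply, map_sub, map_smul, hGG]
    rw [smul_sub, smul_smul, hε, one_smul]
    abel
  have hφ : Function.Injective ((C.anchor x).comp p) := by
    rw [← LinearMap.ker_eq_bot, LinearMap.ker_eq_bot']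
    intro ξ hξ
    have h1 : p ξ = 0 := K.eq_zero_of_mem_Cpm (hp ξ) hξ
    have h2 : C.coanchor x ξ ∈ K.Cpm (-ε) x := by
      rw [mem_Cpm]
      simp only [p, LinearMap.comp_apply, LinearMap.sub_apply, LinearMap.smul_apply,
        LinearMap.id_apply] at h1
      have h3 := congrArg (fun z => r • z) (sub_eq_zero.mp h1)
      simp only [smul_smul, hε, one_smul] at h3
      rw [← h3]
      simp [hr]
    have h4 : C.coanchor x ξ = 0 := by
      refine K.eq_zero_of_mem_Cpm h2 ?_
      have : C.coanchor x ξ ∈ LinearMap.ker (C.anchor x) := by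
        rw [C.exact]
        exact ⟨ξ, rfl⟩
      exact this
    ext v
    obtain ⟨e, rfl⟩ := C.anchor_surjective x v
    have h5 := C.pairing_coanchor x ξ e
    rw [h4] at h5
    simpa using h5.symm
  have : FiniteDimensional ℝ (TangentSpace (𝓡 n) x) :=
    inferInstanceAs (FiniteDimensional ℝ (EuclideanSpace ℝ (Fin n)))
  have hsurj : Function.Surjective ((C.anchor x).comp p) :=
    (LinearMap.injective_iff_surjective_of_finrank_eq_finrank
      Subspace.dual_finrank_eq).mp hφ
  intro v
  obtain ⟨ξ, hξ⟩ := hsurj v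
  exact ⟨⟨p ξ, hp ξ⟩, hξ⟩

/-- The complex structures `I_±` of `X_±`: the restriction of `J₊` to `C_±`, transported to `TM` by
the projection `C_± ≅ TM`. -/
def cplx (ε : ℤˣ) (x : M) : TangentSpace (𝓡 n) x →ₗ[ℝ] TangentSpace (𝓡 n) x :=
  (C.anchor x).comp ((K.Jp.J x).comp ((K.Cpm ε x).subtype.comp
    (LinearEquiv.ofBijective _ (K.anchorCpm_bijective ε x)).symm.toLinearMap))

theorem cplx_anchor {ε : ℤˣ} {x : M} {e : E x} (he : e ∈ K.Cpm ε x) :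
    K.cplx ε x (C.anchor x e) = C.anchor x (K.Jp.J x e) := by
  have h : (LinearEquiv.ofBijective _ (K.anchorCpm_bijective ε x)).symm (C.anchor x e) =
      ⟨e, he⟩ := by
    rw [LinearEquiv.symm_apply_eq]
    rfl
  simp [cplx, h]

/-- The conjugates of `ℓ₊ = L₊ ∩ L₋` and `ℓ₋ = L₊ ∩ L̄₋`: `ellBar 1` is `ℓ̄₊ = L̄₊ ∩ L̄₋` and
`ellBar (-1)` is `ℓ̄₋ = L̄₊ ∩ L₋`, where `L_±` is the `+i`-eigenbundle of `J_±`. -/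
def ellBar (ε : ℤˣ) (x : M) : Submodule ℂ (Cx (E x)) :=
  eigen K.Jp.J (-Complex.I) x ⊓ eigen K.Jm.J (-(((ε : ℤ) : ℂ) * Complex.I)) x

theorem anchor_ellBar (ε : ℤˣ) (x : M) (d : Cx (E x)) (hd : d ∈ K.ellBar ε x) :
    Cx.map (C.anchor x) d ∈ T01 (K.cplx ε) x := by
  have hp : Cx.map (K.Jp.J x) d - (-Complex.I) • d = 0 := hd.1
  have hm : Cx.map (K.Jm.J x) d - (-(((ε : ℤ) : ℂ) * Complex.I)) • d = 0 := hd.2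
  have p1 : K.Jp.J x d.re = d.im := by
    simpa [add_neg_eq_zero] using congrArg Cx.re hp
  have p2 : K.Jp.J x d.im = -d.re := by
    simpa [sub_eq_zero, add_eq_zero_iff_eq_neg] using congrArg Cx.im hp
  have m1 : K.Jm.J x d.re = ((ε : ℤ) : ℝ) • d.im := by
    simpa [add_neg_eq_zero] using congrArg Cx.re hm
  have m2 : K.Jm.J x d.im = -(((ε : ℤ) : ℝ) • d.re) := by
    simpa [sub_eq_zero, add_eq_zero_iff_eq_neg] using congrArg Cx.im hm
  have c1 : d.re ∈ K.Cpm ε x := by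
    rw [mem_Cpm, m1, map_smul, p2, smul_neg]
  have c2 : d.im ∈ K.Cpm ε x := by
    rw [mem_Cpm, m2, map_neg, map_smul, p1]
  change Cx.map (K.cplx ε x) (Cx.map (C.anchor x) d) + Complex.I • Cx.map (C.anchor x) d = 0
  ext1
  · simp [K.cplx_anchor c1, p1]
  · simp [K.cplx_anchor c2, p2]

/-- `𝓐₊` (for `ε = 1`) and `𝓐₋` (for `ε = -1`): the reduction of the `-i`-eigenbundle of `J₊` by
`ℓ̄_±`, a holomorphic Dirac structure on `X_±`. -/
def diracA (ε : ℤˣ) : HolLieAlgebroidData n M :=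
  C.reduction (K.cplx ε) (K.ellBar ε) (eigen K.Jp.J (-Complex.I)) (K.anchor_ellBar ε)

/-- `𝓑₊` (for `ε = 1`) is the reduction of the `-i`-eigenbundle of `J₋` by `ℓ̄₊`, and `𝓑₋` (for
`ε = -1`) is the reduction of the `+i`-eigenbundle of `J₋` by `ℓ̄₋`. -/
def diracB (ε : ℤˣ) : HolLieAlgebroidData n M :=
  C.reduction (K.cplx ε) (K.ellBar ε) (eigen K.Jm.J (-(((ε : ℤ) : ℂ) * Complex.I)))
    (K.anchor_ellBar ε)

end GeneralizedKahler

end CourantAlgebroid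

end Courant

end

noncomputable section

/-! ### Smooth functions and their differentials. -/

section FnSmooth

variable {n : ℕ} {M : Type*} [TopologicalSpace M] [ChartedSpace (EuclideanSpace ℝ (Fin n)) M]
  {G : Type*} [NormedAddCommGroup G] [NormedSpace ℝ G]

/-! Everything reduces to one statement about an isotropic involutive subbundle `L` of `E ⊗ ℂ` that
contains an involutive lifting `D` of `T_{0,1}`. Isotropy makes the Courant bracket skew on `L`,
since its symmetric part is the differential of the pairing; so `L` is itself a complex Lie
algebroid (`lieAlgebroid`). Isotropy also puts `L` inside `Dᗮ`, so its reduction is simply `L/D`.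

A vector of `L` is determined by its class in `L/D` together with the `T_{0,1}`-part of its anchor,
because `D` projects isomorphically to `T_{0,1}`. Hence `L ≅ L/D ⊕ T_{0,1}` as bundles. Transporting
the structure of `L` along this isomorphism gives an algebroid that satisfies the defining laws of
the one associated to the holomorphic Lie algebroid `L/D` (`isAssociated`). The choice that makes
this work is `rep`: each class has a unique representative with anchor in `T_{1,0}`, and `T_{1,0}`
is closed under brackets. That `L/D` is a holomorphic Lie algebroid comes from the Jacobi identity
in `E` and from the involutivity of `D`: bracketing with `D` is `∂̄`, so lifts of holomorphic
sections normalize `D` (`isHolomorphicLieAlgebroid`).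

For a generalized Kähler structure, `D` is `ℓ̄_±`, the `-i`-eigenspace of `J₊` in `C_± ⊗ ℂ`, and it
corresponds to `T_{0,1}X_±` under `C_± ≅ TM`. Both `𝓐₊` and `𝓐₋` are reductions of the same `L`, the
`-i`-eigenbundle of `J₊`, so both associated algebroids are isomorphic to it. `𝓑₊` and `𝓑₋` are
reductions of the two eigenbundles of `J₋`, which complex conjugation exchanges.

The analytic content is that all these subspaces and maps are smooth. It rests on local frames:
smooth sections that form a basis at one point form a frame nearby (`of_basis`), the image of a
smooth projection is a bundle (`of_projection`), and the inverse of `C_± → TM` is smooth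
(`map_lift_smooth`). -/

theorem FnSmoothAt.eventually {f : M → G} {x : M} (h : FnSmoothAt n f x) :
    ∀ᶠ y in 𝓝 x, FnSmoothAt n f y :=
  eventually_eventually_nhds.mpr h

theorem FnSmoothAt.congr {f g : M → G} {x : M} (h : FnSmoothAt n f x) (hfg : ∀ᶠ y in 𝓝 x, f y = g y) :
    FnSmoothAt n g x := by
  filter_upwards [h, eventually_eventually_nhds.mpr hfg] with y hy hg
  exact hy.congr_of_eventuallyEq (hg.mono fun _ h => h.symm)

theorem fnSmoothAt_const (c : G) (x : M) : FnSmoothAt n (fun _ => c) x :=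
  Eventually.of_forall fun _ => contMDiffAt_const

theorem FnSmoothAt.mdifferentiableAt {f : M → G} {x : M} (h : FnSmoothAt n f x) :
    MDifferentiableAt (𝓡 n) 𝓘(ℝ, G) f x :=
  h.self_of_nhds.mdifferentiableAt (by simp)

/-- Post-composition with a map that is smooth at the values taken. -/
theorem FnSmoothAt.contDiffAt_comp {H : Type*} [NormedAddCommGroup H] [NormedSpace ℝ H] {f : M → G}
    {x : M} (h : FnSmoothAt n f x) {φ : G → H} (hφ : ∀ᶠ y in 𝓝 x, ContDiffAt ℝ ∞ φ (f y)) :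
    FnSmoothAt n (fun y => φ (f y)) x := by
  filter_upwards [h, hφ] with y hy hφy
  exact hφy.contMDiffAt.comp y hy

theorem FnSmoothAt.contDiff_comp {H : Type*} [NormedAddCommGroup H] [NormedSpace ℝ H] {f : M → G}
    {x : M} (h : FnSmoothAt n f x) {φ : G → H} (hφ : ContDiff ℝ ∞ φ) :
    FnSmoothAt n (fun y => φ (f y)) x :=
  h.contDiffAt_comp (Eventually.of_forall fun _ => hφ.contDiffAt)

theorem FnSmoothAt.re {f : M → ℂ} {x : M} (h : FnSmoothAt n f x) :
    FnSmoothAt n (fun y => (f y).re) x :=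
  h.contDiff_comp Complex.reCLM.contDiff

theorem FnSmoothAt.im {f : M → ℂ} {x : M} (h : FnSmoothAt n f x) :
    FnSmoothAt n (fun y => (f y).im) x :=
  h.contDiff_comp Complex.imCLM.contDiff

theorem FnSmoothAt.add {f g : M → G} {x : M} (hf : FnSmoothAt n f x) (hg : FnSmoothAt n g x) :
    FnSmoothAt n (fun y => f y + g y) x := by
  filter_upwards [hf, hg] with y h1 h2
  exact h1.add h2

theorem FnSmoothAt.of_re_im {f : M → ℂ} {x : M} (h : FnSmoothAt n (fun y => (f y).re) x)
    (h' : FnSmoothAt n (fun y => (f y).im) x) : FnSmoothAt n f x := by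
  have h1 : FnSmoothAt n (fun y => ((f y).re : ℂ)) x :=
    h.contDiff_comp Complex.ofRealCLM.contDiff
  have h2 : FnSmoothAt n (fun y => ((f y).im : ℂ) * Complex.I) x :=
    h'.contDiff_comp (φ := fun r : ℝ => (r : ℂ) * Complex.I)
      (Complex.ofRealCLM.contDiff.mul contDiff_const)
  exact (h1.add h2).congr (Eventually.of_forall fun y => Complex.re_add_im (f y))

theorem FnSmoothAt.pi {ι : Type*} [Fintype ι] {f : ι → M → G} {x : M}
    (h : ∀ i, FnSmoothAt n (f i) x) : FnSmoothAt n (fun y i => f i y) x := by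
  filter_upwards [eventually_all.mpr h] with y hy
  exact contMDiffAt_pi_space.mpr hy

theorem FnSmoothAt.mul {f g : M → ℂ} {x : M} (hf : FnSmoothAt n f x) (hg : FnSmoothAt n g x) :
    FnSmoothAt n (fun y => f y * g y) x := by
  filter_upwards [hf, hg] with y h1 h2
  exact ((contDiff_mul (𝕜 := ℝ) (𝔸 := ℂ) (n := ∞)).contMDiff.contMDiffAt (x := (f y, g y))).comp y
    (h1.prodMk_space h2)

theorem FnSmoothAt.finset_sum {ι : Type*} {f : ι → M → G} {x : M} (s : Finset ι)
    (h : ∀ i, FnSmoothAt n (f i) x) : FnSmoothAt n (fun y => ∑ i ∈ s, f i y) x := by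
  classical
  induction s using Finset.induction_on with
  | empty => simpa using fnSmoothAt_const (n := n) (0 : G) x
  | insert i s hi ih => simpa [Finset.sum_insert hi] using (h i).add ih

theorem dFn_congr {f g : M → G} {x : M} (h : ∀ᶠ y in 𝓝 x, f y = g y) :
    dFn (n := n) f x = dFn g x :=
  Filter.EventuallyEq.mfderiv_eq h

theorem dFn_const (c : G) (x : M) : dFn (n := n) (fun _ => c) x = 0 :=
  mfderiv_const

theorem dFn_comp_clm {H : Type*} [NormedAddCommGroup H] [NormedSpace ℝ H] {f : M → G} {x : M}
    (h : FnSmoothAt n f x) (φ : G →L[ℝ] H) :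
    dFn (n := n) (fun y => φ (f y)) x = φ.comp (dFn f x) := by
  have h1 : HasMFDerivAt 𝓘(ℝ, G) 𝓘(ℝ, H) (fun z => φ z) (f x) φ := φ.hasFDerivAt.hasMFDerivAt
  exact (h1.comp x h.mdifferentiableAt.hasMFDerivAt).mfderiv

theorem dFn_add {f g : M → G} {x : M} (hf : FnSmoothAt n f x) (hg : FnSmoothAt n g x) :
    dFn (n := n) (fun y => f y + g y) x = dFn f x + dFn g x :=
  (hf.mdifferentiableAt.hasMFDerivAt.add hg.mdifferentiableAt.hasMFDerivAt).mfderiv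

theorem dFn_re {f : M → ℂ} {x : M} (h : FnSmoothAt n f x) (v : TangentSpace (𝓡 n) x) :
    dFn (n := n) (fun y => (f y).re) x v = (dFn f x v).re := by
  have := dFn_comp_clm h Complex.reCLM
  exact congrArg (fun L => L v) this

theorem dFn_im {f : M → ℂ} {x : M} (h : FnSmoothAt n f x) (v : TangentSpace (𝓡 n) x) :
    dFn (n := n) (fun y => (f y).im) x v = (dFn f x v).im := by
  have := dFn_comp_clm h Complex.imCLM
  exact congrArg (fun L => L v) this

end FnSmooth

/-! ### Complexified vectors and smooth sections of complexified bundles. -/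

namespace Cx

variable {V W : Type*} [AddCommGroup V] [Module ℝ V] [AddCommGroup W] [Module ℝ W]

omit [Module ℝ V] in
@[simp] theorem conj_conj (v : Cx V) : conj (conj v) = v := by ext <;> simp
omit [Module ℝ V] in
@[simp] theorem conj_add (v w : Cx V) : conj (v + w) = conj v + conj w := by
  ext <;> simp [add_comm]
@[simp] theorem conj_smul (c : ℂ) (v : Cx V) : conj (c • v) = (starRingEnd ℂ) c • conj v := by
  ext <;> simp [add_comm]
@[simp] theorem map_conj (f : V →ₗ[ℝ] W) (v : Cx V) : map f (conj v) = conj (map f v) := by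
  ext <;> simp

theorem pair_smul_left (B : V →ₗ[ℝ] V →ₗ[ℝ] ℝ) (c : ℂ) (v w : Cx V) :
    pair B (c • v) w = c * pair B v w := by
  apply Complex.ext <;> simp [pair] <;> ring

theorem pair_smul_right (B : V →ₗ[ℝ] V →ₗ[ℝ] ℝ) (c : ℂ) (v w : Cx V) :
    pair B v (c • w) = c * pair B v w := by
  apply Complex.ext <;> simp [pair] <;> ring

end Cx

section SecSmooth

variable {n : ℕ} {M : Type*} [TopologicalSpace M] [ChartedSpace (EuclideanSpace ℝ (Fin n)) M]
  {F : Type*} [NormedAddCommGroup F] [NormedSpace ℝ F] {E : M → Type*}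
  [TopologicalSpace (Bundle.TotalSpace F E)] [∀ x, TopologicalSpace (E x)] [FiberBundle F E]

theorem SecSmoothAt.eventually {s : ∀ x, E x} {x : M} (h : SecSmoothAt n F s x) :
    ∀ᶠ y in 𝓝 x, SecSmoothAt n F s y :=
  eventually_eventually_nhds.mpr h

theorem SecSmoothAt.congr {s t : ∀ x, E x} {x : M} (h : SecSmoothAt n F s x)
    (hst : ∀ᶠ y in 𝓝 x, s y = t y) : SecSmoothAt n F t x := by
  filter_upwards [h, eventually_eventually_nhds.mpr hst] with y hy hg
  exact hy.congr_of_eventuallyEq (hg.mono fun _ h => by simp [h])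

theorem CSecSmoothAt.eventually {s : ∀ x, Cx (E x)} {x : M} (h : CSecSmoothAt n F s x) :
    ∀ᶠ y in 𝓝 x, CSecSmoothAt n F s y :=
  h.1.eventually.and h.2.eventually

theorem CSecSmoothAt.congr {s t : ∀ x, Cx (E x)} {x : M} (h : CSecSmoothAt n F s x)
    (hst : ∀ᶠ y in 𝓝 x, s y = t y) : CSecSmoothAt n F t x :=
  ⟨h.1.congr (hst.mono fun _ h => by rw [h]), h.2.congr (hst.mono fun _ h => by rw [h])⟩

variable [∀ x, AddCommGroup (E x)] [∀ x, Module ℝ (E x)] [VectorBundle ℝ F E]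

theorem SecSmoothAt.add {s t : ∀ x, E x} {x : M} (hs : SecSmoothAt n F s x)
    (ht : SecSmoothAt n F t x) : SecSmoothAt n F (fun y => s y + t y) x := by
  filter_upwards [hs, ht] with y h1 h2
  exact h1.add_section h2

theorem SecSmoothAt.neg {s : ∀ x, E x} {x : M} (hs : SecSmoothAt n F s x) :
    SecSmoothAt n F (fun y => -s y) x := by
  filter_upwards [hs] with y h1
  exact h1.neg_section

theorem SecSmoothAt.sub {s t : ∀ x, E x} {x : M} (hs : SecSmoothAt n F s x)
    (ht : SecSmoothAt n F t x) : SecSmoothAt n F (fun y => s y - t y) x := by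
  filter_upwards [hs, ht] with y h1 h2
  exact h1.sub_section h2

theorem SecSmoothAt.smul {f : M → ℝ} {s : ∀ x, E x} {x : M} (hf : FnSmoothAt n f x)
    (hs : SecSmoothAt n F s x) : SecSmoothAt n F (fun y => f y • s y) x := by
  filter_upwards [hf, hs] with y h1 h2
  exact h1.smul_section h2

theorem secSmoothAt_zero (x : M) : SecSmoothAt n F (fun y => (0 : E y)) x :=
  Eventually.of_forall fun y => (Bundle.contMDiff_zeroSection ℝ E) y

theorem CSecSmoothAt.add {s t : ∀ x, Cx (E x)} {x : M} (hs : CSecSmoothAt n F s x)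
    (ht : CSecSmoothAt n F t x) : CSecSmoothAt n F (fun y => s y + t y) x :=
  ⟨hs.1.add ht.1, hs.2.add ht.2⟩

theorem CSecSmoothAt.sub {s t : ∀ x, Cx (E x)} {x : M} (hs : CSecSmoothAt n F s x)
    (ht : CSecSmoothAt n F t x) : CSecSmoothAt n F (fun y => s y - t y) x :=
  ⟨hs.1.sub ht.1, hs.2.sub ht.2⟩

theorem CSecSmoothAt.conj {s : ∀ x, Cx (E x)} {x : M} (hs : CSecSmoothAt n F s x) :
    CSecSmoothAt n F (fun y => Cx.conj (s y)) x :=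
  ⟨hs.1, hs.2.neg⟩

theorem CSecSmoothAt.smul {f : M → ℂ} {s : ∀ x, Cx (E x)} {x : M} (hf : FnSmoothAt n f x)
    (hs : CSecSmoothAt n F s x) : CSecSmoothAt n F (fun y => f y • s y) x :=
  ⟨(hs.1.smul hf.re).sub (hs.2.smul hf.im), (hs.2.smul hf.re).add (hs.1.smul hf.im)⟩

theorem CSecSmoothAt.const_smul (c : ℂ) {s : ∀ x, Cx (E x)} {x : M} (hs : CSecSmoothAt n F s x) :
    CSecSmoothAt n F (fun y => c • s y) x :=
  hs.smul (fnSmoothAt_const c x)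

theorem csecSmoothAt_zero (x : M) : CSecSmoothAt n F (fun y => (0 : Cx (E y))) x :=
  ⟨secSmoothAt_zero x, secSmoothAt_zero x⟩

theorem CSecSmoothAt.finset_sum {ι : Type*} {s : ι → ∀ x, Cx (E x)} {x : M} (u : Finset ι)
    (hs : ∀ i, CSecSmoothAt n F (s i) x) : CSecSmoothAt n F (fun y => ∑ i ∈ u, s i y) x := by
  classical
  induction u using Finset.induction_on with
  | empty => simpa using csecSmoothAt_zero (n := n) (F := F) x
  | insert i u hi ih => simpa [Finset.sum_insert hi] using (hs i).add ih

omit [VectorBundle ℝ F E] in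
theorem CSecSmoothAt.map {F' : Type*} [NormedAddCommGroup F'] [NormedSpace ℝ F'] {E' : M → Type*}
    [TopologicalSpace (Bundle.TotalSpace F' E')] [∀ x, TopologicalSpace (E' x)] [FiberBundle F' E']
    [∀ x, AddCommGroup (E' x)] [∀ x, Module ℝ (E' x)] {φ : ∀ x, E x →ₗ[ℝ] E' x}
    (hφ : ∀ (s : ∀ x, E x) x, SecSmoothAt n F s x → SecSmoothAt n F' (fun y => φ y (s y)) x)
    {s : ∀ x, Cx (E x)} {x : M} (hs : CSecSmoothAt n F s x) :
    CSecSmoothAt n F' (fun y => Cx.map (φ y) (s y)) x :=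
  ⟨hφ _ x hs.1, hφ _ x hs.2⟩

end SecSmooth

/-! ### Smoothness of matrix inversion. -/

section MatrixSmooth

theorem contDiff_matrix_det {k : ℕ} :
    ContDiff ℝ ∞ (fun A : Fin k → Fin k → ℂ => (Matrix.of A).det) := by
  simp only [Matrix.det_apply]
  refine ContDiff.sum fun σ _ => ?_
  refine ContDiff.const_smul _ (contDiff_prod fun i _ => ?_)
  exact (contDiff_apply ℝ ℂ i).comp (contDiff_apply ℝ (Fin k → ℂ) (σ i))

theorem contDiffAt_matrix_inv {k : ℕ} {A : Fin k → Fin k → ℂ} (hA : (Matrix.of A).det ≠ 0)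
    (i j : Fin k) :
    ContDiffAt ℝ ∞ (fun B : Fin k → Fin k → ℂ => (Matrix.of B)⁻¹ i j) A := by
  -- Cramer's rule. It holds for singular `B` too, because both inverses are then zero by
  -- convention, so the function can be rewritten everywhere and not only near `A`.
  have h1 : ∀ B : Fin k → Fin k → ℂ, (Matrix.of B)⁻¹ i j =
      (Matrix.of B).det⁻¹ * (Matrix.of (Function.update B j (Pi.single i 1))).det := by
    intro B
    rw [Matrix.inv_def, Matrix.smul_apply, Matrix.adjugate_apply, Ring.inverse_eq_inv', smul_eq_mul]
    rfl
  simp only [h1]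
  refine (contDiff_matrix_det.contDiffAt.inv hA).mul
    (contDiff_matrix_det.comp (contDiff_pi.mpr fun l => ?_)).contDiffAt
  by_cases hl : l = j
  · subst hl
    simp only [Function.update_self]
    exact contDiff_const
  · simp only [Function.update_of_ne hl]
    exact contDiff_apply ℝ (Fin k → ℂ) l

end MatrixSmooth

/-! ### Local frames of complex vector bundles. -/

namespace FibreFamily

variable {n : ℕ} {M : Type*} [TopologicalSpace M] [ChartedSpace (EuclideanSpace ℝ (Fin n)) M]

/-- A family of sections that is a basis of every fibre near `x` and detects smoothness. -/
def IsFrameNear (n : ℕ) [ChartedSpace (EuclideanSpace ℝ (Fin n)) M] (V : FibreFamily M) {ι : Type*}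
    [Fintype ι] (e : ι → ∀ y, V.Fib y) (x : M) : Prop :=
  ∀ᶠ y in 𝓝 x,
    (∀ v : V.Fib y, ∃! c : ι → ℂ, v = ∑ i, c i • e i y) ∧
    ∀ s : ∀ y, V.Fib y, V.SmoothAt s y ↔
      ∃ f : ι → M → ℂ, (∀ i, FnSmoothAt n (f i) y) ∧ ∀ᶠ z in 𝓝 y, s z = ∑ i, f i z • e i z

theorem IsFrameNear.eventually {V : FibreFamily M} {ι : Type*} [Fintype ι] {e : ι → ∀ y, V.Fib y}
    {x : M} (h : V.IsFrameNear n e x) : ∀ᶠ y in 𝓝 x, V.IsFrameNear n e y :=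
  eventually_eventually_nhds.mpr h

theorem IsFrameNear.reindex {V : FibreFamily M} {ι κ : Type*} [Fintype ι] [Fintype κ]
    {e : ι → ∀ y, V.Fib y} {x : M} (h : V.IsFrameNear n e x) (σ : κ ≃ ι) :
    V.IsFrameNear n (fun i => e (σ i)) x := by
  have key : ∀ (y : M) (c : ι → ℂ), ∑ i, c i • e i y = ∑ j, c (σ j) • e (σ j) y := fun y c =>
    (Equiv.sum_comp σ (fun i => c i • e i y)).symm
  filter_upwards [h] with y hy
  refine ⟨fun v => ?_, fun s => (hy.2 s).trans ⟨?_, ?_⟩⟩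
  · obtain ⟨c, hc, hu⟩ := hy.1 v
    refine ⟨fun j => c (σ j), hc.trans (key y c), fun d hd => ?_⟩
    have := hu (fun i => d (σ.symm i)) (by
      simp only [key]
      simpa using hd)
    funext j
    simp [← this]
  · rintro ⟨f, hf, hs⟩
    exact ⟨fun j => f (σ j), fun j => hf _, hs.mono fun z hz => hz.trans (key z fun i => f i z)⟩
  · rintro ⟨f, hf, hs⟩
    refine ⟨fun i => f (σ.symm i), fun j => hf _, hs.mono fun z hz => hz.trans ?_⟩
    rw [key z fun i => f (σ.symm i) z]
    simp

theorem IsFrameNear.linearIndependent {V : FibreFamily M} {ι : Type*} [Fintype ι]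
    {e : ι → ∀ y, V.Fib y} {x : M} (h : V.IsFrameNear n e x) :
    LinearIndependent ℂ (fun i => e i x) := by
  rw [Fintype.linearIndependent_iff]
  intro g hg
  obtain ⟨c, -, hu⟩ := h.self_of_nhds.1 0
  have h1 := hu g hg.symm
  have h2 := hu 0 (by simp)
  intro i
  rw [h1, ← h2]
  rfl

theorem IsFrameNear.span_eq_top {V : FibreFamily M} {ι : Type*} [Fintype ι]
    {e : ι → ∀ y, V.Fib y} {x : M} (h : V.IsFrameNear n e x) :
    ⊤ ≤ Submodule.span ℂ (Set.range fun i => e i x) := by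
  intro v _
  obtain ⟨c, hc, -⟩ := h.self_of_nhds.1 v
  rw [hc]
  exact Submodule.sum_mem _ fun i _ => Submodule.smul_mem _ _ (Submodule.subset_span ⟨i, rfl⟩)

/-- The basis of the fibre at the centre of a frame. -/
def IsFrameNear.basis {V : FibreFamily M} {ι : Type*} [Fintype ι]
    {e : ι → ∀ y, V.Fib y} {x : M} (h : V.IsFrameNear n e x) : Module.Basis ι ℂ (V.Fib x) :=
  Module.Basis.mk h.linearIndependent h.span_eq_top

@[simp] theorem IsFrameNear.basis_apply {V : FibreFamily M} {ι : Type*} [Fintype ι]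
    {e : ι → ∀ y, V.Fib y} {x : M} (h : V.IsFrameNear n e x) (i : ι) : h.basis i = e i x := by
  simp [IsFrameNear.basis]

theorem IsFrameNear.smoothAt_iff {V : FibreFamily M} {ι : Type*} [Fintype ι]
    {e : ι → ∀ y, V.Fib y} {x : M} (h : V.IsFrameNear n e x) (s : ∀ y, V.Fib y) :
    V.SmoothAt s x ↔
      ∃ f : ι → M → ℂ, (∀ i, FnSmoothAt n (f i) x) ∧ ∀ᶠ z in 𝓝 x, s z = ∑ i, f i z • e i z :=
  h.self_of_nhds.2 s

/-- A frame transformed by a smooth matrix that is invertible at `x` is a frame near `x`. -/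
theorem IsFrameNear.of_matrix {V : FibreFamily M} {k : ℕ} {e g : Fin k → ∀ y, V.Fib y} {x : M}
    (h : V.IsFrameNear n e x) (A : M → Matrix (Fin k) (Fin k) ℂ)
    (hA : ∀ i j, FnSmoothAt n (fun y => A y i j) x)
    (hg : ∀ᶠ y in 𝓝 x, ∀ i, g i y = ∑ j, A y i j • e j y) (hdet : (A x).det ≠ 0) :
    V.IsFrameNear n g x := by
  have hA' : FnSmoothAt n (fun y => (fun i j => A y i j : Fin k → Fin k → ℂ)) x :=
    FnSmoothAt.pi fun i => FnSmoothAt.pi fun j => hA i j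
  have hdet' : ∀ᶠ y in 𝓝 x, (A y).det ≠ 0 := by
    have h1 : FnSmoothAt n (fun y => (A y).det) x := hA'.contDiff_comp contDiff_matrix_det
    exact h1.self_of_nhds.continuousAt.eventually_ne hdet
  have hinv : ∀ i j, FnSmoothAt n (fun y => (A y)⁻¹ i j) x := fun i j =>
    hA'.contDiffAt_comp (hdet'.mono fun y hy => contDiffAt_matrix_inv (A := A y) hy i j)
  -- change of coefficients
  have key : ∀ (y : M) (c : Fin k → ℂ), (∀ i, g i y = ∑ j, A y i j • e j y) →
      ∑ i, c i • g i y = ∑ j, (Matrix.vecMul c (A y)) j • e j y := by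
    intro y c hgy
    simp only [hgy, Finset.smul_sum, Matrix.vecMul, dotProduct, Finset.sum_smul, smul_smul]
    exact Finset.sum_comm
  filter_upwards [h.eventually, eventually_eventually_nhds.mpr hg, hdet', 
    eventually_eventually_nhds.mpr hdet',
    eventually_all.mpr fun i => eventually_all.mpr fun j => (hinv i j).eventually,
    eventually_all.mpr fun i => eventually_all.mpr fun j => (hA i j).eventually]
    with y hy hgy hdy hdy' hiy hAy
  have key2 : ∀ (z : M) (c : Fin k → ℂ), (A z).det ≠ 0 → (∀ i, g i z = ∑ j, A z i j • e j z) →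
      ∑ j, c j • e j z = ∑ i, (Matrix.vecMul c (A z)⁻¹) i • g i z := by
    intro z c hz hgz
    rw [key z _ hgz, Matrix.vecMul_vecMul, Matrix.nonsing_inv_mul _ (isUnit_iff_ne_zero.mpr hz),
      Matrix.vecMul_one]
  refine ⟨fun v => ?_, fun s => (hy.self_of_nhds.2 s).trans ⟨?_, ?_⟩⟩
  · obtain ⟨c, hc, hu⟩ := hy.self_of_nhds.1 v
    refine ⟨Matrix.vecMul c (A y)⁻¹, hc.trans (key2 y c hdy hgy.self_of_nhds), fun d hd => ?_⟩
    have := hu (Matrix.vecMul d (A y)) (hd.trans (key y d hgy.self_of_nhds))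
    rw [← this, Matrix.vecMul_vecMul, Matrix.mul_nonsing_inv _ (isUnit_iff_ne_zero.mpr hdy),
      Matrix.vecMul_one]
  · rintro ⟨f, hf, hs⟩
    refine ⟨fun i z => Matrix.vecMul (fun j => f j z) (A z)⁻¹ i, fun i => ?_, ?_⟩
    · simp only [Matrix.vecMul, dotProduct]
      exact FnSmoothAt.finset_sum _ fun j => (hf j).mul (hiy j i)
    · filter_upwards [hs, hdy', hgy] with z hz hdz hgz
      exact hz.trans (key2 z _ hdz hgz)
  · rintro ⟨f, hf, hs⟩
    refine ⟨fun i z => Matrix.vecMul (fun j => f j z) (A z) i, fun i => ?_, ?_⟩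
    · simp only [Matrix.vecMul, dotProduct]
      exact FnSmoothAt.finset_sum _ fun j => (hf j).mul (hAy j i)
    · filter_upwards [hs, hgy] with z hz hgz
      exact hz.trans (key z _ hgz)

/-- Smooth sections that form a basis of the fibre at `x` are a frame near `x`. -/
theorem IsFrameNear.of_basis {V : FibreFamily M} {k : ℕ} {e : Fin k → ∀ y, V.Fib y} {x : M}
    (h : V.IsFrameNear n e x) {ι : Type*} [Fintype ι] (g : ι → ∀ y, V.Fib y)
    (hg : ∀ i, V.SmoothAt (g i) x) (b : Module.Basis ι ℂ (V.Fib x)) (hb : ∀ i, b i = g i x) :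
    V.IsFrameNear n g x := by
  classical
  have hsm : ∀ i, ∃ f : Fin k → M → ℂ, (∀ j, FnSmoothAt n (f j) x) ∧
      ∀ᶠ z in 𝓝 x, g i z = ∑ j, f j z • e j z := fun i => (h.smoothAt_iff (g i)).mp (hg i)
  choose a ha hae using hsm
  let σ : Fin k ≃ ι := h.basis.indexEquiv b
  -- The transpose appears because `toMatrix` stores the coordinates of a vector as a column, while
  -- `of_matrix` expects them as a row.
  have hmat : (Matrix.of fun i j => a (σ i) j x) = (h.basis.toMatrix fun i => b (σ i)).transpose := by
    ext i j
    rw [Matrix.transpose_apply, Module.Basis.toMatrix_apply, hb, (hae (σ i)).self_of_nhds]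
    simp only [← h.basis_apply, map_sum, map_smul, Module.Basis.repr_self]
    simp [Finsupp.single_apply]
  have h2 : V.IsFrameNear n (fun i => g (σ i)) x := by
    refine h.of_matrix (fun y => Matrix.of fun i j => a (σ i) j y) (fun i j => ha _ _)
      (eventually_all.mpr fun i => hae (σ i)) ?_
    rw [hmat, Matrix.det_transpose]
    have h3 : IsUnit (h.basis.toMatrix (b.reindex σ.symm)).det := by
      rw [← Module.Basis.det_apply]
      exact h.basis.isUnit_det _
    have h4 : ((b.reindex σ.symm : Module.Basis (Fin k) ℂ (V.Fib x)) : Fin k → V.Fib x) =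
        fun i => b (σ i) := by
      funext i
      simp
    rw [h4] at h3
    exact h3.ne_zero
  simpa using h2.reindex σ.symm

theorem IsFrameNear.isVectorBundle {V : FibreFamily M}
    (h : ∀ x, ∃ (ι : Type) (_ : Fintype ι) (e : ι → ∀ y, V.Fib y), V.IsFrameNear n e x) :
    V.IsVectorBundle n := by
  intro x
  obtain ⟨ι, _, e, he⟩ := h x
  exact ⟨Fintype.card ι, _, he.reindex (Fintype.equivFin ι).symm⟩

/-- The image of a smooth idempotent endomorphism of a vector bundle is a vector bundle. -/
theorem IsVectorBundle.of_projection {V W : FibreFamily M} (hV : V.IsVectorBundle n)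
    (p : ∀ x, V.Fib x →ₗ[ℂ] V.Fib x) (hp : ∀ s x, V.SmoothAt s x → V.SmoothAt (fun y => p y (s y)) x)
    (hpp : ∀ x v, p x (p x v) = p x v) (hsub : ∀ s t x, V.SmoothAt s x → V.SmoothAt t x →
      V.SmoothAt (fun y => s y - t y) x)
    (ι : ∀ x, W.Fib x →ₗ[ℂ] V.Fib x) (hι : ∀ x, Function.Injective (ι x))
    (hr : ∀ x, LinearMap.range (ι x) = LinearMap.range (p x))
    (hW : ∀ s x, W.SmoothAt s x ↔ V.SmoothAt (fun y => ι y (s y)) x) : W.IsVectorBundle n := by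
  classical
  refine IsFrameNear.isVectorBundle fun x => ?_
  obtain ⟨k, e, he'⟩ := hV x
  have he : V.IsFrameNear n e x := he'
  have hcompl : IsCompl (LinearMap.range (p x)) (LinearMap.ker (p x)) := by
    have h : IsIdempotentElem (p x) := LinearMap.ext fun v => hpp x v
    exact LinearMap.IsIdempotentElem.isCompl h
  have : FiniteDimensional ℂ (V.Fib x) := Module.Finite.of_basis he.basis
  let b1 := Module.finBasis ℂ (LinearMap.range (p x))
  let b2 := Module.finBasis ℂ (LinearMap.ker (p x))
  -- A basis at `x` adapted to the splitting into image and kernel of the projection.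
  let b : Module.Basis (Fin _ ⊕ Fin _) ℂ (V.Fib x) :=
    (b1.prod b2).map (Submodule.prodEquivOfIsCompl _ _ hcompl)
  have hb1 : ∀ i, b (Sum.inl i) = b1 i := fun i => by simp [b]
  have hb2 : ∀ i, b (Sum.inr i) = b2 i := fun i => by simp [b]
  -- Extends a vector at `x` to a smooth section near `x`, with constant coefficients in the frame
  -- `e`.
  let ext : V.Fib x → ∀ y, V.Fib y := fun v y => ∑ j, he.basis.repr v j • e j y
  have hext : ∀ v, V.SmoothAt (ext v) x := fun v => (he.smoothAt_iff _).mpr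
    ⟨fun j _ => he.basis.repr v j, fun j => fnSmoothAt_const _ _, Eventually.of_forall fun _ => rfl⟩
  have hextx : ∀ v, ext v x = v := fun v => by
    simp only [ext, ← he.basis_apply]
    exact he.basis.sum_repr v
  -- Applying `p` and `1 - p` to the extensions keeps the first group in the image and the second in
  -- the kernel at every point, and leaves the basis at `x` unchanged. So `g` is a frame near `x`
  -- adapted to the splitting at all nearby points.
  let g : Fin _ ⊕ Fin _ → ∀ y, V.Fib y :=
    Sum.elim (fun i y => p y (ext (b1 i) y)) (fun i y => ext (b2 i) y - p y (ext (b2 i) y))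
  have hpb1 : ∀ i, p x (b1 i) = b1 i := fun i => by
    obtain ⟨w, hw⟩ := (b1 i).2
    rw [← hw, hpp]
  have hpb2 : ∀ i, p x (b2 i) = 0 := fun i => (b2 i).2
  have hgf : V.IsFrameNear n g x := by
    refine he.of_basis g ?_ b ?_
    · rintro (i | i)
      · exact hp _ _ (hext _)
      · exact hsub _ _ _ (hext _) (hp _ _ (hext _))
    · rintro (i | i)
      · rw [hb1]
        simp [g, hextx, hpb1]
      · rw [hb2]
        simp [g, hextx, hpb2]
  have hpre : ∀ y (v : V.Fib y), ∃ w, ι y w = p y v := fun y v => by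
    have : p y v ∈ LinearMap.range (ι y) := by rw [hr]; exact ⟨v, rfl⟩
    exact this
  choose q hq using hpre
  refine ⟨Fin _, inferInstance, fun i y => q y (ext (b1 i) y), ?_⟩
  have hpι : ∀ y (w : W.Fib y), p y (ι y w) = ι y w := fun y w => by
    have : ι y w ∈ LinearMap.range (p y) := by rw [← hr]; exact ⟨w, rfl⟩
    obtain ⟨v, hv⟩ := this
    rw [← hv, hpp]
  -- In the adapted frame, `p` just forgets the kernel coefficients; `hsum'` goes back by padding
  -- with zeros.
  have hsum : ∀ y (c : Fin _ ⊕ Fin _ → ℂ), p y (∑ i, c i • g i y) =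
      ι y (∑ i, c (Sum.inl i) • q y (ext (b1 i) y)) := by
    intro y c
    simp [g, hq, hpp]
  have hsum' : ∀ y c, ι y (∑ i, c i • q y (ext (b1 i) y)) =
      ∑ i, (Sum.elim c 0 : Fin _ ⊕ Fin _ → ℂ) i • g i y := by
    intro y c
    simp [g, hq]
  filter_upwards [hgf.eventually] with y hy
  refine ⟨fun v => ?_, fun s => ⟨fun hs => ?_, ?_⟩⟩
  · obtain ⟨c, hc, hu⟩ := hy.self_of_nhds.1 (ι y v)
    refine ⟨fun i => c (Sum.inl i), hι y ?_, fun d hd => ?_⟩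
    · change ι y v = _
      rw [← hsum, ← hc, hpι]
    · have := hu (Sum.elim d 0) (by
        change ι y v = _
        rw [← hsum', ← hd])
      rw [← this]
      rfl
  · obtain ⟨f, hf, hs'⟩ := (hy.smoothAt_iff _).mp ((hW s y).mp hs)
    refine ⟨fun i => f (Sum.inl i), fun i => hf _, hs'.mono fun z hz => hι z ?_⟩
    rw [← hsum z (fun i => f i z), ← hz, hpι]
  · rintro ⟨f, hf, hs⟩
    rw [hW, hy.smoothAt_iff]
    refine ⟨Sum.elim f 0, ?_, hs.mono fun z hz => ?_⟩
    · rintro (i | i)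
      · exact hf i
      · exact fnSmoothAt_const (0 : ℂ) y
    · rw [hz, hsum' z (fun i => f i z)]
      refine Finset.sum_congr rfl fun i _ => ?_
      rcases i with i | i <;> rfl

/-- A fibrewise isomorphism that matches the smooth sections transports vector bundles. -/
theorem IsVectorBundle.of_equiv {V W : FibreFamily M} (hW : W.IsVectorBundle n)
    (φ : ∀ x, V.Fib x ≃ₗ[ℂ] W.Fib x)
    (hφ : ∀ s x, V.SmoothAt s x ↔ W.SmoothAt (fun y => φ y (s y)) x) : V.IsVectorBundle n := by
  intro x
  obtain ⟨k, e, he⟩ := hW x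
  have key : ∀ (y : M) (v : V.Fib y) (c : Fin k → ℂ),
      v = ∑ i, c i • (φ y).symm (e i y) ↔ φ y v = ∑ i, c i • e i y := by
    intro y v c
    rw [← LinearEquiv.eq_symm_apply]
    simp
  refine ⟨k, fun i y => (φ y).symm (e i y), he.mono fun y hy => ⟨fun v => ?_, fun s => ?_⟩⟩
  · simpa only [key] using hy.1 (φ y v)
  · rw [hφ, hy.2]
    simp only [key]

end FibreFamily

/-! ### The complexification of a real vector bundle. -/

section CxFamily

variable {n : ℕ} {M : Type*} [TopologicalSpace M] [ChartedSpace (EuclideanSpace ℝ (Fin n)) M]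
  {F : Type*} [NormedAddCommGroup F] [NormedSpace ℝ F] {E : M → Type*}
  [TopologicalSpace (Bundle.TotalSpace F E)] [∀ x, TopologicalSpace (E x)] [FiberBundle F E]
  [∀ x, AddCommGroup (E x)] [∀ x, Module ℝ (E x)]

/-- The complexification of a real vector bundle. -/
def cxFamily (n : ℕ) [ChartedSpace (EuclideanSpace ℝ (Fin n)) M] (F : Type*)
    [NormedAddCommGroup F] [NormedSpace ℝ F] (E : M → Type*)
    [TopologicalSpace (Bundle.TotalSpace F E)] [∀ x, TopologicalSpace (E x)] [FiberBundle F E]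
    [∀ x, AddCommGroup (E x)] [∀ x, Module ℝ (E x)] : FibreFamily M where
  Fib x := Cx (E x)
  SmoothAt s x := CSecSmoothAt n F s x

/-- A real local frame from a trivialization is also a complex frame of the complexification: the
complex coefficients of a section are assembled from the real coefficients of its real and imaginary
parts. -/
theorem cxFamily_isVectorBundle [IsManifold (𝓡 n) ∞ M] [FiniteDimensional ℝ F] [VectorBundle ℝ F E]
    [ContMDiffVectorBundle ∞ F E (𝓡 n)] : (cxFamily n F E).IsVectorBundle n := by
  intro x
  have : ContMDiffVectorBundle 1 F E (𝓡 n) := .of_le (n := ∞) (by simp)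
  let b := Module.finBasis ℝ F
  let e := trivializationAt F E x
  refine ⟨_, fun i y => ⟨e.localFrame b i y, 0⟩, ?_⟩
  filter_upwards [e.open_baseSet.mem_nhds (FiberBundle.mem_baseSet_trivializationAt' x)] with y hy
  have sum_re : ∀ (z : M) (c : Fin _ → ℂ),
      (∑ i, c i • (⟨e.localFrame b i z, 0⟩ : Cx (E z))) =
        ⟨∑ i, (c i).re • e.localFrame b i z, ∑ i, (c i).im • e.localFrame b i z⟩ := by
    intro z c
    have h : ∀ u : Finset (Fin _), (∑ i ∈ u, c i • (⟨e.localFrame b i z, 0⟩ : Cx (E z))) =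
        ⟨∑ i ∈ u, (c i).re • e.localFrame b i z, ∑ i ∈ u, (c i).im • e.localFrame b i z⟩ := by
      classical
      intro u
      induction u using Finset.induction_on with
      | empty => rfl
      | insert i u hi ih =>
        rw [Finset.sum_insert hi, Finset.sum_insert hi, Finset.sum_insert hi, ih]
        ext1 <;> simp
    exact h _
  have key : ∀ z, ∀ hz : z ∈ e.baseSet, ∀ (c : Fin _ → ℂ) (v : Cx (E z)),
      v = ∑ i, c i • (⟨e.localFrame b i z, 0⟩ : Cx (E z)) ↔
      c = fun i => ⟨(e.basisAt b hz).repr v.re i, (e.basisAt b hz).repr v.im i⟩ := by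
    intro z hz c v
    rw [sum_re]
    simp only [Bundle.Trivialization.localFrame_apply_of_mem_baseSet _ _ hz]
    constructor
    · rintro rfl
      funext i
      apply Complex.ext <;> simp [Module.Basis.repr_self, Finsupp.single_apply]
    · rintro rfl
      ext1
      · exact ((e.basisAt b hz).sum_repr v.re).symm
      · exact ((e.basisAt b hz).sum_repr v.im).symm
  refine ⟨fun v => ?_, fun s => ?_⟩
  · refine ⟨_, (key y hy _ v).mpr rfl, fun c hc => (key y hy c v).mp hc⟩
  · have hnear : ∀ᶠ z in 𝓝 y, z ∈ e.baseSet := e.open_baseSet.mem_nhds hy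
    constructor
    · intro hs
      refine ⟨fun i z => ⟨e.localFrameCoeff (𝓡 n) b i z (s z).re,
        e.localFrameCoeff (𝓡 n) b i z (s z).im⟩, fun i => FnSmoothAt.of_re_im ?_ ?_, ?_⟩
      · filter_upwards [hs.1, hnear] with z hz hze
        exact contMDiffAt_localFrameCoeff b hze hz i
      · filter_upwards [hs.2, hnear] with z hz hze
        exact contMDiffAt_localFrameCoeff b hze hz i
      · filter_upwards [hnear] with z hz
        refine (key z hz _ _).mpr ?_
        funext i
        simp only [e.localFrameCoeff_apply_of_mem_baseSet b hz (fun z => (s z).re),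
          e.localFrameCoeff_apply_of_mem_baseSet b hz (fun z => (s z).im)]
    · rintro ⟨f, hf, hs⟩
      refine CSecSmoothAt.congr (CSecSmoothAt.finset_sum Finset.univ fun i => (?_ : CSecSmoothAt n F
        (fun z => f i z • (⟨e.localFrame b i z, 0⟩ : Cx (E z))) y)) (hs.mono fun z hz => hz.symm)
      refine CSecSmoothAt.smul (hf i) ⟨?_, secSmoothAt_zero y⟩
      filter_upwards [hnear] with z hz
      exact contMDiffAt_localFrame_of_mem ∞ e b i hz

end CxFamily

/-! ### Complex vector fields and their bracket. -/

section VFBracket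

variable {n : ℕ} {M : Type*} [TopologicalSpace M] [ChartedSpace (EuclideanSpace ℝ (Fin n)) M]

theorem vfBracket_congr {X X' Y Y' : ∀ x : M, CT n x} {x : M} (hX : ∀ᶠ y in 𝓝 x, X y = X' y)
    (hY : ∀ᶠ y in 𝓝 x, Y y = Y' y) : vfBracket X Y x = vfBracket X' Y' x := by
  have h1 : ∀ᶠ y in 𝓝 x, (X y).re = (X' y).re := hX.mono fun _ h => by rw [h]
  have h2 : ∀ᶠ y in 𝓝 x, (X y).im = (X' y).im := hX.mono fun _ h => by rw [h]
  have h3 : ∀ᶠ y in 𝓝 x, (Y y).re = (Y' y).re := hY.mono fun _ h => by rw [h]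
  have h4 : ∀ᶠ y in 𝓝 x, (Y y).im = (Y' y).im := hY.mono fun _ h => by rw [h]
  simp only [vfBracket, EventuallyEq.mlieBracket_vectorField_eq h1 h3,
    EventuallyEq.mlieBracket_vectorField_eq h2 h4, EventuallyEq.mlieBracket_vectorField_eq h1 h4,
    EventuallyEq.mlieBracket_vectorField_eq h2 h3]

variable [IsManifold (𝓡 n) ∞ M]

theorem VFSmoothAt.add {X Y : ∀ x : M, CT n x} {x : M} (hX : VFSmoothAt X x) (hY : VFSmoothAt Y x) :
    VFSmoothAt (fun y => X y + Y y) x :=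
  CSecSmoothAt.add (E := (TangentSpace (𝓡 n) : M → Type _)) hX hY

theorem VFSmoothAt.smul {f : M → ℂ} {X : ∀ x : M, CT n x} {x : M} (hf : FnSmoothAt n f x)
    (hX : VFSmoothAt X x) : VFSmoothAt (fun y => f y • X y) x :=
  CSecSmoothAt.smul (E := (TangentSpace (𝓡 n) : M → Type _)) hf hX

theorem VFSmoothAt.const_smul (c : ℂ) {X : ∀ x : M, CT n x} {x : M} (hX : VFSmoothAt X x) :
    VFSmoothAt (fun y => c • X y) x :=
  VFSmoothAt.smul (fnSmoothAt_const c x) hX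

theorem VFSmoothAt.congr {X Y : ∀ x : M, CT n x} {x : M} (hX : VFSmoothAt X x)
    (h : ∀ᶠ y in 𝓝 x, X y = Y y) : VFSmoothAt Y x :=
  CSecSmoothAt.congr (E := (TangentSpace (𝓡 n) : M → Type _)) hX h

theorem VFSmoothAt.eventually {X : ∀ x : M, CT n x} {x : M} (hX : VFSmoothAt X x) :
    ∀ᶠ y in 𝓝 x, VFSmoothAt X y :=
  CSecSmoothAt.eventually (E := (TangentSpace (𝓡 n) : M → Type _)) hX

end VFBracket

/-! ### The complexified Courant bracket. -/

namespace CourantAlgebroid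

variable {n : ℕ} {M : Type*} [TopologicalSpace M] [ChartedSpace (EuclideanSpace ℝ (Fin n)) M]
  [IsManifold (𝓡 n) ∞ M] {F : Type*} [NormedAddCommGroup F] [NormedSpace ℝ F] {E : M → Type*}
  [∀ x, AddCommGroup (E x)] [∀ x, Module ℝ (E x)] [∀ x, TopologicalSpace (E x)]
  [TopologicalSpace (Bundle.TotalSpace F E)] [FiberBundle F E]

theorem canchor_smooth (C : CourantAlgebroid n F E) {s : ∀ x, Cx (E x)} {x : M}
    (hs : CSecSmoothAt n F s x) : VFSmoothAt (fun y => Cx.map (C.anchor y) (s y)) x :=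
  ⟨C.anchor_smooth _ x hs.1, C.anchor_smooth _ x hs.2⟩

theorem cbracket_congr (C : CourantAlgebroid n F E) {s s' t t' : ∀ x, Cx (E x)} {x : M}
    (hs : CSecSmoothAt n F s x) (ht : CSecSmoothAt n F t x) (hss : ∀ᶠ y in 𝓝 x, s y = s' y)
    (htt : ∀ᶠ y in 𝓝 x, t y = t' y) : C.cbracket s t x = C.cbracket s' t' x := by
  have h1 : ∀ᶠ y in 𝓝 x, (s y).re = (s' y).re := hss.mono fun _ h => by rw [h]
  have h2 : ∀ᶠ y in 𝓝 x, (s y).im = (s' y).im := hss.mono fun _ h => by rw [h]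
  have h3 : ∀ᶠ y in 𝓝 x, (t y).re = (t' y).re := htt.mono fun _ h => by rw [h]
  have h4 : ∀ᶠ y in 𝓝 x, (t y).im = (t' y).im := htt.mono fun _ h => by rw [h]
  simp only [cbracket, C.bracket_local _ _ _ _ x hs.1 ht.1 h1 h3,
    C.bracket_local _ _ _ _ x hs.2 ht.2 h2 h4, C.bracket_local _ _ _ _ x hs.1 ht.2 h1 h4,
    C.bracket_local _ _ _ _ x hs.2 ht.1 h2 h3]

variable [VectorBundle ℝ F E] (C : CourantAlgebroid n F E)

theorem cbracket_smooth {s t : ∀ x, Cx (E x)} {x : M}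
    (hs : CSecSmoothAt n F s x) (ht : CSecSmoothAt n F t x) :
    CSecSmoothAt n F (C.cbracket s t) x :=
  ⟨(C.bracket_smooth _ _ x hs.1 ht.1).sub (C.bracket_smooth _ _ x hs.2 ht.2),
    (C.bracket_smooth _ _ x hs.1 ht.2).add (C.bracket_smooth _ _ x hs.2 ht.1)⟩

section Real

variable {s t u : ∀ x, E x} {x : M}

omit [VectorBundle ℝ F E] in
theorem bracket_fadd_left (hs : SecSmoothAt n F s x) (ht : SecSmoothAt n F t x)
    (hu : SecSmoothAt n F u x) :
    C.bracket (fun y => s y + t y) u x = C.bracket s u x + C.bracket t u x :=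
  C.bracket_add_left s t u x hs ht hu

omit [VectorBundle ℝ F E] in
theorem bracket_fadd_right (hs : SecSmoothAt n F s x) (ht : SecSmoothAt n F t x)
    (hu : SecSmoothAt n F u x) :
    C.bracket s (fun y => t y + u y) x = C.bracket s t x + C.bracket s u x :=
  C.bracket_add_right s t u x hs ht hu

theorem bracket_fsub_left (hs : SecSmoothAt n F s x) (ht : SecSmoothAt n F t x)
    (hu : SecSmoothAt n F u x) :
    C.bracket (fun y => s y - t y) u x = C.bracket s u x - C.bracket t u x := by
  rw [eq_sub_iff_add_eq, ← C.bracket_fadd_left (hs.sub ht) ht hu]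
  simp

theorem bracket_fsub_right (hs : SecSmoothAt n F s x) (ht : SecSmoothAt n F t x)
    (hu : SecSmoothAt n F u x) :
    C.bracket s (fun y => t y - u y) x = C.bracket s t x - C.bracket s u x := by
  rw [eq_sub_iff_add_eq, ← C.bracket_fadd_right hs (ht.sub hu) hu]
  simp

/-- The symmetric part of the Courant bracket. -/
theorem bracket_add_swap (hs : SecSmoothAt n F s x) (ht : SecSmoothAt n F t x) :
    C.bracket s t x + C.bracket t s x =
      (2 : ℝ) • C.coanchor x (dFn (fun y => C.pairing y (s y) (t y)) x).toLinearMap := by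
  -- Polarization: `bracket_self` at `s + t`, minus `bracket_self` at `s` and at `t`.
  have h := C.bracket_self (fun y => s y + t y) x (hs.add ht)
  have hp : (fun y => C.pairing y (s y + t y) (s y + t y)) = fun y =>
      (C.pairing y (s y) (s y) + C.pairing y (t y) (t y)) +
        (C.pairing y (s y) (t y) + C.pairing y (s y) (t y)) := by
    funext y
    simp only [map_add, LinearMap.add_apply, C.pairing_symm y (t y) (s y)]
    ring
  rw [C.bracket_fadd_left hs ht (hs.add ht), C.bracket_fadd_right hs hs ht,
    C.bracket_fadd_right ht hs ht, hp, dFn_add ((C.pairing_smooth _ _ x hs hs).add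
      (C.pairing_smooth _ _ x ht ht)) ((C.pairing_smooth _ _ x hs ht).add
      (C.pairing_smooth _ _ x hs ht)), dFn_add (C.pairing_smooth _ _ x hs hs)
      (C.pairing_smooth _ _ x ht ht), dFn_add (C.pairing_smooth _ _ x hs ht)
      (C.pairing_smooth _ _ x hs ht), C.bracket_self s x hs, C.bracket_self t x ht] at h
  simp only [ContinuousLinearMap.toLinearMap_add, map_add] at h
  rw [two_smul]
  have h2 := congrArg (fun z => z - C.coanchor x (dFn (fun y => C.pairing y (s y) (s y)) x).toLinearMap
    - C.coanchor x (dFn (fun y => C.pairing y (t y) (t y)) x).toLinearMap) h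
  rw [← sub_eq_zero] at h2 ⊢
  rw [← h2]
  abel

end Real

variable {s t u : ∀ x, Cx (E x)} {x : M}

omit [VectorBundle ℝ F E] in
theorem cbracket_add_left (hs : CSecSmoothAt n F s x) (ht : CSecSmoothAt n F t x)
    (hu : CSecSmoothAt n F u x) :
    C.cbracket (fun y => s y + t y) u x = C.cbracket s u x + C.cbracket t u x := by
  ext1 <;> simp only [cbracket, Cx.add_re, Cx.add_im]
  · rw [C.bracket_fadd_left hs.1 ht.1 hu.1, C.bracket_fadd_left hs.2 ht.2 hu.2]
    abel
  · rw [C.bracket_fadd_left hs.1 ht.1 hu.2, C.bracket_fadd_left hs.2 ht.2 hu.1]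
    abel

omit [VectorBundle ℝ F E] in
theorem cbracket_add_right (hs : CSecSmoothAt n F s x) (ht : CSecSmoothAt n F t x)
    (hu : CSecSmoothAt n F u x) :
    C.cbracket s (fun y => t y + u y) x = C.cbracket s t x + C.cbracket s u x := by
  ext1 <;> simp only [cbracket, Cx.add_re, Cx.add_im]
  · rw [C.bracket_fadd_right hs.1 ht.1 hu.1, C.bracket_fadd_right hs.2 ht.2 hu.2]
    abel
  · rw [C.bracket_fadd_right hs.1 ht.2 hu.2, C.bracket_fadd_right hs.2 ht.1 hu.1]
    abel

theorem cbracket_sub_right (hs : CSecSmoothAt n F s x) (ht : CSecSmoothAt n F t x)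
    (hu : CSecSmoothAt n F u x) :
    C.cbracket s (fun y => t y - u y) x = C.cbracket s t x - C.cbracket s u x := by
  rw [eq_sub_iff_add_eq, ← C.cbracket_add_right hs (ht.sub hu) hu]
  simp

theorem cbracket_sub_left (hs : CSecSmoothAt n F s x) (ht : CSecSmoothAt n F t x)
    (hu : CSecSmoothAt n F u x) :
    C.cbracket (fun y => s y - t y) u x = C.cbracket s u x - C.cbracket t u x := by
  rw [eq_sub_iff_add_eq, ← C.cbracket_add_left (hs.sub ht) ht hu]
  simp

/-- The bracket is the complexification of a real one, so it commutes with conjugation. This carries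
involutivity from one eigenbundle of a generalized complex structure to the other, and it gives
`conjIso`. -/
theorem cbracket_conj (hs : CSecSmoothAt n F s x) (ht : CSecSmoothAt n F t x) :
    C.cbracket (fun y => Cx.conj (s y)) (fun y => Cx.conj (t y)) x = Cx.conj (C.cbracket s t x) := by
  have neg_l : ∀ {a b : ∀ x, E x}, SecSmoothAt n F a x → SecSmoothAt n F b x →
      C.bracket (fun y => -a y) b x = -C.bracket a b x := by
    intro a b ha hb
    rw [eq_neg_iff_add_eq_zero, ← C.bracket_fadd_left ha.neg ha hb]
    simpa using C.bracket_fsub_left ha ha hb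
  have neg_r : ∀ {a b : ∀ x, E x}, SecSmoothAt n F a x → SecSmoothAt n F b x →
      C.bracket b (fun y => -a y) x = -C.bracket b a x := by
    intro a b ha hb
    rw [eq_neg_iff_add_eq_zero, ← C.bracket_fadd_right hb ha.neg ha]
    simpa using C.bracket_fsub_right hb ha ha
  ext1 <;> simp only [cbracket, Cx.conj_re, Cx.conj_im]
  · rw [neg_l hs.2 ht.2.neg, neg_r ht.2 hs.2, neg_neg]
  · rw [neg_l hs.2 ht.1, neg_r ht.2 hs.1, neg_add]

/-- The rule is clean only in the second argument: in the first, the Courant bracket has a further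
term coming from the differential of the function. On isotropic subbundles that case is recovered
from skew-symmetry. -/
theorem cbracket_leibniz {f : M → ℂ} (hf : FnSmoothAt n f x) (hs : CSecSmoothAt n F s x)
    (ht : CSecSmoothAt n F t x) :
    C.cbracket s (fun y => f y • t y) x =
      f x • C.cbracket s t x + lieD (Cx.map (C.anchor x) (s x)) f • t x := by
  ext1 <;> simp only [cbracket, Cx.smul_re, Cx.smul_im, Cx.add_re, Cx.add_im, lieD, Cx.map_re,
    Cx.map_im, Complex.add_re, Complex.add_im, Complex.I_mul_re, Complex.I_mul_im]
  · rw [C.bracket_fsub_right hs.1 (ht.1.smul hf.re) (ht.2.smul hf.im),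
      C.bracket_fadd_right hs.2 (ht.2.smul hf.re) (ht.1.smul hf.im),
      C.leibniz _ _ _ x hf.re hs.1 ht.1, C.leibniz _ _ _ x hf.im hs.1 ht.2,
      C.leibniz _ _ _ x hf.re hs.2 ht.2, C.leibniz _ _ _ x hf.im hs.2 ht.1]
    simp only [dFn_re hf, dFn_im hf]
    module
  · rw [C.bracket_fsub_right hs.2 (ht.1.smul hf.re) (ht.2.smul hf.im),
      C.bracket_fadd_right hs.1 (ht.2.smul hf.re) (ht.1.smul hf.im),
      C.leibniz _ _ _ x hf.re hs.1 ht.2, C.leibniz _ _ _ x hf.im hs.1 ht.1,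
      C.leibniz _ _ _ x hf.re hs.2 ht.1, C.leibniz _ _ _ x hf.im hs.2 ht.2]
    simp only [dFn_re hf, dFn_im hf]
    module

omit [VectorBundle ℝ F E] in
theorem canchor_cbracket (hs : CSecSmoothAt n F s x) (ht : CSecSmoothAt n F t x) :
    Cx.map (C.anchor x) (C.cbracket s t x) =
      vfBracket (fun y => Cx.map (C.anchor y) (s y)) (fun y => Cx.map (C.anchor y) (t y)) x := by
  ext1 <;> simp only [cbracket, vfBracket, Cx.map_re, Cx.map_im, map_sub, map_add]
  · rw [C.anchor_bracket _ _ x hs.1 ht.1, C.anchor_bracket _ _ x hs.2 ht.2]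
  · rw [C.anchor_bracket _ _ x hs.1 ht.2, C.anchor_bracket _ _ x hs.2 ht.1]

theorem cbracket_jacobi (hs : CSecSmoothAt n F s x) (ht : CSecSmoothAt n F t x)
    (hu : CSecSmoothAt n F u x) :
    C.cbracket s (C.cbracket t u) x =
      C.cbracket (C.cbracket s t) u x + C.cbracket t (C.cbracket s u) x := by
  have B := fun {a b : ∀ x, E x} (ha : SecSmoothAt n F a x) (hb : SecSmoothAt n F b x) =>
    C.bracket_smooth a b x ha hb
  ext1
  · simp only [Cx.add_re, cbracket]
    rw [C.bracket_fsub_right hs.1 (B ht.1 hu.1) (B ht.2 hu.2),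
      C.bracket_fadd_right hs.2 (B ht.1 hu.2) (B ht.2 hu.1),
      C.bracket_fsub_left (B hs.1 ht.1) (B hs.2 ht.2) hu.1,
      C.bracket_fadd_left (B hs.1 ht.2) (B hs.2 ht.1) hu.2,
      C.bracket_fsub_right ht.1 (B hs.1 hu.1) (B hs.2 hu.2),
      C.bracket_fadd_right ht.2 (B hs.1 hu.2) (B hs.2 hu.1),
      C.jacobi _ _ _ x hs.1 ht.1 hu.1, C.jacobi _ _ _ x hs.1 ht.2 hu.2,
      C.jacobi _ _ _ x hs.2 ht.1 hu.2, C.jacobi _ _ _ x hs.2 ht.2 hu.1]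
    abel
  · simp only [Cx.add_im, cbracket]
    rw [C.bracket_fsub_right hs.2 (B ht.1 hu.1) (B ht.2 hu.2),
      C.bracket_fadd_right hs.1 (B ht.1 hu.2) (B ht.2 hu.1),
      C.bracket_fsub_left (B hs.1 ht.1) (B hs.2 ht.2) hu.2,
      C.bracket_fadd_left (B hs.1 ht.2) (B hs.2 ht.1) hu.1,
      C.bracket_fsub_right ht.2 (B hs.1 hu.1) (B hs.2 hu.2),
      C.bracket_fadd_right ht.1 (B hs.1 hu.2) (B hs.2 hu.1),
      C.jacobi _ _ _ x hs.2 ht.1 hu.1, C.jacobi _ _ _ x hs.2 ht.2 hu.2,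
      C.jacobi _ _ _ x hs.1 ht.1 hu.2, C.jacobi _ _ _ x hs.1 ht.2 hu.1]
    abel

/-- The Courant bracket is skew on sections that are orthogonal to each other. -/
theorem cbracket_skew (hs : CSecSmoothAt n F s x) (ht : CSecSmoothAt n F t x)
    (hst : ∀ᶠ y in 𝓝 x, Cx.pair (C.pairing y) (s y) (t y) = 0) :
    C.cbracket s t x = -C.cbracket t s x := by
  have P := fun {a b : ∀ x, E x} (ha : SecSmoothAt n F a x) (hb : SecSmoothAt n F b x) =>
    C.pairing_smooth a b x ha hb
  -- A vanishing complex pairing is two real identities between pairings of real and imaginary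
  -- parts. Differentiated, they make the symmetric parts of the four real brackets cancel in pairs.
  have hre : dFn (n := n) (fun y => C.pairing y (s y).re (t y).re) x =
      dFn (fun y => C.pairing y (s y).im (t y).im) x := by
    refine dFn_congr (hst.mono fun y hy => ?_)
    simpa [Cx.pair, sub_eq_zero] using congrArg Complex.re hy
  have him : dFn (n := n) (fun y => C.pairing y (s y).re (t y).im) x +
      dFn (fun y => C.pairing y (s y).im (t y).re) x = 0 := by
    rw [← dFn_add (P hs.1 ht.2) (P hs.2 ht.1), ← dFn_const (n := n) (0 : ℝ) x]
    refine dFn_congr (hst.mono fun y hy => ?_)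
    simpa [Cx.pair] using congrArg Complex.im hy
  rw [eq_neg_iff_add_eq_zero]
  have h1 := C.bracket_add_swap hs.1 ht.1
  have h2 := C.bracket_add_swap hs.2 ht.2
  have h3 := C.bracket_add_swap hs.1 ht.2
  have h4 := C.bracket_add_swap hs.2 ht.1
  rw [hre, ← h2] at h1
  rw [eq_neg_of_add_eq_zero_left him, ContinuousLinearMap.toLinearMap_neg, map_neg, smul_neg,
    ← h4] at h3
  ext1 <;> simp only [cbracket, Cx.add_re, Cx.add_im, Cx.zero_re, Cx.zero_im]
  · rw [← sub_eq_zero] at h1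
    rw [← h1]
    abel
  · rw [eq_neg_iff_add_eq_zero] at h3
    rw [← h3]
    abel

end CourantAlgebroid

/-! ### Transport and isomorphisms of complex Lie algebroids. -/

section Isomorphisms

variable {n : ℕ} {M : Type*} [TopologicalSpace M] [ChartedSpace (EuclideanSpace ℝ (Fin n)) M]
  [IsManifold (𝓡 n) ∞ M]

namespace ComplexLieAlgebroid

/-- The complex Lie algebroid structure pulled back along a bundle isomorphism. -/
def transport {V W : FibreFamily M} (B : ComplexLieAlgebroid n W)
    (φ : ∀ x, V.Fib x ≃ₗ[ℂ] W.Fib x)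
    (hφ : ∀ s x, V.SmoothAt s x ↔ W.SmoothAt (fun y => φ y (s y)) x) :
    ComplexLieAlgebroid n V where
  anchor x := (B.anchor x).comp (φ x).toLinearMap
  bracket s t x := (φ x).symm (B.bracket (fun y => φ y (s y)) (fun y => φ y (t y)) x)
  isVectorBundle := B.isVectorBundle.of_equiv φ hφ
  anchor_smooth s x hs := B.anchor_smooth _ x ((hφ s x).mp hs)
  bracket_smooth s t x hs ht := by
    rw [hφ]
    simpa using B.bracket_smooth _ _ x ((hφ s x).mp hs) ((hφ t x).mp ht)
  bracket_local s s' t t' x hs ht hss htt := by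
    rw [B.bracket_local _ (fun y => φ y (s' y)) _ (fun y => φ y (t' y)) x ((hφ s x).mp hs)
      ((hφ t x).mp ht) (hss.mono fun _ h => by rw [h]) (htt.mono fun _ h => by rw [h])]
  bracket_add s t u x hs ht hu := by
    rw [← map_add, ← B.bracket_add _ _ _ x ((hφ s x).mp hs) ((hφ t x).mp ht) ((hφ u x).mp hu)]
    simp only [Pi.add_apply, map_add]
    rfl
  bracket_skew s t x hs ht := by
    rw [← map_neg, ← B.bracket_skew _ _ x ((hφ s x).mp hs) ((hφ t x).mp ht)]
  jacobi s t u x hs ht hu := by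
    simp only [LinearEquiv.apply_symm_apply]
    rw [← map_add, ← B.jacobi _ _ _ x ((hφ s x).mp hs) ((hφ t x).mp ht) ((hφ u x).mp hu)]
  leibniz f s t x hf hs ht := by
    have h := B.leibniz f _ _ x hf ((hφ s x).mp hs) ((hφ t x).mp ht)
    simp only [map_smul, h, map_add, LinearEquiv.symm_apply_apply]
    rfl
  anchor_bracket s t x hs ht := by
    simpa using B.anchor_bracket _ _ x ((hφ s x).mp hs) ((hφ t x).mp ht)

/-- The isomorphism along which the structure was pulled back. -/
def transportIso {V W : FibreFamily M} (B : ComplexLieAlgebroid n W)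
    (φ : ∀ x, V.Fib x ≃ₗ[ℂ] W.Fib x)
    (hφ : ∀ s x, V.SmoothAt s x ↔ W.SmoothAt (fun y => φ y (s y)) x) :
    (B.transport φ hφ).Iso B where
  toEquiv := φ
  smooth_iff := hφ
  anchor_eq _ _ := rfl
  bracket_eq _ _ x _ _ := (φ x).apply_symm_apply _

namespace Iso

variable {V W U : FibreFamily M} {A : ComplexLieAlgebroid n V} {B : ComplexLieAlgebroid n W}
  {D : ComplexLieAlgebroid n U}

/-- The inverse isomorphism. -/
def symm (f : A.Iso B) : B.Iso A where
  toEquiv x := (f.toEquiv x).symm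
  smooth_iff s x := by
    rw [f.smooth_iff]
    simp
  anchor_eq x v := by
    rw [← f.anchor_eq]
    simp
  bracket_eq s t x hs ht := by
    rw [LinearEquiv.symm_apply_eq, f.bracket_eq]
    · simp
    · rw [f.smooth_iff]
      simpa using hs
    · rw [f.smooth_iff]
      simpa using ht

/-- The composite of two isomorphisms. -/
def trans (f : A.Iso B) (g : B.Iso D) : A.Iso D where
  toEquiv x := (f.toEquiv x).trans (g.toEquiv x)
  smooth_iff s x := (f.smooth_iff s x).trans (g.smooth_iff _ x)
  anchor_eq x v := (g.anchor_eq x _).trans (f.anchor_eq x v)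
  bracket_eq s t x hs ht := by
    have h1 := f.bracket_eq s t x hs ht
    have h2 := g.bracket_eq _ _ x ((f.smooth_iff s x).mp hs) ((f.smooth_iff t x).mp ht)
    exact (congrArg (g.toEquiv x) h1).trans h2

/-- The isomorphism of the complex conjugates. -/
def conj (f : A.Iso B) : A.conj.Iso B.conj where
  toEquiv x :=
    { toFun := f.toEquiv x
      invFun := (f.toEquiv x).symm
      left_inv := (f.toEquiv x).left_inv
      right_inv := (f.toEquiv x).right_inv
      map_add' := (f.toEquiv x).map_add
      map_smul' := fun c v => (f.toEquiv x).map_smul ((starRingEnd ℂ) c) v }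
  smooth_iff := f.smooth_iff
  anchor_eq x v := congrArg Cx.conj (f.anchor_eq x v)
  bracket_eq := f.bracket_eq

end Iso

end ComplexLieAlgebroid

end Isomorphisms

/-! ### The splitting into `T_{0,1}` and `T_{1,0}`. -/

section AlmostComplex

variable {n : ℕ} {M : Type*} [TopologicalSpace M] [ChartedSpace (EuclideanSpace ℝ (Fin n)) M]
  {I : ∀ x : M, TangentSpace (𝓡 n) x →ₗ[ℝ] TangentSpace (𝓡 n) x} {x : M}

theorem mem_T01_iff {v : CT n x} : v ∈ T01 I x ↔ Cx.map (I x) v = -(Complex.I • v) := by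
  rw [← add_eq_zero_iff_eq_neg]
  exact LinearMap.mem_ker

theorem mem_T10_iff {v : CT n x} : v ∈ T10 I x ↔ Cx.map (I x) v = Complex.I • v := by
  rw [← sub_eq_zero]
  exact LinearMap.mem_ker

theorem conj_mem_T01_iff {v : CT n x} : Cx.conj v ∈ T01 I x ↔ v ∈ T10 I x := by
  rw [mem_T01_iff, mem_T10_iff, Cx.map_conj]
  constructor
  · intro h
    have h2 := congrArg Cx.conj h
    rw [Cx.conj_conj] at h2
    rw [h2]
    ext <;> simp
  · intro h
    rw [h]
    ext <;> simp

theorem pr01_add_pr10 (v : CT n x) : pr01 I x v + pr10 I x v = v := by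
  simp only [pr01, pr10, LinearMap.smul_apply, LinearMap.add_apply, LinearMap.sub_apply,
    LinearMap.id_apply]
  module

theorem pr01_of_mem_T01 {v : CT n x} (hv : v ∈ T01 I x) : pr01 I x v = v := by
  have h := pr01_add_pr10 (I := I) v
  rwa [pr10_of_mem_T01 hv, add_zero] at h

theorem pr01_of_mem_T10 {v : CT n x} (hv : v ∈ T10 I x) : pr01 I x v = 0 := by
  rw [mem_T10_iff] at hv
  simp [pr01, hv, smul_smul, mul_assoc]

theorem pr10_of_mem_T10 {v : CT n x} (hv : v ∈ T10 I x) : pr10 I x v = v := by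
  have h := pr01_add_pr10 (I := I) v
  rwa [pr01_of_mem_T10 hv, zero_add] at h

variable [IsManifold (𝓡 n) ∞ M]

theorem T01SmoothAt.eventually {X : ∀ x : M, CT n x} (hX : T01SmoothAt I X x) :
    ∀ᶠ y in 𝓝 x, T01SmoothAt I X y :=
  hX.1.eventually.and (eventually_eventually_nhds.mpr hX.2)

namespace IsComplexStructure

variable (hI : IsComplexStructure I)
include hI

theorem map_map (v : CT n x) : Cx.map (I x) (Cx.map (I x) v) = -v := by
  ext1 <;> simp [hI.sq]

theorem pr01_mem (v : CT n x) : pr01 I x v ∈ T01 I x := by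
  rw [mem_T01_iff]
  simp only [pr01, LinearMap.smul_apply, LinearMap.add_apply, LinearMap.id_apply, map_smul, map_add,
    hI.map_map]
  have : Complex.I • Complex.I • Cx.map (I x) v = -Cx.map (I x) v := by
    rw [smul_smul, Complex.I_mul_I, neg_one_smul]
  rw [smul_comm Complex.I (1 / 2 : ℂ), smul_add Complex.I, this]
  module

theorem pr10_mem (v : CT n x) : pr10 I x v ∈ T10 I x := by
  rw [mem_T10_iff]
  simp only [pr10, LinearMap.smul_apply, LinearMap.sub_apply, LinearMap.id_apply, map_smul, map_sub,
    hI.map_map]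
  have : Complex.I • Complex.I • Cx.map (I x) v = -Cx.map (I x) v := by
    rw [smul_smul, Complex.I_mul_I, neg_one_smul]
  rw [smul_comm Complex.I (1 / 2 : ℂ), smul_sub Complex.I, this]
  module

theorem pr01_smooth {X : ∀ x : M, CT n x} (hX : VFSmoothAt X x) :
    VFSmoothAt (fun y => pr01 I y (X y)) x :=
  (hX.add ((hI.smooth X x hX).const_smul Complex.I)).const_smul (1 / 2)

/-- Conjugation exchanges `T_{1,0}` and `T_{0,1}` and preserves brackets, so integrability of one is
integrability of the other. -/
theorem vfBracket_mem_T10 {X Y : ∀ x : M, CT n x} (hX : VFSmoothAt X x) (hY : VFSmoothAt Y x)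
    (hX' : ∀ᶠ y in 𝓝 x, X y ∈ T10 I y) (hY' : ∀ᶠ y in 𝓝 x, Y y ∈ T10 I y) :
    vfBracket X Y x ∈ T10 I x := by
  rw [← conj_mem_T01_iff, ← vfBracket_conj X Y x hX hY]
  exact hI.integrable _ _ x ⟨hX.conj, hX'.mono fun y h => conj_mem_T01_iff.mpr h⟩
    ⟨hY.conj, hY'.mono fun y h => conj_mem_T01_iff.mpr h⟩

end IsComplexStructure

end AlmostComplex

/-! ### Isotropic involutive subbundles as complex Lie algebroids. -/

namespace CourantAlgebroid

variable {n : ℕ} {M : Type*} [TopologicalSpace M] [ChartedSpace (EuclideanSpace ℝ (Fin n)) M]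
  [IsManifold (𝓡 n) ∞ M] {F : Type*} [NormedAddCommGroup F] [NormedSpace ℝ F] {E : M → Type*}
  [∀ x, AddCommGroup (E x)] [∀ x, Module ℝ (E x)] [∀ x, TopologicalSpace (E x)]
  [TopologicalSpace (Bundle.TotalSpace F E)] [FiberBundle F E]

theorem coe_toSub {V : Type*} [AddCommGroup V] [Module ℂ V] {S : Submodule ℂ V} {v : V}
    (h : v ∈ S) : (toSub S v : V) = v := by
  simp [toSub, h]

/-- A family of subspaces of the fibres of `E ⊗ ℂ`, with the smooth sections of `E ⊗ ℂ`. -/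
def subFamily (n : ℕ) [ChartedSpace (EuclideanSpace ℝ (Fin n)) M] (F : Type*)
    [NormedAddCommGroup F] [NormedSpace ℝ F] {E : M → Type*}
    [∀ x, AddCommGroup (E x)] [∀ x, Module ℝ (E x)] [∀ x, TopologicalSpace (E x)]
    [TopologicalSpace (Bundle.TotalSpace F E)] [FiberBundle F E]
    (L : ∀ x, Submodule ℂ (Cx (E x))) : FibreFamily M where
  Fib x := L x
  SmoothAt s x := CSecSmoothAt n F (fun y => (s y : Cx (E y))) x

/-- An isotropic involutive subbundle of `E ⊗ ℂ`, the image of a smooth projection. -/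
structure IsLieSubbundle (C : CourantAlgebroid n F E) (L : ∀ x, Submodule ℂ (Cx (E x))) : Prop where
  isotropic : ∀ x v w, v ∈ L x → w ∈ L x → Cx.pair (C.pairing x) v w = 0
  involutive : C.Involutive L
  exists_proj : ∃ p : ∀ x, Cx (E x) →ₗ[ℂ] Cx (E x),
    (∀ s x, CSecSmoothAt n F s x → CSecSmoothAt n F (fun y => p y (s y)) x) ∧
    (∀ x v, p x v ∈ L x) ∧ ∀ x v, v ∈ L x → p x v = v

theorem IsLieSubbundle.isVectorBundle [FiniteDimensional ℝ F] [VectorBundle ℝ F E]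
    [ContMDiffVectorBundle ∞ F E (𝓡 n)] {C : CourantAlgebroid n F E}
    {L : ∀ x, Submodule ℂ (Cx (E x))} (h : C.IsLieSubbundle L) :
    (subFamily n F L).IsVectorBundle n := by
  obtain ⟨p, hps, hpm, hpe⟩ := h.exists_proj
  refine (cxFamily_isVectorBundle (n := n) (F := F) (E := E)).of_projection p hps
    (fun x v => hpe x _ (hpm x v)) (fun s t x hs ht => CSecSmoothAt.sub hs ht)
    (fun x => (L x).subtype) (fun x => (L x).injective_subtype) (fun x => ?_) fun s x => Iff.rfl
  refine (Submodule.range_subtype (L x)).trans (le_antisymm (fun v hv => ⟨v, hpe x v hv⟩) ?_)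
  rintro _ ⟨v, rfl⟩
  exact hpm x v

/-- Isotropy kills the pairing whose differential is the symmetric part of the bracket. This is the
only obstacle to the Courant bracket being a Lie bracket on `L`. -/
theorem IsLieSubbundle.skew [VectorBundle ℝ F E] {C : CourantAlgebroid n F E}
    {L : ∀ x, Submodule ℂ (Cx (E x))} (h : C.IsLieSubbundle L) {s t : ∀ x, Cx (E x)} {x : M}
    (hs : CSecSmoothAt n F s x) (ht : CSecSmoothAt n F t x) (hsL : ∀ᶠ y in 𝓝 x, s y ∈ L y)
    (htL : ∀ᶠ y in 𝓝 x, t y ∈ L y) : C.cbracket s t x = -C.cbracket t s x :=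
  C.cbracket_skew hs ht ((hsL.and htL).mono fun y hy => h.isotropic y _ _ hy.1 hy.2)

theorem IsLieSubbundle.eventually_cbracket_mem {C : CourantAlgebroid n F E}
    {L : ∀ x, Submodule ℂ (Cx (E x))} (h : C.Involutive L) {s t : ∀ x, Cx (E x)} {x : M}
    (hs : CSecSmoothAt n F s x) (ht : CSecSmoothAt n F t x) (hsL : ∀ᶠ y in 𝓝 x, s y ∈ L y)
    (htL : ∀ᶠ y in 𝓝 x, t y ∈ L y) : ∀ᶠ y in 𝓝 x, C.cbracket s t y ∈ L y := by
  filter_upwards [hs.eventually, ht.eventually, eventually_eventually_nhds.mpr hsL,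
    eventually_eventually_nhds.mpr htL] with y h1 h2 h3 h4
  exact h s t y h1 h2 h3 h4

/-- An isotropic involutive subbundle is a complex Lie algebroid for the Courant bracket. -/
def lieAlgebroid [FiniteDimensional ℝ F] [VectorBundle ℝ F E] [ContMDiffVectorBundle ∞ F E (𝓡 n)]
    (C : CourantAlgebroid n F E) {L : ∀ x, Submodule ℂ (Cx (E x))} (h : C.IsLieSubbundle L) :
    ComplexLieAlgebroid n (subFamily n F L) :=
  have hval : ∀ (s : ∀ x, L x) (x : M), ∀ᶠ y in 𝓝 x, (s y : Cx (E y)) ∈ L y := fun s x =>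
    Eventually.of_forall fun y => (s y).2
  -- The bracket is forced into `L` by `toSub`, whose value is zero outside `L`. Involutivity shows
  -- that for smooth sections this default never occurs.
  have hbr : ∀ (s t : ∀ x, L x) (x : M), CSecSmoothAt n F (fun y => (s y : Cx (E y))) x →
      CSecSmoothAt n F (fun y => (t y : Cx (E y))) x →
      (toSub (L x) (C.cbracket (fun y => s y) (fun y => t y) x) : Cx (E x)) =
        C.cbracket (fun y => s y) (fun y => t y) x := fun s t x hs ht =>
    coe_toSub (h.involutive _ _ x hs ht (hval s x) (hval t x))
  have hbre : ∀ (s t : ∀ x, L x) (x : M), CSecSmoothAt n F (fun y => (s y : Cx (E y))) x →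
      CSecSmoothAt n F (fun y => (t y : Cx (E y))) x → ∀ᶠ y in 𝓝 x,
      C.cbracket (fun y => s y) (fun y => t y) y =
        (toSub (L y) (C.cbracket (fun y => s y) (fun y => t y) y) : Cx (E y)) :=
    fun s t x hs ht => by
      filter_upwards [hs.eventually, ht.eventually] with y h1 h2
      exact (hbr s t y h1 h2).symm
  { anchor := fun x => (Cx.map (C.anchor x)).comp (L x).subtype
    bracket := fun s t x => toSub (L x) (C.cbracket (fun y => (L y).subtype (s y))
      (fun y => (L y).subtype (t y)) x)
    isVectorBundle := h.isVectorBundle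
    anchor_smooth := fun s x hs => C.canchor_smooth hs
    bracket_smooth := fun s t x hs ht => (C.cbracket_smooth hs ht).congr (hbre s t x hs ht)
    bracket_local := fun s s' t t' x hs ht hss htt => congrArg (toSub (L x))
      (C.cbracket_congr hs ht (hss.mono fun _ h => by rw [h]) (htt.mono fun _ h => by rw [h]))
    bracket_add := fun s t u x hs ht hu => Subtype.ext <| by
      have e := C.cbracket_add_right hs ht hu
      exact (hbr s (fun y => t y + u y) x hs (ht.add hu)).trans
        (e.trans (congrArg₂ (· + ·) (hbr s t x hs ht) (hbr s u x hs hu)).symm)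
    bracket_skew := fun s t x hs ht => Subtype.ext <|
      (hbr s t x hs ht).trans ((h.skew hs ht (hval s x) (hval t x)).trans
        (congrArg Neg.neg (hbr t s x ht hs)).symm)
    jacobi := fun s t u x hs ht hu => Subtype.ext <| by
      have B := fun {a b : ∀ x, L x} (ha : CSecSmoothAt n F (fun y => (a y : Cx (E y))) x)
        (hb : CSecSmoothAt n F (fun y => (b y : Cx (E y))) x) =>
          (C.cbracket_smooth ha hb).congr (hbre a b x ha hb)
      have self : ∀ a : ∀ x, L x, ∀ᶠ y in 𝓝 x, (a y : Cx (E y)) = a y := fun a =>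
        Eventually.of_forall fun _ => rfl
      refine (hbr s _ x hs (B ht hu)).trans ?_
      -- The inner brackets agree with their `toSub` versions only near `x`, where the sections are
      -- known to be smooth; locality of the bracket is enough to exchange them.
      refine (C.cbracket_congr hs (C.cbracket_smooth ht hu) (self s) (hbre t u x ht hu)).symm.trans ?_
      refine (C.cbracket_jacobi hs ht hu).trans (congrArg₂ (· + ·) ?_ ?_)
      · exact (C.cbracket_congr (C.cbracket_smooth hs ht) hu (hbre s t x hs ht) (self u)).trans
          (hbr _ u x (B hs ht) hu).symm
      · exact (C.cbracket_congr ht (C.cbracket_smooth hs hu) (self t) (hbre s u x hs hu)).trans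
          (hbr t _ x ht (B hs hu)).symm
    leibniz := fun f s t x hf hs ht => Subtype.ext <|
      (hbr s (fun y => f y • t y) x hs (ht.smul hf)).trans <|
        (C.cbracket_leibniz hf hs ht).trans <|
        (congrArg (fun w => f x • w + lieD (Cx.map (C.anchor x) ((L x).subtype (s x))) f •
          (L x).subtype (t x)) (hbr s t x hs ht)).symm
    anchor_bracket := fun s t x hs ht =>
      (congrArg (Cx.map (C.anchor x)) (hbr s t x hs ht)).trans (C.canchor_cbracket hs ht) }

end CourantAlgebroid

/-! ### The reduction `L/D`: representatives, `∂̄` and bracket. -/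

namespace CourantAlgebroid

variable {n : ℕ} {M : Type*} [TopologicalSpace M] [ChartedSpace (EuclideanSpace ℝ (Fin n)) M]
  [IsManifold (𝓡 n) ∞ M] {F : Type*} [NormedAddCommGroup F] [NormedSpace ℝ F] {E : M → Type*}
  [∀ x, AddCommGroup (E x)] [∀ x, Module ℝ (E x)] [∀ x, TopologicalSpace (E x)]
  [TopologicalSpace (Bundle.TotalSpace F E)] [FiberBundle F E]

/-- `L` is an involutive isotropic subbundle containing the involutive lifting `D` of `T_{0,1}`
for the complex structure `I`; `lam` extends the inverse of the anchor `D → T_{0,1}` smoothly. -/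
structure IsReducible (C : CourantAlgebroid n F E)
    (I : ∀ x : M, TangentSpace (𝓡 n) x →ₗ[ℝ] TangentSpace (𝓡 n) x)
    (D L : ∀ x, Submodule ℂ (Cx (E x))) (lam : ∀ x : M, CT n x →ₗ[ℂ] Cx (E x)) : Prop where
  isComplexStructure : IsComplexStructure I
  isLieSubbundle : C.IsLieSubbundle L
  le : ∀ x, D x ≤ L x
  involutive : C.Involutive D
  anchor_mem : ∀ x, ∀ d ∈ D x, Cx.map (C.anchor x) d ∈ T01 I x
  lam_smooth : ∀ X x, VFSmoothAt X x → CSecSmoothAt n F (fun y => lam y (X y)) x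
  lam_mem : ∀ x, ∀ v ∈ T01 I x, lam x v ∈ D x
  anchor_lam : ∀ x, ∀ v ∈ T01 I x, Cx.map (C.anchor x) (lam x v) = v
  lam_anchor : ∀ x, ∀ d ∈ D x, lam x (Cx.map (C.anchor x) d) = d

namespace IsReducible

variable {C : CourantAlgebroid n F E}
  {I : ∀ x : M, TangentSpace (𝓡 n) x →ₗ[ℝ] TangentSpace (𝓡 n) x}
  {D L : ∀ x, Submodule ℂ (Cx (E x))} {lam : ∀ x : M, CT n x →ₗ[ℂ] Cx (E x)}
  (h : C.IsReducible I D L lam)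
include h

/-- `L` is isotropic and contains `D`. Consequently `(L ∩ Dᗮ + D)/D` collapses to `L/D`. -/
theorem le_perp (x : M) : L x ≤ Cx.perp (C.pairing x) (D x) := fun v hv d hd =>
  h.isLieSubbundle.isotropic x v d hv (h.le x hd)

theorem redSub_eq (x : M) : C.redSub D L x = (L x).map (D x).mkQ := by
  rw [redSub, inf_eq_left.mpr (h.le_perp x), sup_eq_left.mpr (h.le x)]

theorem mem_of_mkQ_mem {x : M} {v : Cx (E x)} (hv : (D x).mkQ v ∈ C.redSub D L x) : v ∈ L x := by
  rw [h.redSub_eq] at hv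
  obtain ⟨w, hw, hwv⟩ := hv
  have h1 : w - v ∈ D x := (Submodule.Quotient.eq (D x)).mp hwv
  have h2 := (L x).sub_mem hw (h.le x h1)
  rwa [sub_sub_cancel] at h2

theorem mkQ_mem {x : M} {v : Cx (E x)} (hv : v ∈ L x) : (D x).mkQ v ∈ C.redSub D L x := by
  rw [h.redSub_eq]
  exact ⟨v, hv, rfl⟩

/-- The reduction of `L` by `D`. -/
abbrev red : HolLieAlgebroidData n M := C.reduction I D L h.anchor_mem

/-- The inclusion of the reduction in `Dᗮ/D`. -/
def coe (x : M) : h.red.bundle.Fib x →ₗ[ℂ] Cx (E x) ⧸ D x := (C.redSub D L x).subtype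

theorem coe_injective (x : M) : Function.Injective (h.coe x) := (C.redSub D L x).injective_subtype

theorem coe_mem (x : M) (q : h.red.bundle.Fib x) : h.coe x q ∈ C.redSub D L x := Subtype.coe_prop _

/-- The class of a vector of `L` in the reduction. -/
def cls (x : M) (v : L x) : h.red.bundle.Fib x := (⟨(D x).mkQ v, h.mkQ_mem v.2⟩ : C.redSub D L x)

@[simp] theorem coe_cls (x : M) (v : L x) : h.coe x (h.cls x v) = (D x).mkQ v := rfl

/-- `v` is a smooth section of `L` near `x` that represents the section `s` of the reduction. -/
def IsRep (s : ∀ x, h.red.bundle.Fib x) (v : ∀ x, Cx (E x)) (x : M) : Prop :=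
  CSecSmoothAt n F v x ∧ ∀ᶠ y in 𝓝 x, v y ∈ L y ∧ (D y).mkQ (v y) = h.coe y (s y)

variable {s t : ∀ x, h.red.bundle.Fib x} {v w : ∀ x, Cx (E x)} {x : M}

/-- Since `D ≤ L`, a vector whose class lies in `L/D` is itself in `L`. So the arbitrary lifts to
`Dᗮ` chosen in the definitions of `∂̄` and bracket are automatically sections of `L`. -/
theorem isRep_iff_isLift : h.IsRep s v x ↔ C.IsLift D (fun y => h.coe y (s y)) v x := by
  refine and_congr_right fun _ => eventually_congr (Eventually.of_forall fun y => ?_)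
  refine ⟨fun hy => ⟨h.le_perp y hy.1, hy.2⟩, fun hy => ⟨h.mem_of_mkQ_mem ?_, hy.2⟩⟩
  rw [hy.2]
  exact h.coe_mem y (s y)

theorem smoothAt_iff : h.red.bundle.SmoothAt s x ↔ ∃ v, h.IsRep s v x :=
  exists_congr fun _ => h.isRep_iff_isLift.symm

omit h in
theorem IsRep.eventually {h : C.IsReducible I D L lam} {s : ∀ x, h.red.bundle.Fib x}
    (hv : h.IsRep s v x) : ∀ᶠ y in 𝓝 x, h.IsRep s v y :=
  hv.1.eventually.and (eventually_eventually_nhds.mpr hv.2)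

theorem IsRep.congr {s' : ∀ x, h.red.bundle.Fib x} (hv : h.IsRep s v x)
    (hs : ∀ᶠ y in 𝓝 x, s y = s' y) : h.IsRep s' v x :=
  ⟨hv.1, by filter_upwards [hv.2, hs] with y h1 h2; rwa [← h2]⟩

variable [VectorBundle ℝ F E]

theorem IsRep.add (hv : h.IsRep s v x) (hw : h.IsRep t w x) :
    h.IsRep (s + t) (fun y => v y + w y) x := by
  refine ⟨hv.1.add hw.1, ?_⟩
  filter_upwards [hv.2, hw.2] with y h1 h2
  refine ⟨(L y).add_mem h1.1 h2.1, ?_⟩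
  rw [map_add, h1.2, h2.2, ← map_add]
  rfl

theorem IsRep.smul {f : M → ℂ} (hf : FnSmoothAt n f x) (hv : h.IsRep s v x) :
    h.IsRep (fun y => f y • s y) (fun y => f y • v y) x := by
  refine ⟨hv.1.smul hf, ?_⟩
  filter_upwards [hv.2] with y h1
  refine ⟨(L y).smul_mem _ h1.1, ?_⟩
  rw [map_smul, h1.2, map_smul]

omit [VectorBundle ℝ F E] in
theorem IsRep.sub_mem (hv : h.IsRep s v x) (hw : h.IsRep s w x) :
    ∀ᶠ y in 𝓝 x, v y - w y ∈ D y := by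
  filter_upwards [hv.2, hw.2] with y h1 h2
  exact (Submodule.Quotient.eq (D y)).mp (h1.2.trans h2.2.symm)

omit [VectorBundle ℝ F E] in
-- The anchor is injective on `D`, with inverse `lam`, so the chosen lift is the only one; in
-- particular it is smooth.
theorem liftT01_eq {X : ∀ x : M, CT n x} {x : M} (hX : X x ∈ T01 I x) :
    C.liftT01 D X x = lam x (X x) := by
  have hex : ∃ d ∈ D x, Cx.map (C.anchor x) d = X x := ⟨_, h.lam_mem x _ hX, h.anchor_lam x _ hX⟩
  rw [liftT01, dif_pos hex]
  obtain ⟨h1, h2⟩ := hex.choose_spec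
  exact (h.lam_anchor x _ h1).symm.trans (congrArg (lam x) h2)

/-- Independence of the representative: two of them differ by a section of `D`, and the bracket of
the lift of `X` with it stays in `D` because `D` is involutive. -/
theorem coe_dbar {X : ∀ x : M, CT n x} (hX : T01SmoothAt I X x) (hv : h.IsRep s v x) :
    h.coe x (h.red.dbar X s x) = (D x).mkQ (C.cbracket (fun y => lam y (X y)) v x) := by
  have hlX := h.lam_smooth X x hX.1
  have hlD : ∀ᶠ y in 𝓝 x, lam y (X y) ∈ D y := hX.2.mono fun y hy => h.lam_mem y _ hy
  have hred : ∃ t, C.IsLift D (fun y => h.coe y (s y)) t x := ⟨v, h.isRep_iff_isLift.mp hv⟩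
  have hw : h.IsRep s hred.choose x := h.isRep_iff_isLift.mpr hred.choose_spec
  have e1 : C.redDbar D X (fun y => h.coe y (s y)) x =
      (D x).mkQ (C.cbracket (fun y => lam y (X y)) v x) := by
    rw [redDbar, dif_pos hred, ← C.cbracket_congr hlX hw.1
      (hX.2.mono fun y hy => (h.liftT01_eq hy).symm) (Eventually.of_forall fun _ => rfl)]
    refine (Submodule.Quotient.eq (D x)).mpr ?_
    rw [← C.cbracket_sub_right hlX hw.1 hv.1]
    exact h.involutive _ _ x hlX (hw.1.sub hv.1) hlD (hw.sub_mem h hv)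
  change ((toSub (C.redSub D L x) (C.redDbar D X (fun y => h.coe y (s y)) x) : C.redSub D L x) :
    Cx (E x) ⧸ D x) = _
  rw [e1]
  exact coe_toSub (h.mkQ_mem (h.isLieSubbundle.involutive _ _ x hlX hv.1
    (hlD.mono fun y hy => h.le y hy) (hv.2.mono fun y hy => hy.1)))

theorem IsRep.dbar {X : ∀ x : M, CT n x} (hX : T01SmoothAt I X x) (hv : h.IsRep s v x) :
    h.IsRep (h.red.dbar X s) (C.cbracket (fun y => lam y (X y)) v) x := by
  have hlX := h.lam_smooth X x hX.1
  have hlL : ∀ᶠ y in 𝓝 x, lam y (X y) ∈ L y := hX.2.mono fun y hy => h.le y (h.lam_mem y _ hy)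
  refine ⟨C.cbracket_smooth hlX hv.1, (IsLieSubbundle.eventually_cbracket_mem
    h.isLieSubbundle.involutive hlX hv.1 hlL (hv.2.mono fun y hy => hy.1)).and ?_⟩
  filter_upwards [hv.eventually, hX.1.eventually, eventually_eventually_nhds.mpr hX.2]
    with y h1 h2 h3
  exact (h.coe_dbar ⟨h2, h3⟩ h1).symm

/-- The bracket of a section of `D` with a representative of a `∂̄`-closed section lies in `D`. -/
theorem cbracket_mem_of_dbar_eq_zero {d : ∀ x, Cx (E x)} (hd : CSecSmoothAt n F d x)
    (hdD : ∀ᶠ y in 𝓝 x, d y ∈ D y) (hv : h.IsRep s v x)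
    (hs : ∀ X, T01SmoothAt I X x → h.red.dbar X s x = 0) : C.cbracket d v x ∈ D x := by
  -- A section of `D` is the lift of its own anchor, so bracketing with it represents `∂̄` along
  -- that anchor.
  have hX : T01SmoothAt I (fun y => Cx.map (C.anchor y) (d y)) x :=
    ⟨C.canchor_smooth hd, hdD.mono fun y hy => h.anchor_mem y _ hy⟩
  have h1 := h.coe_dbar hX hv
  rw [hs _ hX, map_zero, ← C.cbracket_congr hd hv.1
    (hdD.mono fun y hy => (h.lam_anchor y _ hy).symm) (Eventually.of_forall fun _ => rfl)] at h1
  exact (Submodule.Quotient.mk_eq_zero (D x)).mp h1.symm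

omit [VectorBundle ℝ F E] in
theorem HolAt.exists_rep (hs : h.red.HolAt s x) : ∃ v, h.IsRep s v x :=
  h.smoothAt_iff.mp hs.self_of_nhds.1

omit [VectorBundle ℝ F E] in
theorem HolAt.eventually (hs : h.red.HolAt s x) : ∀ᶠ y in 𝓝 x, h.red.HolAt s y :=
  eventually_eventually_nhds.mpr hs

theorem cbracket_mem_left {d : ∀ x, Cx (E x)} (hd : CSecSmoothAt n F d x)
    (hdD : ∀ᶠ y in 𝓝 x, d y ∈ D y) (hs : h.red.HolAt s x) (hv : h.IsRep s v x) :
    C.cbracket d v x ∈ D x :=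
  h.cbracket_mem_of_dbar_eq_zero hd hdD hv hs.self_of_nhds.2

theorem cbracket_mem_right {d : ∀ x, Cx (E x)} (hd : CSecSmoothAt n F d x)
    (hdD : ∀ᶠ y in 𝓝 x, d y ∈ D y) (hs : h.red.HolAt s x) (hv : h.IsRep s v x) :
    C.cbracket v d x ∈ D x := by
  rw [h.isLieSubbundle.skew hv.1 hd (hv.2.mono fun y hy => hy.1) (hdD.mono fun y hy => h.le y hy)]
  exact (D x).neg_mem (h.cbracket_mem_left hd hdD hs hv)

/-- Representatives of holomorphic sections normalize `D`, so the class of their bracket does not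
change when either of them is altered by a section of `D`. For sections that are not holomorphic
this fails in general. -/
theorem coe_bracket (hs : h.red.HolAt s x) (ht : h.red.HolAt t x) (hv : h.IsRep s v x)
    (hw : h.IsRep t w x) :
    h.coe x (h.red.bracket s t x) = (D x).mkQ (C.cbracket v w x) := by
  have hred : (∃ u, C.IsLift D (fun y => h.coe y (s y)) u x) ∧
      ∃ u, C.IsLift D (fun y => h.coe y (t y)) u x :=
    ⟨⟨v, h.isRep_iff_isLift.mp hv⟩, ⟨w, h.isRep_iff_isLift.mp hw⟩⟩
  have hv' : h.IsRep s hred.1.choose x := h.isRep_iff_isLift.mpr hred.1.choose_spec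
  have hw' : h.IsRep t hred.2.choose x := h.isRep_iff_isLift.mpr hred.2.choose_spec
  have e1 : C.redBracket D (fun y => h.coe y (s y)) (fun y => h.coe y (t y)) x =
      (D x).mkQ (C.cbracket v w x) := by
    rw [redBracket, dif_pos hred]
    refine (Submodule.Quotient.eq (D x)).mpr ?_
    -- Uses `[v', w'] - [v, w] = [v' - v, w'] + [v, w' - w]`, where both terms on the right lie in
    -- `D`.
    have h1 := h.cbracket_mem_left (hv'.1.sub hv.1) (hv'.sub_mem h hv) ht hw'
    have h2 := h.cbracket_mem_right (hw'.1.sub hw.1) (hw'.sub_mem h hw) hs hv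
    rw [C.cbracket_sub_left hv'.1 hv.1 hw'.1] at h1
    rw [C.cbracket_sub_right hv.1 hw'.1 hw.1] at h2
    simpa using (D x).add_mem h1 h2
  change ((toSub (C.redSub D L x) (C.redBracket D (fun y => h.coe y (s y))
    (fun y => h.coe y (t y)) x) : C.redSub D L x) : Cx (E x) ⧸ D x) = _
  rw [e1]
  exact coe_toSub (h.mkQ_mem (h.isLieSubbundle.involutive _ _ x hv.1 hw.1
    (hv.2.mono fun y hy => hy.1) (hw.2.mono fun y hy => hy.1)))

theorem IsRep.bracket (hs : h.red.HolAt s x) (ht : h.red.HolAt t x) (hv : h.IsRep s v x)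
    (hw : h.IsRep t w x) : h.IsRep (h.red.bracket s t) (C.cbracket v w) x := by
  refine ⟨C.cbracket_smooth hv.1 hw.1, (IsLieSubbundle.eventually_cbracket_mem
    h.isLieSubbundle.involutive hv.1 hw.1 (hv.2.mono fun y hy => hy.1)
    (hw.2.mono fun y hy => hy.1)).and ?_⟩
  filter_upwards [hv.eventually, hw.eventually, HolAt.eventually h hs, HolAt.eventually h ht]
    with y h1 h2 h3 h4
  exact (h.coe_bracket h3 h4 h1 h2).symm

/-- By Jacobi, `[X̃, [v, w]] = [[X̃, v], w] + [v, [X̃, w]]`. The inner brackets are sections of `D`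
near the point because `v` and `w` represent holomorphic sections, and then the outer brackets lie
in `D` for the same reason. -/
theorem holAt_bracket (hs : h.red.HolAt s x) (ht : h.red.HolAt t x) :
    h.red.HolAt (h.red.bracket s t) x := by
  obtain ⟨v, hv⟩ := HolAt.exists_rep h hs
  obtain ⟨w, hw⟩ := HolAt.exists_rep h ht
  filter_upwards [hv.eventually, hw.eventually, HolAt.eventually h hs, HolAt.eventually h ht]
    with y h1 h2 h3 h4
  have hb := IsRep.bracket h h3 h4 h1 h2
  refine ⟨h.smoothAt_iff.mpr ⟨_, hb⟩, fun X hX => h.coe_injective y ?_⟩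
  have hlX := h.lam_smooth X y hX.1
  have hlD : ∀ᶠ z in 𝓝 y, lam z (X z) ∈ D z := hX.2.mono fun z hz => h.lam_mem z _ hz
  rw [h.coe_dbar hX hb, map_zero, C.cbracket_jacobi hlX h1.1 h2.1]
  refine (Submodule.Quotient.mk_eq_zero (D y)).mpr ((D y).add_mem ?_ ?_)
  · refine h.cbracket_mem_left (C.cbracket_smooth hlX h1.1) ?_ h4 h2
    filter_upwards [hlX.eventually, eventually_eventually_nhds.mpr hlD, h1.eventually,
      HolAt.eventually h h3] with z k1 k2 k3 k4
    exact h.cbracket_mem_left k1 k2 k4 k3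
  · refine h.cbracket_mem_right (C.cbracket_smooth hlX h2.1) ?_ h3 h1
    filter_upwards [hlX.eventually, eventually_eventually_nhds.mpr hlD, h2.eventually,
      HolAt.eventually h h4] with z k1 k2 k3 k4
    exact h.cbracket_mem_left k1 k2 k4 k3

end IsReducible

end CourantAlgebroid

/-! ### Canonical representatives and the holomorphic Lie algebroid laws. -/

namespace CourantAlgebroid

variable {n : ℕ} {M : Type*} [TopologicalSpace M] [ChartedSpace (EuclideanSpace ℝ (Fin n)) M]
  [IsManifold (𝓡 n) ∞ M] {F : Type*} [NormedAddCommGroup F] [NormedSpace ℝ F] {E : M → Type*}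
  [∀ x, AddCommGroup (E x)] [∀ x, Module ℝ (E x)] [∀ x, TopologicalSpace (E x)]
  [TopologicalSpace (Bundle.TotalSpace F E)] [FiberBundle F E]

namespace IsReducible

variable {C : CourantAlgebroid n F E}
  {I : ∀ x : M, TangentSpace (𝓡 n) x →ₗ[ℝ] TangentSpace (𝓡 n) x}
  {D L : ∀ x, Submodule ℂ (Cx (E x))} {lam : ∀ x : M, CT n x →ₗ[ℂ] Cx (E x)}
  (h : C.IsReducible I D L lam)
include h

/-- The endomorphism of `E ⊗ ℂ` that subtracts from a vector the lift of the `T_{0,1}`-part of its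
anchor. -/
def sigma (_ : C.IsReducible I D L lam) (x : M) : Cx (E x) →ₗ[ℂ] Cx (E x) :=
  LinearMap.id - (lam x).comp ((pr01 I x).comp (Cx.map (C.anchor x)))

theorem sigma_apply (x : M) (v : Cx (E x)) :
    h.sigma x v = v - lam x (pr01 I x (Cx.map (C.anchor x) v)) := rfl

theorem sub_sigma_mem (x : M) (v : Cx (E x)) : v - h.sigma x v ∈ D x := by
  rw [sigma_apply, sub_sub_cancel]
  exact h.lam_mem x _ (h.isComplexStructure.pr01_mem _)

theorem sigma_of_mem {x : M} {d : Cx (E x)} (hd : d ∈ D x) : h.sigma x d = 0 := by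
  rw [sigma_apply, pr01_of_mem_T01 (h.anchor_mem x d hd), h.lam_anchor x d hd, sub_self]

/-- `sigma` kills `D` and `1 - sigma` takes values in `D`, so `sigma` is a projection with kernel
`D`. It therefore descends to the quotient and realizes `L/D` as a subbundle of `L`. -/
theorem sigma_sigma (x : M) (v : Cx (E x)) : h.sigma x (h.sigma x v) = h.sigma x v := by
  have h1 := h.sigma_of_mem (h.sub_sigma_mem x v)
  rw [map_sub, sub_eq_zero] at h1
  exact h1.symm

theorem sigma_mem {x : M} {v : Cx (E x)} (hv : v ∈ L x) : h.sigma x v ∈ L x := by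
  have := (L x).sub_mem hv (h.le x (h.sub_sigma_mem x v))
  rwa [sub_sub_cancel] at this

theorem mkQ_sigma (x : M) (v : Cx (E x)) : (D x).mkQ (h.sigma x v) = (D x).mkQ v :=
  ((Submodule.Quotient.eq (D x)).mpr (h.sub_sigma_mem x v)).symm

theorem anchor_sigma (x : M) (v : Cx (E x)) :
    Cx.map (C.anchor x) (h.sigma x v) = pr10 I x (Cx.map (C.anchor x) v) := by
  rw [sigma_apply, map_sub, h.anchor_lam x _ (h.isComplexStructure.pr01_mem _), sub_eq_iff_eq_add,
    add_comm, pr01_add_pr10]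

/-- The representative of a vector of the reduction whose anchor lies in `T_{1,0}`. -/
def rep (x : M) : h.red.bundle.Fib x →ₗ[ℂ] Cx (E x) :=
  ((D x).liftQ (h.sigma x) fun _ hd => h.sigma_of_mem hd).comp (h.coe x)

theorem rep_of_mkQ {x : M} {q : h.red.bundle.Fib x} {v : Cx (E x)}
    (hv : (D x).mkQ v = h.coe x q) : h.rep x q = h.sigma x v :=
  congrArg ((D x).liftQ (h.sigma x) fun _ hd => h.sigma_of_mem hd) hv.symm

theorem exists_mkQ (x : M) (q : h.red.bundle.Fib x) : ∃ v ∈ L x, (D x).mkQ v = h.coe x q := by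
  have := h.coe_mem x q
  rw [h.redSub_eq] at this
  exact this

theorem mkQ_rep (x : M) (q : h.red.bundle.Fib x) : (D x).mkQ (h.rep x q) = h.coe x q := by
  obtain ⟨v, -, hq⟩ := h.exists_mkQ x q
  rw [h.rep_of_mkQ hq, h.mkQ_sigma, hq]

theorem rep_mem (x : M) (q : h.red.bundle.Fib x) : h.rep x q ∈ L x := by
  obtain ⟨v, hv, hq⟩ := h.exists_mkQ x q
  rw [h.rep_of_mkQ hq]
  exact h.sigma_mem hv

theorem anchor_of_mkQ {x : M} {q : h.red.bundle.Fib x} {v : Cx (E x)}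
    (hv : (D x).mkQ v = h.coe x q) : h.red.anchor x q = pr10 I x (Cx.map (C.anchor x) v) := by
  have hker : D x ≤ LinearMap.ker ((pr10 I x).comp (Cx.map (C.anchor x))) := fun d hd =>
    pr10_of_mem_T01 (h.anchor_mem x d hd)
  exact congrArg ((D x).liftQ _ hker) hv.symm

theorem anchor_rep (x : M) (q : h.red.bundle.Fib x) :
    Cx.map (C.anchor x) (h.rep x q) = h.red.anchor x q := by
  obtain ⟨v, -, hq⟩ := h.exists_mkQ x q
  rw [h.rep_of_mkQ hq, h.anchor_sigma, h.anchor_of_mkQ hq]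

theorem rep_injective (x : M) : Function.Injective (h.rep x) := fun q r hqr => by
  refine h.coe_injective x ?_
  rw [← h.mkQ_rep, hqr, h.mkQ_rep]

theorem anchor_red_mem (x : M) (q : h.red.bundle.Fib x) : h.red.anchor x q ∈ T10 I x := by
  obtain ⟨v, -, hq⟩ := h.exists_mkQ x q
  rw [h.anchor_of_mkQ hq]
  exact h.isComplexStructure.pr10_mem _

variable [VectorBundle ℝ F E] {s t u : ∀ x, h.red.bundle.Fib x} {v w : ∀ x, Cx (E x)} {x : M}

theorem sigma_smooth (hv : CSecSmoothAt n F v x) :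
    CSecSmoothAt n F (fun y => h.sigma y (v y)) x :=
  hv.sub (h.lam_smooth _ x (h.isComplexStructure.pr01_smooth (C.canchor_smooth hv)))

theorem isRep_rep (hs : h.red.bundle.SmoothAt s x) : h.IsRep s (fun y => h.rep y (s y)) x := by
  obtain ⟨v, hv⟩ := h.smoothAt_iff.mp hs
  refine ⟨(h.sigma_smooth hv.1).congr (hv.2.mono fun y hy => (h.rep_of_mkQ hy.2).symm),
    Eventually.of_forall fun y => ⟨h.rep_mem y _, h.mkQ_rep y _⟩⟩

/-- Smoothness in the quotient, defined by the existence of some smooth lift, can be tested on one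
canonical lift, because `sigma` is smooth and turns any lift into that one. -/
theorem smoothAt_iff_rep :
    h.red.bundle.SmoothAt s x ↔ CSecSmoothAt n F (fun y => h.rep y (s y)) x :=
  ⟨fun hs => (h.isRep_rep hs).1, fun hs => h.smoothAt_iff.mpr
    ⟨_, hs, Eventually.of_forall fun y => ⟨h.rep_mem y _, h.mkQ_rep y _⟩⟩⟩

theorem anchor_red_smooth (hs : h.red.bundle.SmoothAt s x) :
    VFSmoothAt (fun y => h.red.anchor y (s y)) x :=
  (C.canchor_smooth (h.isRep_rep hs).1).congr (Eventually.of_forall fun y => h.anchor_rep y _)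

theorem vfBracket_anchor_mem (hs : h.red.bundle.SmoothAt s x) (ht : h.red.bundle.SmoothAt t x) :
    vfBracket (fun y => h.red.anchor y (s y)) (fun y => h.red.anchor y (t y)) x ∈ T10 I x :=
  h.isComplexStructure.vfBracket_mem_T10 (h.anchor_red_smooth hs) (h.anchor_red_smooth ht)
    (Eventually.of_forall fun y => h.anchor_red_mem y _)
    (Eventually.of_forall fun y => h.anchor_red_mem y _)

theorem anchor_cbracket_rep (hs : h.red.bundle.SmoothAt s x) (ht : h.red.bundle.SmoothAt t x) :
    Cx.map (C.anchor x) (C.cbracket (fun y => h.rep y (s y)) (fun y => h.rep y (t y)) x) =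
      vfBracket (fun y => h.red.anchor y (s y)) (fun y => h.red.anchor y (t y)) x := by
  rw [C.canchor_cbracket (h.isRep_rep hs).1 (h.isRep_rep ht).1]
  simp only [h.anchor_rep]

omit [VectorBundle ℝ F E] in
theorem anchor_lam_eventually {X : ∀ x : M, CT n x} (hX : T01SmoothAt I X x) :
    ∀ᶠ y in 𝓝 x, Cx.map (C.anchor y) (lam y (X y)) = X y :=
  hX.2.mono fun y hy => h.anchor_lam y _ hy

omit [VectorBundle ℝ F E] in
theorem anchor_cbracket_lam {X : ∀ x : M, CT n x} (hX : T01SmoothAt I X x)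
    (hv : CSecSmoothAt n F v x) : Cx.map (C.anchor x) (C.cbracket (fun y => lam y (X y)) v x) =
      vfBracket X (fun y => Cx.map (C.anchor y) (v y)) x := by
  rw [C.canchor_cbracket (h.lam_smooth X x hX.1) hv]
  exact vfBracket_congr (h.anchor_lam_eventually hX) (Eventually.of_forall fun _ => rfl)

/-- The bracket lies in `D` by involutivity, and a vector of `D` is determined by its anchor. That
the lifting preserves brackets is what makes `∂̄` flat. -/
theorem cbracket_lam_lam {X Y : ∀ x : M, CT n x} (hX : T01SmoothAt I X x)
    (hY : T01SmoothAt I Y x) :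
    C.cbracket (fun y => lam y (X y)) (fun y => lam y (Y y)) x = lam x (vfBracket X Y x) := by
  have hm := h.involutive _ _ x (h.lam_smooth X x hX.1) (h.lam_smooth Y x hY.1)
    (hX.2.mono fun y hy => h.lam_mem y _ hy) (hY.2.mono fun y hy => h.lam_mem y _ hy)
  rw [← h.lam_anchor x _ hm, h.anchor_cbracket_lam hX (h.lam_smooth Y x hY.1)]
  exact congrArg (lam x) (vfBracket_congr (Eventually.of_forall fun _ => rfl)
    (h.anchor_lam_eventually hY))

/-- The reduction of an involutive isotropic subbundle is a holomorphic Lie algebroid. -/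
theorem isHolomorphicLieAlgebroid [FiniteDimensional ℝ F] [ContMDiffVectorBundle ∞ F E (𝓡 n)] :
    h.red.IsHolomorphicLieAlgebroid where
  isComplexStructure := h.isComplexStructure
  isVectorBundle := by
    obtain ⟨p, hps, hpm, hpe⟩ := h.isLieSubbundle.exists_proj
    -- With `p` the projection to `L`, the composite `sigma ∘ p` is a smooth idempotent of `E ⊗ ℂ`
    -- whose image is that of `rep`.
    refine (cxFamily_isVectorBundle (n := n) (F := F) (E := E)).of_projection
      (fun x => (h.sigma x).comp (p x)) (fun s x hs => h.sigma_smooth (hps s x hs))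
      (fun x v => ?_) (fun s t x hs ht => CSecSmoothAt.sub hs ht) h.rep h.rep_injective
      (fun x => le_antisymm ?_ ?_) fun s x => h.smoothAt_iff_rep
    · change h.sigma x (p x (h.sigma x (p x v))) = h.sigma x (p x v)
      rw [hpe x _ (h.sigma_mem (hpm x v)), h.sigma_sigma]
    · rintro _ ⟨q, rfl⟩
      refine ⟨h.rep x q, ?_⟩
      change h.sigma x (p x (h.rep x q)) = h.rep x q
      rw [hpe x _ (h.rep_mem x q), ← h.rep_of_mkQ (h.mkQ_rep x q)]
    · rintro _ ⟨v, rfl⟩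
      exact ⟨h.cls x ⟨p x v, hpm x v⟩, h.rep_of_mkQ rfl⟩
  dbar_smooth X s x hX hs := h.smoothAt_iff.mpr ⟨_, IsRep.dbar h hX (h.isRep_rep hs)⟩
  dbar_local X X' s s' x hX hs hXX hss := by
    have hv := h.isRep_rep hs
    refine h.coe_injective x ?_
    have hX' : T01SmoothAt I X' x := ⟨hX.1.congr hXX, by
      filter_upwards [hX.2, hXX] with y h1 h2
      rwa [← h2]⟩
    rw [h.coe_dbar hX hv, h.coe_dbar hX' (IsRep.congr h hv hss),
      C.cbracket_congr (h.lam_smooth X x hX.1) hv.1 (hXX.mono fun y hy => by rw [hy])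
        (Eventually.of_forall fun _ => rfl)]
  dbar_add_left X Y s x hX hY hs := by
    have hv := h.isRep_rep hs
    refine h.coe_injective x ?_
    have hXY : T01SmoothAt I (X + Y) x := ⟨hX.1.add hY.1, by
      filter_upwards [hX.2, hY.2] with y h1 h2
      exact (T01 I y).add_mem h1 h2⟩
    rw [map_add, h.coe_dbar hX hv, h.coe_dbar hY hv, h.coe_dbar hXY hv, ← map_add,
      ← C.cbracket_add_left (h.lam_smooth X x hX.1) (h.lam_smooth Y x hY.1) hv.1]
    simp only [Pi.add_apply, map_add]
  dbar_smul_left f X s x hf hX hs := by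
    have hv := h.isRep_rep hs
    refine h.coe_injective x ?_
    have hfX : T01SmoothAt I (fun y => f y • X y) x :=
      ⟨hX.1.smul hf, hX.2.mono fun y hy => (T01 I y).smul_mem _ hy⟩
    have hlX := h.lam_smooth X x hX.1
    have hD : ∀ᶠ y in 𝓝 x, lam y (X y) ∈ D y := hX.2.mono fun y hy => h.lam_mem y _ hy
    have hL : ∀ᶠ y in 𝓝 x, lam y (X y) ∈ L y := hD.mono fun y hy => h.le y hy
    have hvL : ∀ᶠ y in 𝓝 x, h.rep y (s y) ∈ L y := hv.2.mono fun y hy => hy.1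
    have hz : (D x).mkQ (lam x (X x)) = 0 :=
      (Submodule.Quotient.mk_eq_zero (D x)).mpr hD.self_of_nhds
    rw [map_smul, h.coe_dbar hX hv, h.coe_dbar hfX hv]
    simp only [map_smul]
    -- Swap the arguments, apply the Leibniz rule, swap back. The derivative term is a multiple of
    -- the lift of `X`, which lies in `D` and vanishes in the quotient.
    rw [h.isLieSubbundle.skew (hlX.smul hf) hv.1 (hL.mono fun y hy => (L y).smul_mem _ hy) hvL,
      C.cbracket_leibniz hf hv.1 hlX, h.isLieSubbundle.skew hlX hv.1 hL hvL, map_neg, map_add,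
      map_smul, map_smul, hz, smul_zero, add_zero, map_neg, smul_neg]
  dbar_add_right X s t x hX hs ht := by
    have hv := h.isRep_rep hs
    have hw := h.isRep_rep ht
    refine h.coe_injective x ?_
    rw [map_add, h.coe_dbar hX hv, h.coe_dbar hX hw, h.coe_dbar hX (IsRep.add h hv hw), ← map_add,
      ← C.cbracket_add_right (h.lam_smooth X x hX.1) hv.1 hw.1]
  dbar_leibniz f X s x hf hX hs := by
    have hv := h.isRep_rep hs
    refine h.coe_injective x ?_
    rw [map_add, map_smul, map_smul, h.coe_dbar hX hv, h.coe_dbar hX (IsRep.smul h hf hv),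
      C.cbracket_leibniz hf (h.lam_smooth X x hX.1) hv.1, map_add, map_smul, map_smul, h.mkQ_rep,
      h.anchor_lam x _ hX.2.self_of_nhds]
  dbar_flat X Y s x hX hY hs := by
    have hv := h.isRep_rep hs
    have hlX := h.lam_smooth X x hX.1
    have hlY := h.lam_smooth Y x hY.1
    have hb : ∀ᶠ y in 𝓝 x, C.cbracket (fun y => lam y (X y)) (fun y => lam y (Y y)) y =
        lam y (vfBracket X Y y) := by
      filter_upwards [hX.eventually, hY.eventually] with y h1 h2
      exact h.cbracket_lam_lam h1 h2
    have hbs := C.cbracket_smooth hlX hlY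
    have hXY : T01SmoothAt I (vfBracket X Y) x := by
      refine ⟨(C.canchor_smooth hbs).congr ?_, ?_⟩
      · filter_upwards [hX.eventually, hY.eventually, hb] with y h1 h2 h3
        rw [h3, h.anchor_lam y _ (h.isComplexStructure.integrable X Y y h1 h2)]
      · filter_upwards [hX.eventually, hY.eventually] with y h1 h2
        exact h.isComplexStructure.integrable X Y y h1 h2
    refine h.coe_injective x ?_
    rw [map_sub, h.coe_dbar hX (IsRep.dbar h hY hv), h.coe_dbar hY (IsRep.dbar h hX hv),
      h.coe_dbar hXY hv, C.cbracket_jacobi hlX hlY hv.1,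
      C.cbracket_congr hbs hv.1 hb (Eventually.of_forall fun _ => rfl), map_add, add_sub_cancel_right]
  anchor_mem := h.anchor_red_mem
  anchor_smooth s x hs := h.anchor_red_smooth hs
  anchor_hol X s x hX hs := by
    have hv := h.isRep_rep hs
    rw [h.anchor_of_mkQ (h.coe_dbar hX hv).symm, h.anchor_cbracket_lam hX hv.1]
    simp only [h.anchor_rep]
    rfl
  bracket_hol s t x hs ht := h.holAt_bracket hs ht
  bracket_local s s' t t' x hs ht hss htt := by
    have hv := h.isRep_rep hs.self_of_nhds.1
    have hw := h.isRep_rep ht.self_of_nhds.1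
    -- Holomorphy depends only on the germ; it has to be known for the modified sections before
    -- their bracket can be computed from representatives.
    have hol : ∀ {r r' : ∀ x, h.red.bundle.Fib x}, h.red.HolAt r x → (∀ᶠ y in 𝓝 x, r y = r' y) →
        h.red.HolAt r' x := by
      intro r r' hr hrr
      filter_upwards [HolAt.eventually h hr, eventually_eventually_nhds.mpr hrr] with y h1 h2
      have h3 := h.isRep_rep h1.self_of_nhds.1
      have h4 := IsRep.congr h h3 h2
      refine ⟨h.smoothAt_iff.mpr ⟨_, h4⟩, fun X hX => h.coe_injective y ?_⟩
      rw [h.coe_dbar hX h4, ← h.coe_dbar hX h3, h1.self_of_nhds.2 X hX]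
    refine h.coe_injective x ?_
    rw [h.coe_bracket hs ht hv hw, h.coe_bracket (hol hs hss) (hol ht htt)
      (IsRep.congr h hv hss) (IsRep.congr h hw htt)]
  bracket_add s t u x hs ht hu := by
    have hv := h.isRep_rep hs.self_of_nhds.1
    have hw := h.isRep_rep ht.self_of_nhds.1
    have hz := h.isRep_rep hu.self_of_nhds.1
    have htu : h.red.HolAt (t + u) x := by
      filter_upwards [HolAt.eventually h ht, HolAt.eventually h hu] with y h1 h2
      have h3 := h.isRep_rep h1.self_of_nhds.1
      have h4 := h.isRep_rep h2.self_of_nhds.1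
      have h5 := IsRep.add h h3 h4
      refine ⟨h.smoothAt_iff.mpr ⟨_, h5⟩, fun X hX => h.coe_injective y ?_⟩
      rw [h.coe_dbar hX h5, C.cbracket_add_right (h.lam_smooth X y hX.1) h3.1 h4.1, map_add,
        ← h.coe_dbar hX h3, ← h.coe_dbar hX h4, h1.self_of_nhds.2 X hX, h2.self_of_nhds.2 X hX,
        map_zero, add_zero]
    refine h.coe_injective x ?_
    rw [map_add, h.coe_bracket hs ht hv hw, h.coe_bracket hs hu hv hz,
      h.coe_bracket hs htu hv (IsRep.add h hw hz), C.cbracket_add_right hv.1 hw.1 hz.1, map_add]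
  bracket_skew s t x hs ht := by
    have hv := h.isRep_rep hs.self_of_nhds.1
    have hw := h.isRep_rep ht.self_of_nhds.1
    refine h.coe_injective x ?_
    rw [map_neg, h.coe_bracket hs ht hv hw, h.coe_bracket ht hs hw hv,
      h.isLieSubbundle.skew hv.1 hw.1 (hv.2.mono fun y hy => hy.1) (hw.2.mono fun y hy => hy.1),
      map_neg]
  jacobi s t u x hs ht hu := by
    have hv := h.isRep_rep hs.self_of_nhds.1
    have hw := h.isRep_rep ht.self_of_nhds.1
    have hz := h.isRep_rep hu.self_of_nhds.1
    refine h.coe_injective x ?_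
    rw [map_add,
      h.coe_bracket hs (h.holAt_bracket ht hu) hv (IsRep.bracket h ht hu hw hz),
      h.coe_bracket (h.holAt_bracket hs ht) hu (IsRep.bracket h hs ht hv hw) hz,
      h.coe_bracket ht (h.holAt_bracket hs hu) hw (IsRep.bracket h hs hu hv hz),
      C.cbracket_jacobi hv.1 hw.1 hz.1, map_add]
  leibniz f s t x hf hs ht := by
    have hv := h.isRep_rep hs.self_of_nhds.1
    have hw := h.isRep_rep ht.self_of_nhds.1
    -- The Leibniz rule for `∂̄` leaves only the derivative of `f` along `T_{0,1}`, which vanishes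
    -- as `f` is holomorphic.
    have hft : h.red.HolAt (fun y => f y • t y) x := by
      filter_upwards [HolAt.eventually h ht, hf.1.eventually, eventually_eventually_nhds.mpr hf.2]
        with y h1 h2 h3
      have h4 := h.isRep_rep h1.self_of_nhds.1
      have h5 := IsRep.smul h h2 h4
      refine ⟨h.smoothAt_iff.mpr ⟨_, h5⟩, fun X hX => h.coe_injective y ?_⟩
      have hXy := hX.2.self_of_nhds
      rw [h.coe_dbar hX h5, C.cbracket_leibniz h2 (h.lam_smooth X y hX.1) h4.1, map_add, map_smul,
        ← h.coe_dbar hX h4, h1.self_of_nhds.2 X hX, h.anchor_lam y _ hXy,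
        h3.self_of_nhds _ hXy]
      simp
    refine h.coe_injective x ?_
    rw [map_add, map_smul, map_smul, h.coe_bracket hs ht hv hw,
      h.coe_bracket hs hft hv (IsRep.smul h hf.1 hw), C.cbracket_leibniz hf.1 hv.1 hw.1, map_add,
      map_smul, map_smul, h.mkQ_rep, h.anchor_rep]
  anchor_bracket s t x hs ht := by
    have hs' := hs.self_of_nhds.1
    have ht' := ht.self_of_nhds.1
    -- The projection to `T_{1,0}` in the anchor of the quotient changes nothing here, because the
    -- canonical representatives have anchors in `T_{1,0}`, which is closed under brackets.
    rw [h.anchor_of_mkQ (h.coe_bracket hs ht (h.isRep_rep hs') (h.isRep_rep ht')).symm,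
      h.anchor_cbracket_rep hs' ht', pr10_of_mem_T10 (h.vfBracket_anchor_mem hs' ht')]


end IsReducible

end CourantAlgebroid

/-! ### `L` as the algebroid associated to its reduction. -/

namespace CourantAlgebroid

variable {n : ℕ} {M : Type*} [TopologicalSpace M] [ChartedSpace (EuclideanSpace ℝ (Fin n)) M]
  [IsManifold (𝓡 n) ∞ M] {F : Type*} [NormedAddCommGroup F] [NormedSpace ℝ F] {E : M → Type*}
  [∀ x, AddCommGroup (E x)] [∀ x, Module ℝ (E x)] [∀ x, TopologicalSpace (E x)]
  [TopologicalSpace (Bundle.TotalSpace F E)] [FiberBundle F E]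

namespace IsReducible

variable {C : CourantAlgebroid n F E}
  {I : ∀ x : M, TangentSpace (𝓡 n) x →ₗ[ℝ] TangentSpace (𝓡 n) x}
  {D L : ∀ x, Submodule ℂ (Cx (E x))} {lam : ∀ x : M, CT n x →ₗ[ℂ] Cx (E x)}
  (h : C.IsReducible I D L lam)
include h

/-- The vector of `L` with given class in the reduction and given `T_{0,1}`-part of its anchor. -/
def assocMap (x : M) : h.red.assocBundle.Fib x →ₗ[ℂ] Cx (E x) :=
  (h.rep x).coprod ((lam x).comp (T01 I x).subtype)

theorem assocMap_apply (x : M) (q : h.red.bundle.Fib x) (X : T01 I x) :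
    h.assocMap x (q, X) = h.rep x q + lam x X := rfl

theorem mkQ_assocMap (x : M) (q : h.red.assocBundle.Fib x) :
    (D x).mkQ (h.assocMap x q) = h.coe x q.1 := by
  have h1 : (D x).mkQ (lam x ((T01 I x).subtype q.2)) = 0 :=
    (Submodule.Quotient.mk_eq_zero (D x)).mpr (h.lam_mem x _ q.2.2)
  change (D x).mkQ (h.rep x q.1 + lam x ((T01 I x).subtype q.2)) = _
  rw [map_add, h1, add_zero, h.mkQ_rep]

theorem anchor_assocMap (x : M) (q : h.red.assocBundle.Fib x) :
    Cx.map (C.anchor x) (h.assocMap x q) = h.red.anchor x q.1 + (T01 I x).subtype q.2 := by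
  change Cx.map (C.anchor x) (h.rep x q.1 + lam x ((T01 I x).subtype q.2)) = _
  rw [map_add, h.anchor_rep]
  exact congrArg (h.red.anchor x q.1 + ·) (h.anchor_lam x _ q.2.2)

theorem pr01_anchor_assocMap (x : M) (q : h.red.assocBundle.Fib x) :
    pr01 I x (Cx.map (C.anchor x) (h.assocMap x q)) = (T01 I x).subtype q.2 := by
  rw [h.anchor_assocMap, map_add, pr01_of_mem_T10 (h.anchor_red_mem x _), zero_add]
  exact pr01_of_mem_T01 q.2.2

theorem assocMap_mem (x : M) (q : h.red.assocBundle.Fib x) : h.assocMap x q ∈ L x :=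
  (L x).add_mem (h.rep_mem x q.1) (h.le x (h.lam_mem x _ q.2.2))

/-- The class in the reduction and the `T_{0,1}`-part of the anchor of a vector of `L`. -/
def assocInv (x : M) (v : L x) : h.red.assocBundle.Fib x :=
  (h.cls x v, (⟨pr01 I x (Cx.map (C.anchor x) v), h.isComplexStructure.pr01_mem _⟩ : T01 I x))

theorem assocMap_assocInv (x : M) (v : L x) : h.assocMap x (h.assocInv x v) = v := by
  change h.rep x (h.cls x v) + lam x (pr01 I x (Cx.map (C.anchor x) v)) = v
  rw [h.rep_of_mkQ (h.coe_cls x v).symm, h.sigma_apply, sub_add_cancel]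

/-- Both components can be read off from the image: the first as its class modulo `D`, the second as
the `T_{0,1}`-part of its anchor. -/
theorem assocMap_injective (x : M) : Function.Injective (h.assocMap x) := fun q r hqr => by
  refine Prod.ext (h.coe_injective x ?_) ((T01 I x).injective_subtype ?_)
  · rw [← h.mkQ_assocMap, hqr, h.mkQ_assocMap]
  · rw [← h.pr01_anchor_assocMap, hqr, h.pr01_anchor_assocMap]

/-- The bundle isomorphism from the reduction plus `T_{0,1}` to `L`. -/
def assocEquiv (x : M) : h.red.assocBundle.Fib x ≃ₗ[ℂ] (subFamily n F L).Fib x where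
  toFun q := (⟨h.assocMap x q, h.assocMap_mem x q⟩ : L x)
  invFun := h.assocInv x
  left_inv _ := h.assocMap_injective x (h.assocMap_assocInv x _)
  right_inv v := Subtype.ext (h.assocMap_assocInv x v)
  map_add' q r := Subtype.ext (map_add (h.assocMap x) q r)
  map_smul' c q := Subtype.ext (map_smul (h.assocMap x) c q)

variable [VectorBundle ℝ F E]

/-- For the converse, the image section is itself a smooth representative of the first component,
and the second component is a smooth function of its anchor. -/
theorem assoc_smoothAt_iff (s : ∀ x, h.red.assocBundle.Fib x) (x : M) :
    h.red.assocBundle.SmoothAt s x ↔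
      (subFamily n F L).SmoothAt (fun y => h.assocEquiv y (s y)) x := by
  change _ ↔ CSecSmoothAt n F (fun y => h.assocMap y (s y)) x
  constructor
  · rintro ⟨h1, h2⟩
    exact (h.smoothAt_iff_rep.mp h1).add (h.lam_smooth _ x h2)
  · intro hs
    refine ⟨h.smoothAt_iff.mpr ⟨_, hs, Eventually.of_forall fun y =>
      ⟨h.assocMap_mem y _, h.mkQ_assocMap y _⟩⟩, ?_⟩
    exact (h.isComplexStructure.pr01_smooth (C.canchor_smooth hs)).congr
      (Eventually.of_forall fun y => h.pr01_anchor_assocMap y _)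

variable [FiniteDimensional ℝ F] [ContMDiffVectorBundle ∞ F E (𝓡 n)]

/-- The complex Lie algebroid associated to the reduction, obtained from that of `L`. -/
def assocLieAlgebroid : ComplexLieAlgebroid n h.red.assocBundle :=
  (C.lieAlgebroid h.isLieSubbundle).transport h.assocEquiv h.assoc_smoothAt_iff

theorem assocMap_bracket {s t : ∀ x, h.red.assocBundle.Fib x} {x : M}
    (hs : h.red.assocBundle.SmoothAt s x) (ht : h.red.assocBundle.SmoothAt t x) :
    h.assocMap x (h.assocLieAlgebroid.bracket s t x) =
      C.cbracket (fun y => h.assocMap y (s y)) (fun y => h.assocMap y (t y)) x := by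
  have hs' := (h.assoc_smoothAt_iff s x).mp hs
  have ht' := (h.assoc_smoothAt_iff t x).mp ht
  refine (h.assocMap_assocInv x _).trans (coe_toSub ?_)
  exact h.isLieSubbundle.involutive _ _ x hs' ht' (Eventually.of_forall fun y => h.assocMap_mem y _)
    (Eventually.of_forall fun y => h.assocMap_mem y _)

/-- Each law is checked inside `L`, where the transported bracket is the Courant bracket. Its class
modulo `D` gives the component in the reduction, and the `T_{0,1}`-part of its anchor gives the
other one. -/
theorem isAssociated : h.red.IsAssociated h.assocLieAlgebroid where
  anchor_eq x v X := h.anchor_assocMap x (v, X)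
  bracket_hol s t x hs ht := by
    have hs' := hs.self_of_nhds.1
    have ht' := ht.self_of_nhds.1
    have e : ∀ r : ∀ x, h.red.bundle.Fib x,
        (fun y => h.assocMap y (r y, (0 : T01 I y))) = fun y => h.rep y (r y) := fun r => by
      funext y
      rw [h.assocMap_apply]
      simp
    have z : VFSmoothAt (fun y : M => (0 : CT n y)) x :=
      csecSmoothAt_zero (E := (TangentSpace (𝓡 n) : M → Type _)) x
    have hb := h.assocMap_bracket (s := fun y => (s y, (0 : T01 I y)))
      (t := fun y => (t y, (0 : T01 I y))) ⟨hs', z⟩ ⟨ht', z⟩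
    rw [e s, e t] at hb
    refine Prod.ext (h.coe_injective x ?_) ((T01 I x).injective_subtype ?_)
    · rw [← h.mkQ_assocMap]
      exact (congrArg _ hb).trans
        (h.coe_bracket hs ht (h.isRep_rep hs') (h.isRep_rep ht')).symm
    -- No `T_{0,1}`-component arises: canonical representatives have anchors in `T_{1,0}`, and so do
    -- their brackets.
    · refine (h.pr01_anchor_assocMap x _).symm.trans ?_
      refine (congrArg (fun w => pr01 I x (Cx.map (C.anchor x) w)) hb).trans ?_
      simp only [h.anchor_cbracket_rep hs' ht']
      exact pr01_of_mem_T10 (h.vfBracket_anchor_mem hs' ht')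
  bracket_T01 X Y x hX hY := by
    have e : ∀ Z : ∀ x, T01 I x,
        (fun y => h.assocMap y ((0 : h.red.bundle.Fib y), Z y)) = fun y => lam y (Z y) := fun Z => by
      funext y
      rw [h.assocMap_apply]
      simp
    have z : h.red.bundle.SmoothAt (fun y => 0) x := h.smoothAt_iff_rep.mpr (by
      simpa only [map_zero] using csecSmoothAt_zero x)
    have hb := h.assocMap_bracket (s := fun y => ((0 : h.red.bundle.Fib y), X y))
      (t := fun y => ((0 : h.red.bundle.Fib y), Y y)) ⟨z, hX⟩ ⟨z, hY⟩
    have hX' : T01SmoothAt I (fun y => (X y : CT n y)) x := ⟨hX, Eventually.of_forall fun y => (X y).2⟩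
    have hY' : T01SmoothAt I (fun y => (Y y : CT n y)) x := ⟨hY, Eventually.of_forall fun y => (Y y).2⟩
    have hm := h.isComplexStructure.integrable _ _ x hX' hY'
    rw [e X, e Y, h.cbracket_lam_lam hX' hY'] at hb
    constructor
    · refine h.coe_injective x ?_
      rw [← h.mkQ_assocMap, map_zero]
      -- The bracket of two lifts is again a lift, hence zero modulo `D`.
      exact (congrArg _ hb).trans ((Submodule.Quotient.mk_eq_zero (D x)).mpr (h.lam_mem x _ hm))
    · refine (h.pr01_anchor_assocMap x _).symm.trans ?_
      refine (congrArg (fun w => pr01 I x (Cx.map (C.anchor x) w)) hb).trans ?_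
      simp only [h.anchor_lam x _ hm]
      exact pr01_of_mem_T01 hm
  bracket_mixed X s x hX hs := by
    have hX' : T01SmoothAt I (fun y => (X y : CT n y)) x := ⟨hX, Eventually.of_forall fun y => (X y).2⟩
    have z1 : VFSmoothAt (fun y : M => (0 : CT n y)) x :=
      csecSmoothAt_zero (E := (TangentSpace (𝓡 n) : M → Type _)) x
    have z : h.red.bundle.SmoothAt (fun y => 0) x := h.smoothAt_iff_rep.mpr (by
      simpa only [map_zero] using csecSmoothAt_zero x)
    have e1 : (fun y => h.assocMap y ((0 : h.red.bundle.Fib y), X y)) = fun y => lam y (X y) := by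
      funext y
      refine (h.assocMap_apply y 0 (X y)).trans ?_
      simp
    have e2 : (fun y => h.assocMap y (s y, (0 : T01 I y))) = fun y => h.rep y (s y) := by
      funext y
      rw [h.assocMap_apply]
      simp
    have hb := h.assocMap_bracket (s := fun y => ((0 : h.red.bundle.Fib y), X y))
      (t := fun y => (s y, (0 : T01 I y))) ⟨z, hX⟩ ⟨hs, z1⟩
    rw [e1, e2] at hb
    constructor
    · refine h.coe_injective x ?_
      rw [← h.mkQ_assocMap]
      exact (congrArg _ hb).trans (h.coe_dbar hX' (h.isRep_rep hs)).symm
    · refine (h.pr01_anchor_assocMap x _).symm.trans ?_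
      refine (congrArg (fun w => pr01 I x (Cx.map (C.anchor x) w)) hb).trans ?_
      simp only [h.anchor_cbracket_lam hX' (h.isRep_rep hs).1, h.anchor_rep]
      rfl

/-- The associated complex Lie algebroid of the reduction is isomorphic to `L`. -/
def assocIso : h.assocLieAlgebroid.Iso (C.lieAlgebroid h.isLieSubbundle) :=
  ComplexLieAlgebroid.transportIso _ _ _

end IsReducible

/-- Complex conjugation, from a Lie subbundle to the complex conjugate of its conjugate. -/
def conjIso [VectorBundle ℝ F E] [FiniteDimensional ℝ F] [ContMDiffVectorBundle ∞ F E (𝓡 n)]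
    {C : CourantAlgebroid n F E} {L L' : ∀ x, Submodule ℂ (Cx (E x))} (h : C.IsLieSubbundle L)
    (h' : C.IsLieSubbundle L') (hc : ∀ x v, v ∈ L x ↔ Cx.conj v ∈ L' x) :
    (C.lieAlgebroid h).Iso (C.lieAlgebroid h').conj where
  toEquiv x :=
    { toFun := fun v : L x => (⟨Cx.conj v, (hc x _).mp v.2⟩ : L' x)
      invFun := fun v : L' x => (⟨Cx.conj v, (hc x _).mpr (by simp)⟩ : L x)
      left_inv := fun v => Subtype.ext (Cx.conj_conj _)
      right_inv := fun v => Subtype.ext (Cx.conj_conj _)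
      map_add' := fun v w => Subtype.ext (Cx.conj_add _ _)
      map_smul' := fun c v => Subtype.ext (Cx.conj_smul _ _) }
  smooth_iff s x := by
    refine ⟨fun hs => CSecSmoothAt.conj hs, fun hs => ?_⟩
    have := CSecSmoothAt.conj hs
    exact this.congr (Eventually.of_forall fun y => Cx.conj_conj _)
  anchor_eq x v := by
    -- The conjugate algebroid conjugates the anchor once more, which undoes the conjugation of the
    -- vector.
    refine (congrArg Cx.conj (Cx.map_conj (C.anchor x) _)).trans (Cx.conj_conj _)
  bracket_eq s t x hs ht := Subtype.ext <| by
    have hL : ∀ u : ∀ x, L x, ∀ᶠ y in 𝓝 x, (u y : Cx (E y)) ∈ L y := fun u =>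
      Eventually.of_forall fun y => (u y).2
    refine (congrArg Cx.conj (coe_toSub (h.involutive _ _ x hs ht (hL s) (hL t)))).trans ?_
    refine (C.cbracket_conj hs ht).symm.trans (coe_toSub ?_).symm
    exact h'.involutive _ _ x (CSecSmoothAt.conj hs) (CSecSmoothAt.conj ht)
      ((hL s).mono fun y hy => (hc y _).mp hy) ((hL t).mono fun y hy => (hc y _).mp hy)

end CourantAlgebroid

/-! ### Eigenbundles of generalized complex structures. -/

namespace Cx

variable {V : Type*} [AddCommGroup V] [Module ℝ V]

theorem pair_map_map {B : V →ₗ[ℝ] V →ₗ[ℝ] ℝ} {J : V →ₗ[ℝ] V} (hJ : ∀ v w, B (J v) (J w) = B v w)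
    (v w : Cx V) : pair B (map J v) (map J w) = pair B v w := by
  simp [pair, hJ]

theorem map_map_of_sq {J : V →ₗ[ℝ] V} (hJ : ∀ v, J (J v) = -v) (v : Cx V) :
    map J (map J v) = -v := by
  ext1 <;> simp [hJ]

end Cx

namespace CourantAlgebroid

variable {n : ℕ} {M : Type*} [TopologicalSpace M] [ChartedSpace (EuclideanSpace ℝ (Fin n)) M]
  [IsManifold (𝓡 n) ∞ M] {F : Type*} [NormedAddCommGroup F] [NormedSpace ℝ F] {E : M → Type*}
  [∀ x, AddCommGroup (E x)] [∀ x, Module ℝ (E x)] [∀ x, TopologicalSpace (E x)]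
  [TopologicalSpace (Bundle.TotalSpace F E)] [FiberBundle F E]

omit [TopologicalSpace M] [∀ x, TopologicalSpace (E x)] in
theorem mem_eigen_iff {J : ∀ x, E x →ₗ[ℝ] E x} {c : ℂ} {x : M} {v : Cx (E x)} :
    v ∈ eigen J c x ↔ Cx.map (J x) v = c • v := by
  rw [← sub_eq_zero]
  exact LinearMap.mem_ker

omit [TopologicalSpace M] [∀ x, TopologicalSpace (E x)] in
theorem conj_mem_eigen_iff {J : ∀ x, E x →ₗ[ℝ] E x} {c : ℂ} {x : M} {v : Cx (E x)} :
    Cx.conj v ∈ eigen J ((starRingEnd ℂ) c) x ↔ v ∈ eigen J c x := by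
  rw [mem_eigen_iff, mem_eigen_iff, Cx.map_conj, ← Cx.conj_smul]
  exact (Function.LeftInverse.injective (g := Cx.conj) Cx.conj_conj).eq_iff

namespace GeneralizedComplex

variable [VectorBundle ℝ F E] {C : CourantAlgebroid n F E} (J : C.GeneralizedComplex)

/-- The `-i`-eigenbundle is the conjugate of the `+i`-eigenbundle, and conjugation preserves the
bracket. -/
theorem involutive_neg : C.Involutive (eigen J.J (-Complex.I)) := by
  intro s t x hs ht hsL htL
  have hc : ∀ (y : M) (v : Cx (E y)), v ∈ eigen J.J (-Complex.I) y ↔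
      Cx.conj v ∈ eigen J.J Complex.I y := fun y v => by
    rw [← conj_mem_eigen_iff]
    simp
  rw [hc, ← C.cbracket_conj hs ht]
  exact J.involutive _ _ x hs.conj ht.conj (hsL.mono fun y hy => (hc y _).mp hy)
    (htL.mono fun y hy => (hc y _).mp hy)

/-- The eigenbundles of a generalized complex structure are Lie subbundles. -/
theorem isLieSubbundle {c : ℂ} (hc : c = Complex.I ∨ c = -Complex.I) :
    C.IsLieSubbundle (eigen J.J c) where
  isotropic x v w hv hw := by
    have hcc : c * c = -1 := by rcases hc with rfl | rfl <;> simp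
    -- Orthogonality gives `⟨v, w⟩ = c²⟨v, w⟩ = -⟨v, w⟩`.
    have h1 := Cx.pair_map_map (J.orthogonal x) v w
    rw [mem_eigen_iff.mp hv, mem_eigen_iff.mp hw, Cx.pair_smul_left, Cx.pair_smul_right,
      ← mul_assoc, hcc] at h1
    linear_combination (-1 / 2 : ℂ) * h1
  involutive := by
    rcases hc with rfl | rfl
    · exact J.involutive
    · exact J.involutive_neg
  exists_proj := by
    have hcc : c * c = -1 := by rcases hc with rfl | rfl <;> simp
    -- The spectral projection of `J` for the eigenvalue `c`, since `c⁻¹ = -c`.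
    refine ⟨fun x => (1 / 2 : ℂ) • (LinearMap.id - c • Cx.map (J.J x)), fun s x hs => ?_,
      fun x v => ?_, fun x v hv => ?_⟩
    · exact (hs.sub ((hs.map J.smooth).const_smul c)).const_smul (1 / 2)
    · rw [mem_eigen_iff]
      simp only [LinearMap.smul_apply, LinearMap.sub_apply, LinearMap.id_apply, map_smul, map_sub,
        Cx.map_map_of_sq (J.sq x)]
      have : c • c • Cx.map (J.J x) v = -Cx.map (J.J x) v := by
        rw [smul_smul, hcc, neg_one_smul]
      rw [smul_comm c (1 / 2 : ℂ), smul_sub c, this]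
      module
    · rw [mem_eigen_iff] at hv
      simp only [LinearMap.smul_apply, LinearMap.sub_apply, LinearMap.id_apply, hv]
      rw [smul_smul c, hcc]
      module

end GeneralizedComplex

/-! ### Generalized Kähler structures: `C_±`, `ℓ̄_±` and the complex structures `I_±`. -/

namespace GeneralizedKahler

variable {C : CourantAlgebroid n F E} (K : C.GeneralizedKahler) (ε : ℤˣ)

omit K in
theorem units_mul_self (ε : ℤˣ) : ((ε : ℤ) : ℝ) * ((ε : ℤ) : ℝ) = 1 := by
  rcases Int.units_eq_one_or ε with h | h <;> simp [h]

/-- The inverse of the projection `C_± → TM`. -/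
def lift (x : M) : TangentSpace (𝓡 n) x →ₗ[ℝ] E x :=
  (K.Cpm ε x).subtype.comp
    (LinearEquiv.ofBijective _ (K.anchorCpm_bijective ε x)).symm.toLinearMap

theorem lift_mem (x : M) (v : TangentSpace (𝓡 n) x) : K.lift ε x v ∈ K.Cpm ε x :=
  Subtype.coe_prop _

theorem anchor_lift (x : M) (v : TangentSpace (𝓡 n) x) : C.anchor x (K.lift ε x v) = v :=
  (LinearEquiv.ofBijective _ (K.anchorCpm_bijective ε x)).apply_symm_apply v

variable {ε} in
theorem eq_of_mem_Cpm {x : M} {e e' : E x} (he : e ∈ K.Cpm ε x) (he' : e' ∈ K.Cpm ε x)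
    (h : C.anchor x e = C.anchor x e') : e = e' := by
  rw [← sub_eq_zero]
  refine K.eq_zero_of_mem_Cpm ((K.Cpm ε x).sub_mem he he') ?_
  rw [map_sub, h, sub_self]

variable {ε} in
theorem lift_anchor {x : M} {e : E x} (he : e ∈ K.Cpm ε x) : K.lift ε x (C.anchor x e) = e :=
  K.eq_of_mem_Cpm (K.lift_mem ε x _) he (K.anchor_lift ε x _)

variable {ε} in
theorem Jp_mem {x : M} {e : E x} (he : e ∈ K.Cpm ε x) : K.Jp.J x e ∈ K.Cpm ε x := by
  rw [mem_Cpm] at he ⊢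
  rw [← K.commute, he, map_neg, map_smul]

variable {ε} in
theorem Jm_eq {x : M} {e : E x} (he : e ∈ K.Cpm ε x) :
    K.Jm.J x e = ((ε : ℤ) : ℝ) • K.Jp.J x e := by
  rw [mem_Cpm] at he
  have := congrArg (K.Jp.J x) he
  rw [K.Jp.sq, map_neg, map_smul] at this
  exact neg_injective this

theorem cplx_apply (x : M) (v : TangentSpace (𝓡 n) x) :
    K.cplx ε x v = C.anchor x (K.Jp.J x (K.lift ε x v)) := rfl

theorem cplx_cplx (x : M) (v : TangentSpace (𝓡 n) x) : K.cplx ε x (K.cplx ε x v) = -v := by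
  rw [K.cplx_apply ε x v, K.cplx_anchor (K.Jp_mem (K.lift_mem ε x v)), K.Jp.sq, map_neg,
    K.anchor_lift]

variable {ε} in
-- On `C_±` one has `J₋ = ±J₊`, so the two eigenvalue conditions together say exactly that the
-- vector lies in `C_± ⊗ ℂ` and in the `-i`-eigenspace of `J₊`.
theorem mem_ellBar_iff {x : M} {d : Cx (E x)} :
    d ∈ K.ellBar ε x ↔ d.re ∈ K.Cpm ε x ∧ d.im ∈ K.Cpm ε x ∧ K.Jp.J x d.re = d.im ∧
      K.Jp.J x d.im = -d.re := by
  have hε := units_mul_self ε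
  rw [ellBar, Submodule.mem_inf, mem_eigen_iff, mem_eigen_iff, Cx.ext_iff, Cx.ext_iff]
  simp only [Cx.map_re, Cx.map_im, Cx.smul_re, Cx.smul_im, Complex.neg_re, Complex.neg_im,
    Complex.I_re, Complex.I_im, Complex.mul_re, Complex.mul_im, Complex.intCast_re,
    Complex.intCast_im]
  simp only [neg_zero, zero_smul, zero_sub, neg_smul, one_smul, neg_neg, zero_add, mul_zero,
    mul_one, sub_zero, add_zero]
  constructor
  · rintro ⟨⟨p1, p2⟩, m1, m2⟩
    refine ⟨?_, ?_, p1, p2⟩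
    · rw [mem_Cpm, m1, map_smul, p2, smul_neg]
    · rw [mem_Cpm, m2, map_neg, map_smul, p1]
  · rintro ⟨c1, c2, p1, p2⟩
    refine ⟨⟨p1, p2⟩, ?_, ?_⟩
    · rw [K.Jm_eq c1, p1]
    · rw [K.Jm_eq c2, p2, smul_neg]

/-- The lift `TM → C_±` intertwines `I_±` with `J₊`: both sides lie in `C_±` and have the same
anchor. So it carries `T_{0,1}` into `ℓ̄_±`. -/
theorem map_lift_mem {x : M} {v : CT n x} (hv : v ∈ T01 (K.cplx ε) x) :
    Cx.map (K.lift ε x) v ∈ K.ellBar ε x := by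
  rw [mem_T01_iff, Cx.ext_iff] at hv
  simp only [Cx.map_re, Cx.map_im, Cx.neg_re, Cx.neg_im, Cx.smul_re, Cx.smul_im, Complex.I_re,
    Complex.I_im, zero_smul, one_smul, zero_sub, neg_neg, zero_add] at hv
  rw [mem_ellBar_iff]
  refine ⟨K.lift_mem ε x _, K.lift_mem ε x _, ?_, ?_⟩
  · refine K.eq_of_mem_Cpm (K.Jp_mem (K.lift_mem ε x _)) (K.lift_mem ε x _) ?_
    rw [Cx.map_re, Cx.map_im, K.anchor_lift, ← hv.1, K.cplx_apply]
  · refine K.eq_of_mem_Cpm (K.Jp_mem (K.lift_mem ε x _))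
      ((K.Cpm ε x).neg_mem (K.lift_mem ε x _)) ?_
    rw [Cx.map_re, Cx.map_im, map_neg, K.anchor_lift, ← hv.2, K.cplx_apply]

theorem map_anchor_map_lift (x : M) (v : CT n x) :
    Cx.map (C.anchor x) (Cx.map (K.lift ε x) v) = v := by
  ext1
  · exact K.anchor_lift ε x _
  · exact K.anchor_lift ε x _

/-- The orthogonal projection to `C_±`. -/
def projCpm (x : M) : E x →ₗ[ℝ] E x :=
  (1 / 2 : ℝ) • (LinearMap.id - ((ε : ℤ) : ℝ) • (K.Jp.J x).comp (K.Jm.J x))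

theorem projCpm_apply (x : M) (e : E x) : K.projCpm ε x e =
    (1 / 2 : ℝ) • (e - ((ε : ℤ) : ℝ) • K.Jp.J x (K.Jm.J x e)) := rfl

theorem projCpm_mem (x : M) (e : E x) : K.projCpm ε x e ∈ K.Cpm ε x := by
  have h1 : K.Jp.J x (K.Jm.J x (K.Jp.J x (K.Jm.J x e))) = e := by
    rw [K.commute x (K.Jp.J x (K.Jm.J x e)), K.Jp.sq, map_neg, K.Jm.sq, neg_neg]
  rw [mem_Cpm, projCpm_apply]
  have h2 : ∀ w : E x, ((ε : ℤ) : ℝ) • ((ε : ℤ) : ℝ) • w = w := fun w => by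
    rw [smul_smul, units_mul_self, one_smul]
  simp only [map_smul, map_sub, h1]
  rw [smul_comm ((ε : ℤ) : ℝ) (1 / 2 : ℝ), smul_sub ((ε : ℤ) : ℝ), h2]
  module

variable {ε} in
theorem projCpm_of_mem {x : M} {e : E x} (he : e ∈ K.Cpm ε x) : K.projCpm ε x e = e := by
  rw [projCpm_apply, K.mem_Cpm.mp he, smul_neg, smul_smul, units_mul_self, one_smul]
  module

variable [VectorBundle ℝ F E]

theorem projCpm_smooth (s : ∀ x, E x) (x : M) (hs : SecSmoothAt n F s x) :
    SecSmoothAt n F (fun y => K.projCpm ε y (s y)) x :=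
  (hs.sub ((K.Jp.smooth _ x (K.Jm.smooth s x hs)).smul (fnSmoothAt_const _ x))).smul
    (fnSmoothAt_const _ x)

/-- The inverse of the bundle isomorphism `C_± → TM` is smooth. -/
theorem map_lift_smooth [FiniteDimensional ℝ F] [ContMDiffVectorBundle ∞ F E (𝓡 n)]
    {X : ∀ x : M, CT n x} {x : M} (hX : VFSmoothAt X x) :
    CSecSmoothAt n F (fun y => Cx.map (K.lift ε y) (X y)) x := by
  obtain ⟨k, e, he'⟩ := cxFamily_isVectorBundle (n := n) (F := EuclideanSpace ℝ (Fin n))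
    (E := (TangentSpace (𝓡 n) : M → Type _)) x
  obtain ⟨l, g, hg'⟩ := cxFamily_isVectorBundle (n := n) (F := F) (E := E) x
  have he : (cxFamily n (EuclideanSpace ℝ (Fin n))
    (TangentSpace (𝓡 n) : M → Type _)).IsFrameNear n e x := he'
  have hg : (cxFamily n F E).IsFrameNear n g x := hg'
  -- The lifts of the frame vectors of `TM` at the single point `x` are extended to smooth sections
  -- of `E ⊗ ℂ` with constant coefficients.
  let a : Fin k → Fin l → ℂ := fun i => hg.basis.repr (Cx.map (K.lift ε x) (e i x))
  let w : Fin k → ∀ y, Cx (E y) := fun i y => ∑ j, a i j • (g j y : Cx (E y))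
  have hw : ∀ i, CSecSmoothAt n F (w i) x := fun i => (hg.smoothAt_iff (w i)).mpr
    ⟨fun j _ => a i j, fun j => fnSmoothAt_const _ _, Eventually.of_forall fun _ => rfl⟩
  have hwx : ∀ i, w i x = Cx.map (K.lift ε x) (e i x) := fun i => by
    have h1 := hg.basis.sum_repr (Cx.map (K.lift ε x) (e i x))
    simp only [hg.basis_apply] at h1
    exact h1
  -- Projecting makes these extensions sections of `C_± ⊗ ℂ` at every point without changing their
  -- values at `x`.
  let u : Fin k → ∀ y, Cx (E y) := fun i y => Cx.map (K.projCpm ε y) (w i y)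
  have hu : ∀ i, CSecSmoothAt n F (u i) x := fun i => (hw i).map (K.projCpm_smooth ε)
  have hux : ∀ i, Cx.map (C.anchor x) (u i x) = e i x := fun i => by
    have h1 : u i x = Cx.map (K.lift ε x) (e i x) := by
      simp only [u, hwx]
      ext1
      · exact K.projCpm_of_mem (K.lift_mem ε x _)
      · exact K.projCpm_of_mem (K.lift_mem ε x _)
    rw [h1]
    exact K.map_anchor_map_lift ε x _
  have hlu : ∀ i y, Cx.map (K.lift ε y) (Cx.map (C.anchor y) (u i y)) = u i y := fun i y => by
    ext1
    · exact K.lift_anchor (K.projCpm_mem ε y _)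
    · exact K.lift_anchor (K.projCpm_mem ε y _)
  -- The anchors of the `u i` agree with the frame `e` at `x`, so they are a frame of `TM ⊗ ℂ` near
  -- `x`. The lift sends this frame to the smooth sections `u i`, hence sends smooth coefficients to
  -- a smooth section.
  have hframe := he.of_basis (fun i y => Cx.map (C.anchor y) (u i y))
    (fun i => C.canchor_smooth (hu i)) he.basis (fun i => (he.basis_apply i).trans (hux i).symm)
  obtain ⟨f, hf, hXf⟩ := (hframe.smoothAt_iff X).mp hX
  refine (CSecSmoothAt.finset_sum Finset.univ fun i => (hu i).smul (hf i)).congr ?_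
  filter_upwards [hXf] with y hy
  have h1 : Cx.map (K.lift ε y) (X y) =
      Cx.map (K.lift ε y) (∑ i, f i y • Cx.map (C.anchor y) (u i y)) := congrArg _ hy
  rw [h1, map_sum]
  simp only [map_smul, hlu]

omit [VectorBundle ℝ F E] in
theorem neg_units_mul_I (ε : ℤˣ) : -(((ε : ℤ) : ℂ) * Complex.I) = Complex.I ∨
    -(((ε : ℤ) : ℂ) * Complex.I) = -Complex.I := by
  rcases Int.units_eq_one_or ε with h | h <;> simp [h]

/-- An intersection of two involutive families is involutive. -/
theorem involutive_ellBar : C.Involutive (K.ellBar ε) := fun s t x hs ht hsL htL =>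
  ⟨(K.Jp.isLieSubbundle (Or.inr rfl)).involutive s t x hs ht (hsL.mono fun _ h => h.1)
      (htL.mono fun _ h => h.1),
    (K.Jm.isLieSubbundle (neg_units_mul_I ε)).involutive s t x hs ht (hsL.mono fun _ h => h.2)
      (htL.mono fun _ h => h.2)⟩

variable [FiniteDimensional ℝ F] [ContMDiffVectorBundle ∞ F E (𝓡 n)]

/-- Integrability is inherited from `ℓ̄_±`: vector fields in `T_{0,1}` lift to sections of it, their
bracket stays in it, and the anchor preserves brackets. -/
theorem isComplexStructure_cplx : IsComplexStructure (K.cplx ε) where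
  smooth _ x hX := C.canchor_smooth ((K.map_lift_smooth ε hX).map K.Jp.smooth)
  sq := K.cplx_cplx ε
  integrable X Y x hX hY := by
    have h1 := K.involutive_ellBar ε _ _ x (K.map_lift_smooth ε hX.1) (K.map_lift_smooth ε hY.1)
      (hX.2.mono fun y hy => K.map_lift_mem ε hy) (hY.2.mono fun y hy => K.map_lift_mem ε hy)
    have h2 := K.anchor_ellBar ε x _ h1
    rw [C.canchor_cbracket (K.map_lift_smooth ε hX.1) (K.map_lift_smooth ε hY.1)] at h2
    simpa only [K.map_anchor_map_lift] using h2

/-- The required smooth extension of the inverse of `ℓ̄_± → T_{0,1}` is the complexified inverse of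
`C_± → TM`, which is defined on all of `TM ⊗ ℂ`. -/
theorem isReducible {L : ∀ x, Submodule ℂ (Cx (E x))} (hL : C.IsLieSubbundle L)
    (hle : ∀ x, K.ellBar ε x ≤ L x) :
    C.IsReducible (K.cplx ε) (K.ellBar ε) L fun x => Cx.map (K.lift ε x) where
  isComplexStructure := K.isComplexStructure_cplx ε
  isLieSubbundle := hL
  le := hle
  involutive := K.involutive_ellBar ε
  anchor_mem := K.anchor_ellBar ε
  lam_smooth _ _ hX := K.map_lift_smooth ε hX
  lam_mem _ _ hv := K.map_lift_mem ε hv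
  anchor_lam x v _ := K.map_anchor_map_lift ε x v
  lam_anchor x d hd := by
    obtain ⟨h1, h2, -, -⟩ := K.mem_ellBar_iff.mp hd
    ext1
    · exact K.lift_anchor h1
    · exact K.lift_anchor h2

theorem isReducible_Jp : C.IsReducible (K.cplx ε) (K.ellBar ε) (eigen K.Jp.J (-Complex.I))
    fun x => Cx.map (K.lift ε x) :=
  K.isReducible ε (K.Jp.isLieSubbundle (Or.inr rfl)) fun _ => inf_le_left

theorem isReducible_Jm : C.IsReducible (K.cplx ε) (K.ellBar ε)
    (eigen K.Jm.J (-(((ε : ℤ) : ℂ) * Complex.I))) fun x => Cx.map (K.lift ε x) :=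
  K.isReducible ε (K.Jm.isLieSubbundle (neg_units_mul_I ε)) fun _ => inf_le_right

end GeneralizedKahler

end CourantAlgebroid

end

/-- Let `(J₊, J₋)` be a generalized Kähler structure on an exact Courant algebroid over `M`. The
reductions `𝓐_±`, `𝓑_±` are holomorphic Lie algebroids over the complex manifolds
`X_± = (M, I_±)`; `𝓐₊` is Morita equivalent to `𝓐₋`, and `𝓑₊` is Morita conjugate to `𝓑₋`. -/
theorem mainTheorem6 {n : ℕ} {M : Type*} [TopologicalSpace M] [T2Space M]
    [SecondCountableTopology M] [ChartedSpace (EuclideanSpace ℝ (Fin n)) M]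
    [IsManifold (𝓡 n) ∞ M] {F : Type*} [NormedAddCommGroup F] [NormedSpace ℝ F]
    [FiniteDimensional ℝ F] {E : M → Type*} [∀ x, AddCommGroup (E x)] [∀ x, Module ℝ (E x)]
    [∀ x, TopologicalSpace (E x)] [TopologicalSpace (Bundle.TotalSpace F E)] [FiberBundle F E]
    [VectorBundle ℝ F E] [ContMDiffVectorBundle ∞ F E (𝓡 n)]
    (C : CourantAlgebroid n F E) (K : C.GeneralizedKahler) :
    (∀ ε : ℤˣ, (K.diracA ε).IsHolomorphicLieAlgebroid ∧
      (K.diracB ε).IsHolomorphicLieAlgebroid) ∧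
    (K.diracA 1).MoritaEquivalent (K.diracA (-1)) ∧
    (K.diracB 1).MoritaConjugate (K.diracB (-1)) := by
  refine ⟨fun ε => ⟨(K.isReducible_Jp ε).isHolomorphicLieAlgebroid,
    (K.isReducible_Jm ε).isHolomorphicLieAlgebroid⟩, ?_, ?_⟩
  -- Only the lifting `ℓ̄_±` depends on the sign; the subbundle reduced is the `-i`-eigenbundle of
  -- `J₊` in both cases, and it is the middle term of the composite.
  · exact ⟨_, _, (K.isReducible_Jp 1).isAssociated, (K.isReducible_Jp (-1)).isAssociated,
      ⟨(K.isReducible_Jp 1).assocIso.trans (K.isReducible_Jp (-1)).assocIso.symm⟩⟩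
  -- Now the subbundles are the `-i`- and the `+i`-eigenbundle of `J₋`, so conjugation is inserted
  -- between the two identifications. What remains is that it exchanges these eigenbundles.
  · refine ⟨_, _, (K.isReducible_Jm 1).isAssociated, (K.isReducible_Jm (-1)).isAssociated,
      ⟨((K.isReducible_Jm 1).assocIso.trans (CourantAlgebroid.conjIso _ _ fun x v => ?_)).trans
        (K.isReducible_Jm (-1)).assocIso.conj.symm⟩⟩
    rw [← CourantAlgebroid.conj_mem_eigen_iff]
    simp
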